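/- **Setting.** Let $\mathsf G=(\mathsf V,\mathsf E)$ be a finite oriented graph without loops; each edge $\mathsf e$ carries $k_{\mathsf e}\in\{1,2,\dots\}$ and $\ell_{\mathsf e}>0$ and is identified with $[0,\ell_{\mathsf e}]$, its initial endpoint being $0$ and its terminal endpoint $\ell_{\mathsf e}$. Let $\mathsf E_{\mathsf v}$ be the set of edges incident in $\mathsf v$, $k=\sum_{\mathsf e}k_{\mathsf e}$, $k_{\mathsf v}=\sum_{\mathsf e\in\mathsf E_{\mathsf v}}k_{\mathsf e}$, and let $\iota_{\mathsf v\mathsf e}=1$, $-1$ or $0$ if $\mathsf v$ is the terminal endpoint, the initial endpoint, or no endpoint of $\mathsf e$. For every $\mathsf e$ let $M_{\mathsf e},N_{\mathsf e},Q_{\mathsf e}:[0,\ell_{\mathsf e}]\to M_{k_{\mathsf e}}(\mathbb C)$ be such that $M_{\mathsf e}$ is Lipschitz continuous with invertible values, $N_{\mathsf e}\in L^\infty$, $Q_{\mathsf e}$ is Lipschitz continuous and uniformly positive definite, and $Q_{\mathsf e}(x)$, $Q_{\mathsf e}(x)M_{\mathsf e}(x)$ are Hermitian for all $x$. For every $\mathsf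 v$ let $Y^{(d)}_{\mathsf v}\subset Y_{\mathsf v}\subset\mathbb C^{k_{\mathsf v}}$ be subspaces, $B_{\mathsf v}:Y_{\mathsf v}\to Y^{(d)}_{\mathsf v}$, $C_{\mathsf v}:Y^{(d)}_{\mathsf v}\to Y^{(d)}_{\mathsf v}$ linear, and $Q_{\mathsf v}$ a Hermitian positive definite operator on $Y^{(d)}_{\mathsf v}$. Adjoints and orthogonality in these spaces are Euclidean; $P^{(d)}_{\mathsf v}$ is the orthogonal projector of $\mathbb C^{k_{\mathsf v}}$ onto $Y^{(d)}_{\mathsf v}$ and $P^{(d),\perp}_{\mathsf v}$ the one onto the orthogonal complement of $Y^{(d)}_{\mathsf v}$ in $Y_{\mathsf v}$. For $u\in\bigoplus_{\mathsf e}H^1(0,\ell_{\mathsf e})^{k_{\mathsf e}}$ put $\gamma_{\mathsf v}(u)=(u_{\mathsf e}(\mathsf v))_{\mathsf e\in\mathsf E_{\mathsf v}}\in\mathbb C^{k_{\mathsf v}}$, and let $T_{\mathsf v}=\operatorname{diag}(\iota_{\mathsf v\mathsf e}Q_{\mathsf e}(\mathsf v)M_{\mathsf e}(\mathsf v))_{\mathsf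 e\in\mathsf E_{\mathsf v}}$. On $\mathbf L^2_d=\bigoplus_{\mathsf e}L^2(0,\ell_{\mathsf e})^{k_{\mathsf e}}\oplus\bigoplus_{\mathsf v}Y^{(d)}_{\mathsf v}$ let $$\mathbb A\binom{u}{\mathsf x}=\binom{(M_{\mathsf e}u_{\mathsf e}'+N_{\mathsf e}u_{\mathsf e})_{\mathsf e}}{(B_{\mathsf v}\gamma_{\mathsf v}(u)+C_{\mathsf v}\mathsf x_{\mathsf v})_{\mathsf v}},$$ $$D(\mathbb A)=\Big\{\tbinom{u}{\mathsf x}:u\in\bigoplus_{\mathsf e}H^1(0,\ell_{\mathsf e})^{k_{\mathsf e}},\ \gamma_{\mathsf v}(u)\in Y_{\mathsf v},\ \mathsf x_{\mathsf v}=P^{(d)}_{\mathsf v}\gamma_{\mathsf v}(u)\text{ for all }\mathsf v\Big\}.$$ Consider the following conditions. * **(a)** For every $\mathsf v$ choose bases $(\mathsf w^{(\mathsf v,i)})_i$ of $Y_{\mathsf v}^\perp$, $(\mathsf y^{(\mathsf v,j)})_j$ of $\operatorname{Ran}B_{\mathsf v}$, $(\mathsf z^{(\mathsf v,l)})_l$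 of $\operatorname{Ker}B_{\mathsf v}^*$. The family of all $\mathsf w^{(\mathsf v,i)}$, $B_{\mathsf v}^*\mathsf y^{(\mathsf v,j)}$, $\mathsf z^{(\mathsf v,l)}$ ($\mathsf v\in\mathsf V$), extended by $0$ to $\mathbb C^k$, is a basis of $\mathbb C^k$; and for every $\mathsf v$ there is $\lambda\ge0$ such that the quadratic form of $T_{\mathsf v}+Q_{\mathsf v}B_{\mathsf v}+B_{\mathsf v}^*Q_{\mathsf v}P^{(d)}_{\mathsf v}-\lambda P^{(d)}_{\mathsf v}Q_{\mathsf v}P^{(d)}_{\mathsf v}$ is nonpositive on $Y_{\mathsf v}$. * **(b)** For every $\mathsf v$ there is $\lambda\ge0$ such that the form in (a) is nonpositive on $Y^{(d)}_{\mathsf v}$, and there is $\mu\ge0$ such that the quadratic form on $\mathbb C^{k_{\mathsf v}}\oplus Y^{(d)}_{\mathsf v}$ of $$\begin{pmatrix}-T_{\mathsf v}-2\mu&T_{\mathsf v}\\P^{(d)}_{\mathsf v}T_{\mathsf v}&(P^{(d)}_{\mathsf v}B_{\mathsf v}^*-\mu)Q_{\mathsf v}+Q_{\mathsf v}(B_{\mathsf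 v}-\mu)\end{pmatrix}$$ is nonpositive on $\mathbb Y_{\mathsf v}^*=\{(\xi,\mathsf x)\in\mathbb C^{k_{\mathsf v}}\oplus Y^{(d)}_{\mathsf v}:P^{(d),\perp}_{\mathsf v}T_{\mathsf v}\xi+P^{(d),\perp}_{\mathsf v}B_{\mathsf v}^*Q_{\mathsf v}\mathsf x=0\}$. * **(b′)** As (b), but with the first form nonpositive on all of $Y_{\mathsf v}$, and with $-T_{\mathsf v}$ in place of $-T_{\mathsf v}-2\mu$. **Proposition.** Suppose that all $Y_{\mathsf v}$ and $Y^{(d)}_{\mathsf v}$ are invariant under taking entrywise real parts, that $Q_{\mathsf e}$, $M_{\mathsf e}$, $N_{\mathsf e}$ are real-valued ($N_{\mathsf e}$ almost everywhere) for all $\mathsf e$, and that $Q_{\mathsf v},B_{\mathsf v},C_{\mathsf v}$ are real (they map vectors with real entries to vectors with real entries) for all $\mathsf v$. 1. If (a) or (b′) holds, then $\mathbb A$ generates a strongly continuous semigroup on $\mathbf L^2_d$, and exactly one. 2. If (a) or (b) holds, then every strongly continuous semigroup $(S(t))_{t\ge0}$ on $\mathbf L^2_d$ whose generator is $\mathbb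 A$ is real: each $S(t)$ maps the real-valued elements of $\mathbf L^2_d$ to real-valued elements. -/

import Mathlib

open MeasureTheory Set Filter Topology
open scoped ENNReal NNReal ContDiff

noncomputable section

/-- A finite oriented combinatorial graph without loops, with a positive integer `k e` (the size of
the system on the edge `e`) and a positive length `len e` attached to each edge. The edge `e` is
identified with `[0, len e]`: its initial endpoint is `0`, its terminal endpoint is `len e`. -/
structure Network (V E : Type*) where
  init : E → V
  term : E → V
  init_ne_term : ∀ e, init e ≠ term e
  k : E → ℕ
  k_pos : ∀ e, 0 < k e
  len : E → ℝ
  len_pos : ∀ e, 0 < len e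

namespace Network

variable {V E : Type*} [Fintype V] [Fintype E] [DecidableEq V] [DecidableEq E]

/-- The edge `e` is incident in the vertex `v`. -/
def Inc (G : Network V E) (v : V) (e : E) : Prop := G.init e = v ∨ G.term e = v

instance (G : Network V E) (v : V) : DecidablePred (G.Inc v) := fun e =>
  inferInstanceAs (Decidable (G.init e = v ∨ G.term e = v))

/-- `E_v`, the set of edges incident in `v`. -/
abbrev EdgesAt (G : Network V E) (v : V) : Type _ := {e : E // G.Inc v e}

/-- `ℂ^{k_e}` -/
abbrev EdgeVec (G : Network V E) (e : E) : Type := EuclideanSpace ℂ (Fin (G.k e))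

/-- `ℂ^{k_v}`, with `k_v = ∑_{e ∈ E_v} k_e` -/
abbrev VertexVec (G : Network V E) (v : V) : Type _ :=
  EuclideanSpace ℂ (Σ e : G.EdgesAt v, Fin (G.k e))

/-- `ℂ^k`, with `k = ∑_e k_e` -/
abbrev TotalVec (G : Network V E) : Type _ := EuclideanSpace ℂ (Σ e : E, Fin (G.k e))

/-- The point of `[0, len e]` that corresponds to the endpoint `v` of an edge `e ∈ E_v`. -/
def pos (G : Network V E) (v : V) (e : E) : ℝ := if G.init e = v then 0 else G.len e

/-- The entry `ι_{v e}` of the signed incidence matrix. -/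
def incidence (G : Network V E) (v : V) (e : E) : ℂ :=
  (if G.term e = v then 1 else 0) - (if G.init e = v then 1 else 0)

/-- The trace `γ_v(f) = (f_e(v))_{e ∈ E_v}` of a family of functions defined everywhere. -/
def trace (G : Network V E) (v : V) (f : ∀ e, ℝ → G.EdgeVec e) : G.VertexVec v :=
  WithLp.toLp 2 fun p => f p.1 (G.pos v p.1) p.2

/-- Extension by zero of a vector of `ℂ^{k_v}` to a vector of `ℂ^k`. -/
def extend (G : Network V E) (v : V) (ξ : G.VertexVec v) : G.TotalVec :=
  WithLp.toLp 2 fun p => if h : G.Inc v p.1 then ξ ⟨⟨p.1, h⟩, p.2⟩ else 0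

/-- `L²(0, len e)^{k_e}` -/
abbrev EdgeL2 (G : Network V E) (e : E) : Type :=
  Lp (G.EdgeVec e) 2 (volume.restrict (Ioo 0 (G.len e)))

/-- `L²(G) = ⨁_e L²(0, len e)^{k_e}` -/
abbrev L2 (G : Network V E) : Type _ := PiLp 2 (fun e => G.EdgeL2 e)

instance (G : Network V E) : NormedAddCommGroup G.L2 := inferInstance

instance (G : Network V E) : NormedSpace ℂ G.L2 := inferInstance

end Network

/-- `g` is the weak derivative of `u` on the interval `(0, a)`. -/
def HasWeakDerivOn {F : Type*} [NormedAddCommGroup F] [NormedSpace ℝ F]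
    (a : ℝ) (u g : ℝ → F) : Prop :=
  ∀ φ : ℝ → ℝ, ContDiff ℝ ∞ φ → HasCompactSupport φ → tsupport φ ⊆ Ioo 0 a →
    ∫ x in Ioo 0 a, deriv φ x • u x = - ∫ x in Ioo 0 a, φ x • g x

/-- A complex vector with real entries. -/
def IsRealVec {ι : Type*} (x : EuclideanSpace ℂ ι) : Prop := ∀ i, (x i).im = 0

/-- The entrywise real part of a complex vector. -/
def reVec {ι : Type*} (x : EuclideanSpace ℂ ι) : EuclideanSpace ℂ ι :=
  WithLp.toLp 2 fun i => ((x i).re : ℂ)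

/-- A linear operator between subspaces of `ℂⁿ` is real if it maps vectors with real entries to
vectors with real entries. -/
def IsRealOp {ι : Type*} {Y Z : Submodule ℂ (EuclideanSpace ℂ ι)} (f : Y →ₗ[ℂ] Z) : Prop :=
  ∀ x : Y, IsRealVec (x : EuclideanSpace ℂ ι) → IsRealVec (f x : EuclideanSpace ℂ ι)

/-- A matrix with real entries. -/
def IsRealMatrix {m n : Type*} (A : Matrix m n ℂ) : Prop := ∀ i j, (A i j).im = 0

/-- The coefficients `M_e`, `N_e` of the system, with a Friedrichs symmetrizer `Q_e`, and the
standing assumptions on them. -/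
structure EdgeCoefficients {V E : Type*} (G : Network V E) where
  M : ∀ e, ℝ → Matrix (Fin (G.k e)) (Fin (G.k e)) ℂ
  N : ∀ e, ℝ → Matrix (Fin (G.k e)) (Fin (G.k e)) ℂ
  Q : ∀ e, ℝ → Matrix (Fin (G.k e)) (Fin (G.k e)) ℂ
  M_lipschitz : ∀ e, ∃ L : ℝ≥0, ∀ i j, LipschitzOnWith L (fun x => M e x i j) (Icc 0 (G.len e))
  M_invertible : ∀ e, ∀ x ∈ Icc 0 (G.len e), IsUnit (M e x)
  N_bounded : ∀ e i j, MemLp (fun x => N e x i j) ∞ (volume.restrict (Ioo 0 (G.len e)))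
  Q_lipschitz : ∀ e, ∃ L : ℝ≥0, ∀ i j, LipschitzOnWith L (fun x => Q e x i j) (Icc 0 (G.len e))
  Q_hermitian : ∀ e, ∀ x ∈ Icc 0 (G.len e), (Q e x).IsHermitian
  QM_hermitian : ∀ e, ∀ x ∈ Icc 0 (G.len e), (Q e x * M e x).IsHermitian
  Q_posDef : ∀ e, ∃ q : ℝ, 0 < q ∧ ∀ x ∈ Icc 0 (G.len e), ∀ ξ : G.EdgeVec e,
    q * ‖ξ‖ ^ 2 ≤ (inner ℂ ξ ((Q e x).toEuclideanLin ξ)).re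

/-- The spaces `Y_v^{(d)} ⊆ Y_v ⊆ ℂ^{k_v}` and the operators `B_v`, `C_v`, `Q_v` that describe the
vertex conditions, with the standing assumptions on them. -/
structure VertexConditions {V E : Type*} [Fintype V] [Fintype E] [DecidableEq V] [DecidableEq E]
    (G : Network V E) where
  Y : ∀ v, Submodule ℂ (G.VertexVec v)
  Yd : ∀ v, Submodule ℂ (G.VertexVec v)
  Yd_le : ∀ v, Yd v ≤ Y v
  B : ∀ v, Y v →ₗ[ℂ] Yd v
  C : ∀ v, Yd v →ₗ[ℂ] Yd v
  Q : ∀ v, Yd v →ₗ[ℂ] Yd v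
  Q_symmetric : ∀ v, ∀ x y : Yd v, inner ℂ (Q v x) y = inner ℂ x (Q v y)
  Q_posDef : ∀ v, ∀ x : Yd v, x ≠ 0 → 0 < (inner ℂ x (Q v x)).re

section System

variable {V E : Type*} [Fintype V] [Fintype E] [DecidableEq V] [DecidableEq E]
  {G : Network V E}

/-- The block-diagonal matrix `T_v = diag (Q_e(v) M_e(v) ι_{v e})_{e ∈ E_v}`, as an operator. -/
def vertexT (K : EdgeCoefficients G) (v : V) : G.VertexVec v →ₗ[ℂ] G.VertexVec v :=
  (Matrix.blockDiagonal' fun e : G.EdgesAt v =>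
    G.incidence v e • (K.Q e (G.pos v e) * K.M e (G.pos v e))).toEuclideanLin

namespace VertexConditions

/-- `Y^{(d)} = ⨁_v Y_v^{(d)}` -/
abbrev YdSum (D : VertexConditions G) : Type _ := PiLp 2 (fun v => D.Yd v)

/-- The Hilbert space `L²_d(G) = ⨁_e L²(0, len e)^{k_e} ⊕ ⨁_v Y_v^{(d)}`, with its canonical
norm. -/
abbrev State (D : VertexConditions G) : Type _ := WithLp 2 (G.L2 × D.YdSum)

instance (D : VertexConditions G) : NormedAddCommGroup D.YdSum := inferInstance

instance (D : VertexConditions G) : NormedSpace ℂ D.YdSum := inferInstance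

instance (D : VertexConditions G) : NormedAddCommGroup D.State :=
  WithLp.instProdNormedAddCommGroup 2 G.L2 D.YdSum

instance (D : VertexConditions G) : NormedSpace ℂ D.State :=
  WithLp.instProdNormedSpace 2 ℂ G.L2 D.YdSum

/-- The adjoint `B_v^* : Y_v^{(d)} → Y_v` with respect to the Euclidean inner products. -/
def Bstar (D : VertexConditions G) (v : V) : D.Yd v →ₗ[ℂ] D.Y v :=
  LinearMap.adjoint (𝕜 := ℂ) (E := D.Y v) (F := D.Yd v) (D.B v)

/-- The orthogonal projector `P_v^{(d)}` of `ℂ^{k_v}` onto `Y_v^{(d)}`. -/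
def Pd (D : VertexConditions G) (v : V) (ξ : G.VertexVec v) : D.Yd v :=
  (D.Yd v).orthogonalProjectionOnto ξ

/-- The orthogonal projector `P_v^{(d),⊥}` of `ℂ^{k_v}` onto the orthogonal complement of
`Y_v^{(d)}` in `Y_v`. -/
def PdPerp (D : VertexConditions G) (v : V) (ξ : G.VertexVec v) : G.VertexVec v :=
  (D.Y v ⊓ (D.Yd v)ᗮ).starProjection ξ

/-- An element of `Y_v^{(d)}`, seen in `Y_v`. -/
def incl (D : VertexConditions G) (v : V) (x : D.Yd v) : D.Y v := ⟨x, D.Yd_le v x.2⟩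

/-- The vectors
`w^{(v,i)}` (a basis of `Y_v^⊥`), `B_v^* y^{(v,j)}` (where `y^{(v,j)}` is a basis of `Ran B_v`) and
`w_{KB^*}^{(v,l)}` (a basis of `Ker B_v^*`), extended by zero to `ℂ^k`, for all vertices `v`. -/
def basisFamily (D : VertexConditions G)
    (w : ∀ v, Module.Basis (Fin (Module.finrank ℂ (D.Y v)ᗮ)) ℂ (D.Y v)ᗮ)
    (y : ∀ v, Module.Basis (Fin (Module.finrank ℂ (LinearMap.range (D.B v)))) ℂ
      (LinearMap.range (D.B v)))
    (z : ∀ v, Module.Basis (Fin (Module.finrank ℂ (LinearMap.ker (D.Bstar v)))) ℂ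
      (LinearMap.ker (D.Bstar v))) :
    (Σ v : V, Fin (Module.finrank ℂ (D.Y v)ᗮ) ⊕
      (Fin (Module.finrank ℂ (LinearMap.range (D.B v))) ⊕
        Fin (Module.finrank ℂ (LinearMap.ker (D.Bstar v))))) → G.TotalVec
  | ⟨v, Sum.inl i⟩ => G.extend v (w v i : G.VertexVec v)
  | ⟨v, Sum.inr (Sum.inl j)⟩ =>
      G.extend v (D.Bstar v (y v j : D.Yd v) : G.VertexVec v)
  | ⟨v, Sum.inr (Sum.inr l)⟩ =>
      G.extend v ((z v l : D.Yd v) : G.VertexVec v)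

/-- The vectors of `basisFamily` form a basis of `ℂ^k`. (Whether they do does not depend on the
bases of `Y_v^⊥`, `Ran B_v` and `Ker B_v^*`.) -/
def BasisCondition (D : VertexConditions G) : Prop :=
  ∃ w y z, LinearIndependent ℂ (D.basisFamily w y z) ∧
    Submodule.span ℂ (range (D.basisFamily w y z)) = ⊤

/-- The quadratic form associated with
`T_v + Q_v B_v + B_v^* Q_v - lam P_v^{(d)} Q_v P_v^{(d)}`, on `Y_v`. Here `B_v^* Q_v` stands for the
adjoint `B_v^* Q_v P_v^{(d)}` of `Q_v B_v`. -/
def formY (D : VertexConditions G) (K : EdgeCoefficients G) (lam : ℝ) (v : V) (ξ : D.Y v) : ℝ :=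
  (inner ℂ (ξ : G.VertexVec v)
    (vertexT K v ξ + (D.Q v (D.B v ξ) : G.VertexVec v)
      + (D.Bstar v (D.Q v (D.Pd v ξ)) : G.VertexVec v)
      - (lam : ℂ) • (D.Q v (D.Pd v ξ) : G.VertexVec v))).re

/-- The space `𝕐_v^*`, the kernel of `(P_v^{(d),⊥} T_v, P_v^{(d),⊥} B_v^* Q_v)` in
`ℂ^{k_v} ⊕ Y_v^{(d)}`. -/
def YstarMem (D : VertexConditions G) (K : EdgeCoefficients G) (v : V)
    (ξ : G.VertexVec v) (x : D.Yd v) : Prop :=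
  D.PdPerp v (vertexT K v ξ) + D.PdPerp v (D.Bstar v (D.Q v x) : G.VertexVec v) = 0

/-- The quadratic form on `ℂ^{k_v} ⊕ Y_v^{(d)}` associated with the block matrix
`(-T_v - 2 nu, T_v; P_v^{(d)} T_v, (P_v^{(d)} B_v^* - mu) Q_v + Q_v (B_v - mu))`. -/
def formYstar (D : VertexConditions G) (K : EdgeCoefficients G) (nu mu : ℝ) (v : V)
    (ξ : G.VertexVec v) (x : D.Yd v) : ℝ :=
  (inner ℂ ξ (-(vertexT K v ξ) - (2 * nu : ℂ) • ξ + vertexT K v (x : G.VertexVec v))).re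
  + (inner ℂ x (D.Pd v (vertexT K v ξ)
      + (D.Pd v (D.Bstar v (D.Q v x) : G.VertexVec v) - (mu : ℂ) • D.Q v x)
      + D.Q v (D.B v (D.incl v x) - (mu : ℂ) • x))).re

/-- The hypotheses of the first well-posedness theorem. -/
def WellPosedHyp₁ (D : VertexConditions G) (K : EdgeCoefficients G) : Prop :=
  D.BasisCondition ∧
  ∀ v, ∃ lam : ℝ, 0 ≤ lam ∧ ∀ ξ : D.Y v, D.formY K lam v ξ ≤ 0

/-- The hypotheses of the second well-posedness theorem: the first form is nonpositive on
`Y_v^{(d)}`, the second one on `𝕐_v^*`. -/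
def WellPosedHyp₂ (D : VertexConditions G) (K : EdgeCoefficients G) : Prop :=
  ∀ v, (∃ lam : ℝ, 0 ≤ lam ∧ ∀ x : D.Yd v, D.formY K lam v (D.incl v x) ≤ 0) ∧
    ∃ mu : ℝ, 0 ≤ mu ∧ ∀ ξ x, D.YstarMem K v ξ x → D.formYstar K mu mu v ξ x ≤ 0

/-- The stronger form of the second set of hypotheses that yields generation: the first form is
nonpositive on all of `Y_v`, and the block `-T_v - 2 mu` is replaced by `-T_v`. -/
def WellPosedHyp₂' (D : VertexConditions G) (K : EdgeCoefficients G) : Prop :=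
  ∀ v, (∃ lam : ℝ, 0 ≤ lam ∧ ∀ ξ : D.Y v, D.formY K lam v ξ ≤ 0) ∧
    ∃ mu : ℝ, 0 ≤ mu ∧ ∀ ξ x, D.YstarMem K v ξ x → D.formYstar K 0 mu v ξ x ≤ 0

/-- The operator `𝔸`, through its graph: `U = (u, x)` lies in `D(𝔸)` and `W = 𝔸 U`. The function
`f e` is the continuous representative of `u_e ∈ H¹(0, len e)^{k_e}` and `g e ∈ L²` is its weak
derivative; both are determined by `u_e`. -/
def IsA (D : VertexConditions G) (K : EdgeCoefficients G) (U W : D.State) : Prop :=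
  ∃ (f : ∀ e, ℝ → G.EdgeVec e) (g : ∀ e, G.EdgeL2 e),
    (∀ e, ContinuousOn (f e) (Icc 0 (G.len e)) ∧
      U.fst e =ᵐ[volume.restrict (Ioo 0 (G.len e))] f e ∧
      HasWeakDerivOn (G.len e) (U.fst e) (g e)) ∧
    (∀ e, W.fst e =ᵐ[volume.restrict (Ioo 0 (G.len e))] fun x =>
      (K.M e x).toEuclideanLin (g e x) + (K.N e x).toEuclideanLin (f e x)) ∧
    ∀ v, U.snd v = D.Pd v (G.trace v f) ∧
      ∃ h : G.trace v f ∈ D.Y v, W.snd v = D.B v ⟨G.trace v f, h⟩ + D.C v (U.snd v)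

/-- The elements of `L²_d(G)` that are real-valued. -/
def IsRealState (D : VertexConditions G) (U : D.State) : Prop :=
  (∀ e, ∀ᵐ x ∂(volume.restrict (Ioo 0 (G.len e))), IsRealVec (U.fst e x)) ∧
  ∀ v, IsRealVec (U.snd v : G.VertexVec v)

end VertexConditions

end System

/-- A strongly continuous semigroup of bounded operators. -/
structure IsC0Semigroup {H : Type*} [NormedAddCommGroup H] [NormedSpace ℂ H]
    (S : ℝ≥0 → H →L[ℂ] H) : Prop where
  zero : S 0 = ContinuousLinearMap.id ℂ H
  add : ∀ s t, S (s + t) = (S s).comp (S t)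
  continuous_at_zero : ∀ U, Tendsto (fun t => S t U) (𝓝 0) (𝓝 U)

/-- `S` is a strongly continuous semigroup whose infinitesimal generator is the operator with
graph `A`. -/
def IsSemigroupGeneratedBy {H : Type*} [NormedAddCommGroup H] [NormedSpace ℂ H]
    (S : ℝ≥0 → H →L[ℂ] H) (A : H → H → Prop) : Prop :=
  IsC0Semigroup S ∧
  ∀ U W, A U W ↔
    Tendsto (fun t : ℝ≥0 => ((t : ℝ) : ℂ)⁻¹ • (S t U - U)) (𝓝[>] 0) (𝓝 W)

end

/-! Generation rests on the Lumer–Phillips argument in the energy inner product, which weights the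
edge components by `Q_e` and the vertex components by `Q_v` and is equivalent to the given norm.
Since `Q_e M_e` is Hermitian and Lipschitz, integration by parts turns the energy of `𝔸U` against
`U` into boundary terms plus an error bounded by the squared norm. Sorted by vertices, the boundary
terms are the forms of `T_v`, and nonpositivity of the first form on `Y_v` lets the dynamic part at
the vertex absorb them. Hence `𝔸 - ω` is dissipative for some `ω` (`exists_quasiDissipative`).

For the range condition, the resolvent equation `λu - Mu' - Nu = y` is a linear differential
equation on each edge, whose solutions form an affine space of dimension `k`. The vertex conditions
impose `∑_v (dim Y_v^⊥ + dim Y_v^{(d)})` linear equations on it. For `λ > ω` the homogeneous problem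
has only the zero solution, so solvability follows as soon as there are at most `k` equations
(`exists_isA_of_injective`). Under (a) this count holds because a linearly independent family of
that size lives in `ℂ^k`. Under (b′) it is dual: the second form at `x = 0` makes a map from `ℂ^k`
into the sum of the spaces `Y_v ⊖ Y_v^{(d)}` injective, and the vertex spaces have total dimension
`2k` (`WellPosedHyp₂'.finrank_le`). An m-dissipative operator then generates a semigroup, the limit
of the exponentials of its Yosida approximations (`IsMDissipative.exists_semigroup`).

Reality is a consequence of uniqueness. With real data, complex conjugation `J` maps the graph of
`𝔸` into itself, so `J S(t) J` is a semigroup with the same generator as `S(t)`. A semigroup is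
determined by its generator, hence `S(t)` commutes with `J` and preserves the fixed points of `J`,
which are the real-valued states. -/

/-! ### Strongly continuous semigroups -/

section Semigroup

variable {H : Type*} [NormedAddCommGroup H] [NormedSpace ℂ H]

/-- The infinitesimal generator of a family of operators, through its graph. -/
def GeneratorGraph (S : ℝ≥0 → H →L[ℂ] H) (U W : H) : Prop :=
  Tendsto (fun t : ℝ≥0 => ((t : ℝ) : ℂ)⁻¹ • (S t U - U)) (𝓝[>] 0) (𝓝 W)

theorem NNReal.tendsto_coe_nhdsGT_zero :
    Tendsto (fun t : ℝ≥0 => (t : ℝ)) (𝓝[>] 0) (𝓝[>] 0) := by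
  refine tendsto_nhdsWithin_iff.2 ⟨?_, ?_⟩
  · exact (NNReal.continuous_coe.tendsto 0).mono_left nhdsWithin_le_nhds
  · filter_upwards [self_mem_nhdsWithin] with t ht
    exact_mod_cast ht

theorem Real.tendsto_toNNReal_nhdsGT_zero :
    Tendsto Real.toNNReal (𝓝[>] 0) (𝓝[>] 0) := by
  refine tendsto_nhdsWithin_iff.2 ⟨?_, ?_⟩
  · have := (continuous_real_toNNReal.tendsto 0).mono_left
      (nhdsWithin_le_nhds (s := Ioi (0 : ℝ)))
    rwa [Real.toNNReal_zero] at this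
  · filter_upwards [self_mem_nhdsWithin] with t ht
    exact Real.toNNReal_pos.2 ht

/-- A real time variable makes slopes and one-sided derivatives available. -/
theorem generatorGraph_iff_real {S : ℝ≥0 → H →L[ℂ] H} {U W : H} :
    GeneratorGraph S U W ↔
      Tendsto (fun t : ℝ => t⁻¹ • (S t.toNNReal U - U)) (𝓝[>] 0) (𝓝 W) := by
  constructor
  · intro h
    refine (h.comp Real.tendsto_toNNReal_nhdsGT_zero).congr' ?_
    filter_upwards [self_mem_nhdsWithin] with t ht
    have : ((t.toNNReal : ℝ) : ℂ)⁻¹ = ((t⁻¹ : ℝ) : ℂ) := by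
      rw [Real.coe_toNNReal t (le_of_lt ht)]; simp
    simp only [Function.comp_apply, this, Complex.coe_smul]
  · intro h
    refine (h.comp NNReal.tendsto_coe_nhdsGT_zero).congr' ?_
    filter_upwards with t
    have : ((t : ℝ) : ℂ)⁻¹ = (((t : ℝ)⁻¹ : ℝ) : ℂ) := by simp
    simp only [Function.comp_apply, this, Complex.coe_smul, Real.toNNReal_coe]

namespace IsC0Semigroup

variable {S T : ℝ≥0 → H →L[ℂ] H}

theorem apply_add (hS : IsC0Semigroup S) (s t : ℝ≥0) (U : H) : S (s + t) U = S s (S t U) := by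
  rw [hS.add]; rfl

theorem apply_zero (hS : IsC0Semigroup S) (U : H) : S 0 U = U := by
  rw [hS.zero]; rfl

theorem generatorGraph_apply (hS : IsC0Semigroup S) {U W : H} (h : GeneratorGraph S U W)
    (t : ℝ≥0) : GeneratorGraph S (S t U) (S t W) := by
  refine (((S t).continuous.tendsto W).comp h).congr fun r => ?_
  rw [Function.comp_apply, map_smul, map_sub, ← hS.apply_add, ← hS.apply_add, add_comm]

/-- For `s ≤ t` one has `S t - S s = S s (S (t - s) - 1)`. As the estimate is symmetric in `s` and
`t`, it reduces continuity from either side to continuity at `0`. -/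
theorem norm_apply_sub_le (hS : IsC0Semigroup S) {a : ℝ≥0} {M : ℝ}
    (hM : ∀ t ≤ a, ‖S t‖ ≤ M) {s t : ℝ≥0} (hs : s ≤ a) (ht : t ≤ a) (U : H) :
    ‖S t U - S s U‖ ≤ M * ‖S (nndist s t) U - U‖ := by
  wlog hst : s ≤ t generalizing s t
  · rw [norm_sub_rev, nndist_comm]
    exact this ht hs (le_of_not_ge hst)
  have h1 : t = s + nndist s t := by
    apply NNReal.coe_injective
    rw [NNReal.coe_add, coe_nndist, NNReal.dist_eq, abs_sub_comm, abs_of_nonneg]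
    · ring
    · exact sub_nonneg.2 (by exact_mod_cast hst)
  conv_lhs => rw [h1]
  rw [hS.apply_add, ← map_sub]
  exact ((S s).le_opNorm _).trans (by gcongr; exact hM s hs)

variable [CompleteSpace H]

/-- Otherwise there are times `t n → 0` with `‖S (t n)‖ > n`, while every orbit along them converges
and is therefore bounded; this contradicts the uniform boundedness principle. -/
theorem exists_bound_near_zero (hS : IsC0Semigroup S) :
    ∃ δ : ℝ≥0, 0 < δ ∧ ∃ M : ℝ, ∀ t ≤ δ, ‖S t‖ ≤ M := by
  by_contra! hcon
  have hpos : ∀ n : ℕ, (0 : ℝ≥0) < ((n : ℝ≥0) + 1)⁻¹ := fun n => by positivity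
  choose t ht hbig using fun n : ℕ => hcon _ (hpos n) n
  have htend : Tendsto t atTop (𝓝 0) := by
    refine tendsto_of_tendsto_of_tendsto_of_le_of_le tendsto_const_nhds ?_
      (fun n => zero_le) ht
    simpa only [one_div] using tendsto_one_div_add_atTop_nhds_zero_nat (𝕜 := ℝ≥0)
  obtain ⟨C, hC⟩ := banach_steinhaus (g := fun n => S (t n)) fun U => by
    obtain ⟨C, hC⟩ := (((hS.continuous_at_zero U).comp htend).norm).bddAbove_range
    exact ⟨C, fun n => hC ⟨n, rfl⟩⟩
  obtain ⟨n, hn⟩ := exists_nat_gt C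
  exact absurd (hC n) (not_le.2 (hn.trans (hbig n)))

theorem exists_bound (hS : IsC0Semigroup S) (a : ℝ≥0) :
    ∃ M : ℝ, 0 ≤ M ∧ ∀ t ≤ a, ‖S t‖ ≤ M := by
  obtain ⟨δ, hδ, M, hM⟩ := hS.exists_bound_near_zero
  have key : ∀ n : ℕ, ∃ C : ℝ, 0 ≤ C ∧ ∀ t ≤ (n + 1) * δ, ‖S t‖ ≤ C := by
    intro n
    induction n with
    | zero =>
      refine ⟨M, (norm_nonneg _).trans (hM 0 zero_le), fun t ht => hM t (by simpa using ht)⟩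
    | succ n ih =>
      obtain ⟨C, hC0, hC⟩ := ih
      have hM0 : 0 ≤ M := (norm_nonneg _).trans (hM 0 zero_le)
      -- The sum covers both cases: `C` on the old interval, and `M * C` after splitting off one
      -- further step of length at most `δ`.
      refine ⟨C + M * C, by positivity, fun t ht => ?_⟩
      rcases le_total t ((n + 1) * δ) with h | h
      · exact (hC t h).trans (by linarith [mul_nonneg hM0 hC0])
      · have hsplit : t = (t - (n + 1) * δ) + (n + 1) * δ := (tsub_add_cancel_of_le h).symm
        have hle : t - (n + 1) * δ ≤ δ := by
          rw [tsub_le_iff_right]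
          refine ht.trans (le_of_eq ?_)
          push_cast; ring
        rw [hsplit, hS.add]
        refine (ContinuousLinearMap.opNorm_comp_le _ _).trans ?_
        have := mul_le_mul (hM _ hle) (hC _ le_rfl) (norm_nonneg _) hM0
        linarith
  obtain ⟨n, hn⟩ := exists_nat_ge (a / δ)
  obtain ⟨C, hC0, hC⟩ := key n
  refine ⟨C, hC0, fun t ht => hC t (ht.trans ?_)⟩
  rw [← div_le_iff₀ hδ]
  exact hn.trans (by simp)

theorem continuous_apply (hS : IsC0Semigroup S) (U : H) : Continuous fun t => S t U := by
  rw [continuous_iff_continuousAt]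
  intro s
  obtain ⟨M, hM0, hM⟩ := hS.exists_bound (s + 1)
  rw [ContinuousAt, tendsto_iff_norm_sub_tendsto_zero]
  have h0 : Tendsto (fun t => M * ‖S (nndist s t) U - U‖) (𝓝 s) (𝓝 0) := by
    have h1 : Tendsto (fun t => nndist s t) (𝓝 s) (𝓝 0) := by
      have : Continuous fun t => nndist s t := by fun_prop
      simpa using this.tendsto s
    have h2 := ((hS.continuous_at_zero U).comp h1).sub_const U
    simpa using (h2.norm.const_mul M)
  refine squeeze_zero' (Eventually.of_forall fun _ => norm_nonneg _) ?_ h0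
  filter_upwards [Iic_mem_nhds (show s < s + 1 by simp)] with t ht
  exact hS.norm_apply_sub_le hM (by simp) ht U

/-- A semigroup is jointly continuous. -/
theorem tendsto_apply (hS : IsC0Semigroup S) {α : Type*} {l : Filter α} {f : α → ℝ≥0}
    {g : α → H} {t : ℝ≥0} {U : H} (hf : Tendsto f l (𝓝 t)) (hg : Tendsto g l (𝓝 U)) :
    Tendsto (fun x => S (f x) (g x)) l (𝓝 (S t U)) := by
  obtain ⟨M, hM0, hM⟩ := hS.exists_bound (t + 1)
  have h1 : Tendsto (fun x => S (f x) U) l (𝓝 (S t U)) :=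
    ((hS.continuous_apply U).tendsto t).comp hf
  have h2 : Tendsto (fun x => S (f x) (g x - U)) l (𝓝 0) := by
    have h0 : Tendsto (fun x => M * ‖g x - U‖) l (𝓝 0) := by
      simpa using ((hg.sub_const U).norm.const_mul M)
    refine squeeze_zero_norm' ?_ h0
    filter_upwards [hf (Iic_mem_nhds (show t < t + 1 by simp))] with x hx
    exact ((S (f x)).le_opNorm _).trans (by gcongr; exact hM _ hx)
  simpa using h1.add h2

/-- The integrals `∫₀ʰ S s U ds` lie in the domain, because applying `S r` only translates the
interval of integration; divided by `h`, they tend to `U` as `h → 0`. -/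
theorem dense_generator_domain (hS : IsC0Semigroup S) :
    Dense {U : H | ∃ W, GeneratorGraph S U W} := by
  intro U
  let v : ℝ → H := fun r => S r.toNNReal U
  have hv : Continuous v := (hS.continuous_apply U).comp continuous_real_toNNReal
  have hv0 : v 0 = U := by simp [v, hS.apply_zero]
  have hint : ∀ a b, IntervalIntegrable v volume a b := fun a b => hv.intervalIntegrable a b
  have hmem : ∀ h : ℝ, 0 < h → ∃ W, GeneratorGraph S (∫ s in (0 : ℝ)..h, v s) W := by
    intro h hh
    refine ⟨v h - v 0, generatorGraph_iff_real.2 ?_⟩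
    have hd : ∀ b, HasDerivAt (fun r => ∫ s in (0 : ℝ)..r, v s) (v b) b := fun b =>
      intervalIntegral.integral_hasDerivAt_right (hint _ _)
        (hv.stronglyMeasurableAtFilter _ _) hv.continuousAt
    have hd1 : HasDerivAt (fun r => ∫ s in (0 : ℝ)..(r + h), v s) (v h) 0 := by
      have := (hd (0 + h)).comp_add_const 0 h
      rwa [zero_add] at this
    have hd2 := hd1.sub (hd 0)
    have hd3 := (hasDerivAt_iff_tendsto_slope.1 hd2).mono_left
      (nhdsWithin_mono 0 (fun x (hx : 0 < x) => hx.ne'))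
    refine hd3.congr' ?_
    filter_upwards [self_mem_nhdsWithin] with r hr
    have hr0 : (0 : ℝ) ≤ r := le_of_lt hr
    have e1 : S r.toNNReal (∫ s in (0 : ℝ)..h, v s) = ∫ s in r..(h + r), v s := by
      rw [← ContinuousLinearMap.intervalIntegral_comp_comm _ (hint _ _)]
      have := intervalIntegral.integral_comp_add_right (a := 0) (b := h) v r
      rw [zero_add] at this
      rw [← this]
      refine intervalIntegral.integral_congr fun s hs => ?_
      rw [uIcc_of_le hh.le] at hs
      simp only [v]
      rw [Real.toNNReal_add hs.1 hr0, add_comm, hS.apply_add]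
    -- After cancelling the common part, the difference quotient is that of `r ↦ ∫₀^{r+h} v - ∫₀^r
    -- v` at `0`, with limit `v h - v 0`.
    have e2 : (∫ s in (0 : ℝ)..(r + h), v s) = (∫ s in (0 : ℝ)..r, v s)
        + ∫ s in r..(h + r), v s := by
      rw [add_comm r h, intervalIntegral.integral_add_adjacent_intervals (hint _ _) (hint _ _)]
    simp only [slope, vsub_eq_sub, sub_zero, Pi.sub_apply, zero_add,
      intervalIntegral.integral_same, e1, e2]
    congr 1
    abel
  have hlim : Tendsto (fun h : ℝ => h⁻¹ • ∫ s in (0 : ℝ)..h, v s) (𝓝[>] 0) (𝓝 U) := by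
    have hd : HasDerivAt (fun r => ∫ s in (0 : ℝ)..r, v s) (v 0) 0 :=
      intervalIntegral.integral_hasDerivAt_right (hint _ _)
        (hv.stronglyMeasurableAtFilter _ _) hv.continuousAt
    have hd3 := (hasDerivAt_iff_tendsto_slope.1 hd).mono_left
      (nhdsWithin_mono 0 (fun x (hx : 0 < x) => hx.ne'))
    rw [hv0] at hd3
    refine hd3.congr fun r => ?_
    simp [slope]
  refine mem_closure_of_tendsto hlim ?_
  filter_upwards [self_mem_nhdsWithin] with h hh
  obtain ⟨W, hW⟩ := hmem h hh
  refine ⟨((h⁻¹ : ℝ) : ℂ) • W, ?_⟩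
  rw [← Complex.coe_smul]
  refine (hW.const_smul ((h⁻¹ : ℝ) : ℂ)).congr fun t => ?_
  rw [map_smul, ← smul_sub, smul_comm]

/-- If the generator of `T` is contained in the generator of `S`, then `S = T`. -/
theorem eq_of_generator_le (hS : IsC0Semigroup S) (hT : IsC0Semigroup T)
    (h : ∀ U W, GeneratorGraph T U W → GeneratorGraph S U W) : S = T := by
  have key : ∀ (t : ℝ≥0) (U W : H), GeneratorGraph T U W → S t U = T t U := by
    intro t U W hU
    -- This path joins `S t U` at `r = 0` to `T t U` at `r = t`; it is constant because its right
    -- derivative vanishes.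
    let w : ℝ → H := fun r => S (t - r.toNNReal) (T r.toNNReal U)
    have hcont : ContinuousOn w (Icc 0 t) := by
      intro r hr
      refine ContinuousAt.continuousWithinAt ?_
      refine hS.tendsto_apply ?_ ?_
      · have : Continuous fun r : ℝ => t - r.toNNReal := by fun_prop
        exact this.tendsto r
      · exact (((hT.continuous_apply U).comp continuous_real_toNNReal).tendsto r)
    have hderiv : ∀ r ∈ Ico (0 : ℝ) t, HasDerivWithinAt w 0 (Ici r) r := by
      intro r hr
      have hV := hT.generatorGraph_apply hU r.toNNReal
      have h1 := generatorGraph_iff_real.1 hV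
      have h2 := generatorGraph_iff_real.1 (h _ _ hV)
      -- At `T r U` the two semigroups have the same generator value, so the difference of their
      -- difference quotients tends to `0`. The factor `S (t - x)` in front is harmless by joint
      -- continuity.
      have h3 := h1.sub h2
      rw [sub_self] at h3
      have hmap : Tendsto (fun x : ℝ => x - r) (𝓝[>] r) (𝓝[>] 0) := by
        refine tendsto_nhdsWithin_iff.2 ⟨?_, ?_⟩
        · have : Continuous fun x : ℝ => x - r := by fun_prop
          simpa using (this.tendsto r).mono_left (nhdsWithin_le_nhds (s := Ioi r))
        · filter_upwards [self_mem_nhdsWithin] with x hx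
          exact sub_pos.2 (mem_Ioi.1 hx)
      have h4 := h3.comp hmap
      have hs : Tendsto (fun x : ℝ => t - x.toNNReal) (𝓝[>] r) (𝓝 (t - r.toNNReal)) := by
        have : Continuous fun x : ℝ => t - x.toNNReal := by fun_prop
        exact (this.tendsto r).mono_left nhdsWithin_le_nhds
      have h5 := hS.tendsto_apply hs h4
      rw [map_zero] at h5
      rw [← hasDerivWithinAt_Ioi_iff_Ici, hasDerivWithinAt_iff_tendsto_slope' (by simp)]
      refine h5.congr' ?_
      filter_upwards [Ioo_mem_nhdsGT hr.2] with x hx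
      have hr0 := hr.1
      have e1 : x.toNNReal = (x - r).toNNReal + r.toNNReal := by
        rw [← Real.toNNReal_add (by linarith [hx.1]) hr0, sub_add_cancel]
      have e2 : t - r.toNNReal = (t - x.toNNReal) + (x - r).toNNReal := by
        apply NNReal.coe_injective
        rw [NNReal.coe_add, NNReal.coe_sub (Real.toNNReal_le_iff_le_coe.2 hr.2.le),
          NNReal.coe_sub (Real.toNNReal_le_iff_le_coe.2 hx.2.le), Real.coe_toNNReal _ hr0,
          Real.coe_toNNReal _ (hr0.trans hx.1.le), Real.coe_toNNReal _ (by linarith [hx.1])]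
        ring
      have e3 : w r = S (t - x.toNNReal) (S (x - r).toNNReal (T r.toNNReal U)) := by
        simp only [w]; rw [e2, hS.apply_add]
      have e4 : w x = S (t - x.toNNReal) (T (x - r).toNNReal (T r.toNNReal U)) := by
        simp only [w]; rw [← hT.apply_add, ← e1]
      rw [slope, vsub_eq_sub, e3, e4, ← map_sub, Function.comp_apply, ← smul_sub,
        sub_sub_sub_cancel_right]
      rw [← Complex.coe_smul, ← Complex.coe_smul, map_smul]
    have := constant_of_has_deriv_right_zero hcont hderiv t ⟨t.2, le_rfl⟩
    simp only [w, Real.toNNReal_coe, tsub_self, Real.toNNReal_zero, tsub_zero, hS.apply_zero,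
      hT.apply_zero] at this
    exact this.symm
  funext t
  refine ContinuousLinearMap.ext fun U => ?_
  have hd := hT.dense_generator_domain
  refine congrFun (Continuous.ext_on hd (S t).continuous (T t).continuous ?_) U
  rintro V ⟨W, hW⟩
  exact key t V W hW

end IsC0Semigroup

/-- A semigroup is determined by its generator. -/
theorem IsSemigroupGeneratedBy.unique [CompleteSpace H] {S T : ℝ≥0 → H →L[ℂ] H}
    {A : H → H → Prop} (hS : IsSemigroupGeneratedBy S A) (hT : IsSemigroupGeneratedBy T A) :
    S = T :=
  hS.1.eq_of_generator_le hT.1 fun U W h => (hS.2 U W).1 ((hT.2 U W).2 h)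

end Semigroup

/-! ### Generation of semigroups by m-dissipative operators -/

section Exponential

variable {H : Type*} [NormedAddCommGroup H] [NormedSpace ℂ H]

/-- The one-parameter group generated by a bounded operator. -/
noncomputable def expGroup (A : H →L[ℂ] H) (t : ℝ) : H →L[ℂ] H := NormedSpace.exp ((t : ℂ) • A)

theorem expGroup_zero (A : H →L[ℂ] H) : expGroup A 0 = 1 := by
  simp [expGroup]

theorem expGroup_commute_apply (A : H →L[ℂ] H) (t : ℝ) (Y : H) :
    expGroup A t (A Y) = A (expGroup A t Y) := by
  have h : Commute A (expGroup A t) := ((Commute.refl A).smul_right _).exp_right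
  exact congrArg (fun L : H →L[ℂ] H => L Y) h.eq.symm

variable [CompleteSpace H]

theorem exp_add_of_commute_clm {A B : H →L[ℂ] H} (h : Commute A B) :
    NormedSpace.exp (A + B) = NormedSpace.exp A * NormedSpace.exp B :=
  letI : NormedAlgebra ℚ (H →L[ℂ] H) := NormedAlgebra.restrictScalars ℚ ℂ (H →L[ℂ] H)
  NormedSpace.exp_add_of_commute h

theorem expGroup_add (A : H →L[ℂ] H) (s t : ℝ) :
    expGroup A (s + t) = expGroup A s * expGroup A t := by
  unfold expGroup
  rw [← exp_add_of_commute_clm, Complex.ofReal_add, add_smul]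
  exact ((Commute.refl A).smul_left _).smul_right _

/-- The left side interpolates between the two groups as `s` runs from `0` to `t`; in the form on
the right its derivative in `s` brings out only `A - B`. -/
theorem expGroup_mul_of_commute {A B : H →L[ℂ] H} (h : Commute A B) (s t : ℝ) :
    expGroup A s * expGroup B (t - s) = expGroup B t * expGroup (A - B) s := by
  unfold expGroup
  rw [← exp_add_of_commute_clm ((h.smul_left _).smul_right _),
    ← exp_add_of_commute_clm (((h.symm.sub_right (Commute.refl B)).smul_left _).smul_right _)]
  congr 1
  push_cast
  module

theorem hasDerivAt_expGroup (A : H →L[ℂ] H) (Y : H) (t : ℝ) :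
    HasDerivAt (fun s => expGroup A s Y) (expGroup A t (A Y)) t := by
  have h1 := hasDerivAt_exp_smul_const A (t : ℂ)
  have h2 := (ContinuousLinearMap.apply ℂ H Y).hasFDerivAt.comp_hasDerivAt (t : ℂ) h1
  have h3 := h2.scomp t (hasDerivAt_id t).ofReal_comp
  rw [Complex.ofReal_one, one_smul] at h3
  exact h3

end Exponential

/-- `B` is a real inner product that is equivalent to the norm. -/
structure IsEquivInner {H : Type*} [NormedAddCommGroup H] [NormedSpace ℂ H]
    (B : H →L[ℝ] H →L[ℝ] ℝ) (c : ℝ) : Prop where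
  pos : 0 < c
  symm : ∀ x y, B x y = B y x
  lower : ∀ x, ‖x‖ ^ 2 ≤ c * B x x
  upper : ∀ x, B x x ≤ c * ‖x‖ ^ 2

/-- The operator with graph `A` is linear and m-dissipative with respect to `B`. -/
structure IsMDissipative {H : Type*} [NormedAddCommGroup H] [NormedSpace ℂ H]
    (B : H →L[ℝ] H →L[ℝ] ℝ) (A : H → H → Prop) : Prop where
  add : ∀ {U W U' W'}, A U W → A U' W' → A (U + U') (W + W')
  smul : ∀ (a : ℂ) {U W}, A U W → A (a • U) (a • W)
  func : ∀ {W}, A 0 W → W = 0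
  diss : ∀ {U W}, A U W → B W U ≤ 0
  range : ∀ lam : ℝ, 0 < lam → ∀ Y, ∃ U, A U (lam • U - Y)

namespace IsEquivInner

variable {H : Type*} [NormedAddCommGroup H] [NormedSpace ℂ H]
  {B : H →L[ℝ] H →L[ℝ] ℝ} {c : ℝ}

theorem nonneg (hB : IsEquivInner B c) (x : H) : 0 ≤ B x x :=
  nonneg_of_mul_nonneg_right ((sq_nonneg _).trans (hB.lower x)) hB.pos

theorem eq_zero (hB : IsEquivInner B c) {x : H} (h : B x x ≤ 0) : x = 0 := by
  have h1 := hB.lower x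
  have h2 : B x x = 0 := le_antisymm h (hB.nonneg x)
  rw [h2, mul_zero] at h1
  exact norm_eq_zero.1 (pow_eq_zero_iff two_ne_zero |>.1 (le_antisymm h1 (sq_nonneg _)))

/-- Each passage between the norm and `B` costs a factor `c` on squares, so the two together cost
`c` on norms. -/
theorem norm_le_of_le (hB : IsEquivInner B c) {x y : H} (h : B x x ≤ B y y) :
    ‖x‖ ≤ c * ‖y‖ := by
  refine abs_le_of_sq_le_sq' ?_ (mul_nonneg hB.pos.le (norm_nonneg _)) |>.2
  calc ‖x‖ ^ 2 ≤ c * B x x := hB.lower x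
    _ ≤ c * (c * ‖y‖ ^ 2) := by
        have := hB.pos.le
        gcongr
        exact h.trans (hB.upper y)
    _ = (c * ‖y‖) ^ 2 := by ring

theorem sub_sub (hB : IsEquivInner B c) (x y : H) :
    B (x - y) (x - y) = B x x - 2 * B x y + B y y := by
  simp only [map_sub, _root_.sub_apply, hB.symm y x]
  ring

theorem two_mul_le (hB : IsEquivInner B c) (x y : H) : 2 * B x y ≤ B x x + B y y := by
  have := hB.nonneg (x - y)
  rw [hB.sub_sub] at this
  linarith

end IsEquivInner

namespace IsMDissipative

variable {H : Type*} [NormedAddCommGroup H] [NormedSpace ℂ H]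
  {B : H →L[ℝ] H →L[ℝ] ℝ} {c : ℝ} {A : H → H → Prop}

theorem sub (hA : IsMDissipative B A) {U W U' W' : H} (h : A U W) (h' : A U' W') :
    A (U - U') (W - W') := by
  have := hA.add h (hA.smul (-1) h')
  simpa [sub_eq_add_neg] using this

theorem rsmul (hA : IsMDissipative B A) (a : ℝ) {U W : H} (h : A U W) : A (a • U) (a • W) := by
  have := hA.smul (a : ℂ) h
  simpa using this

/-- In the expansion of the right side, `-2 lam B(W, U)` and `B(W, W)` are nonnegative. With `W =
lam • U - Y`, which encodes `(lam - A) U = Y`, this is the resolvent estimate, and it also yields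
uniqueness. -/
theorem resolvent_bound (hA : IsMDissipative B A) (hB : IsEquivInner B c) {lam : ℝ}
    (hlam : 0 < lam) {U W : H} (h : A U W) :
    lam ^ 2 * B U U ≤ B (lam • U - W) (lam • U - W) := by
  have h1 := hA.diss h
  have h2 := hB.nonneg W
  rw [hB.sub_sub]
  simp only [map_smul, _root_.smul_apply, smul_eq_mul, hB.symm U W]
  nlinarith

theorem resolvent_unique (hA : IsMDissipative B A) (hB : IsEquivInner B c) {lam : ℝ}
    (hlam : 0 < lam) {U U' Y : H} (h : A U (lam • U - Y)) (h' : A U' (lam • U' - Y)) :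
    U = U' := by
  have h1 := hA.resolvent_bound hB hlam (hA.sub h h')
  have h2 : lam • (U - U') - (lam • U - Y - (lam • U' - Y)) = 0 := by
    rw [smul_sub]; abel
  rw [h2] at h1
  simp only [map_zero] at h1
  have h3 : B (U - U') (U - U') ≤ 0 := by
    have : 0 < lam ^ 2 := by positivity
    by_contra! hc
    exact absurd h1 (not_le.2 (mul_pos this hc))
  exact sub_eq_zero.1 (hB.eq_zero h3)

theorem exists_resolvent (hA : IsMDissipative B A) (hB : IsEquivInner B c) {lam : ℝ}
    (hlam : 0 < lam) : ∃ R : H →L[ℂ] H, ∀ Y, A (R Y) (lam • R Y - Y) := by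
  choose r hr using hA.range lam hlam
  have hadd : ∀ x y, r (x + y) = r x + r y := fun x y => by
    refine hA.resolvent_unique hB hlam (hr _) ?_
    convert hA.add (hr x) (hr y) using 1
    rw [smul_add]; abel
  have hsmul : ∀ (a : ℂ) x, r (a • x) = a • r x := fun a x => by
    refine hA.resolvent_unique hB hlam (hr _) ?_
    convert hA.smul a (hr x) using 1
    rw [smul_sub, smul_comm]
  refine ⟨LinearMap.mkContinuous ⟨⟨r, hadd⟩, hsmul⟩ (lam⁻¹ * c) fun Y => ?_, fun Y => hr Y⟩
  have h1 := hA.resolvent_bound hB hlam (hr Y)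
  rw [sub_sub_cancel] at h1
  have h2 : B (lam • r Y) (lam • r Y) ≤ B Y Y := by
    refine le_trans (le_of_eq ?_) h1
    simp only [map_smul, _root_.smul_apply, smul_eq_mul]
    ring
  have h3 := hB.norm_le_of_le h2
  rw [norm_smul, Real.norm_of_nonneg hlam.le] at h3
  rw [mul_assoc, ← div_eq_inv_mul, le_div_iff₀ hlam, mul_comm]
  exact h3

end IsMDissipative

/-- The resolvents `R n = (n + 1 - A)⁻¹` of an m-dissipative operator. -/
structure IsResolventSeq {H : Type*} [NormedAddCommGroup H] [NormedSpace ℂ H]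
    (A : H → H → Prop) (R : ℕ → H →L[ℂ] H) : Prop where
  mem : ∀ n Y, A (R n Y) ((n + 1 : ℝ) • R n Y - Y)

/-! ### Resolvents and Yosida approximations. -/

section Yosida

variable {H : Type*} [NormedAddCommGroup H] [NormedSpace ℂ H]

/-- The operators `(n + 1) R n`, which approximate the identity. -/
noncomputable def resolventApprox (R : ℕ → H →L[ℂ] H) (n : ℕ) : H →L[ℂ] H := (n + 1 : ℂ) • R n

/-- The Yosida approximations of an operator with resolvents `R n`. -/
noncomputable def yosida (R : ℕ → H →L[ℂ] H) (n : ℕ) : H →L[ℂ] H :=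
  (n + 1 : ℂ) • (resolventApprox R n - 1)

theorem natCast_add_one_smul (n : ℕ) (x : H) : (n + 1 : ℂ) • x = (n + 1 : ℝ) • x := by
  rw [← Complex.coe_smul]; push_cast; rfl

theorem resolventApprox_apply (R : ℕ → H →L[ℂ] H) (n : ℕ) (Y : H) :
    resolventApprox R n Y = (n + 1 : ℝ) • R n Y := by
  rw [← natCast_add_one_smul]; rfl

theorem yosida_apply (R : ℕ → H →L[ℂ] H) (n : ℕ) (Y : H) :
    yosida R n Y = (n + 1 : ℝ) • (resolventApprox R n Y - Y) := by
  rw [← natCast_add_one_smul]; rfl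

theorem resolventApprox_eq (R : ℕ → H →L[ℂ] H) (n : ℕ) (Y : H) :
    resolventApprox R n Y = Y + (n + 1 : ℝ)⁻¹ • yosida R n Y := by
  have : (n + 1 : ℝ) ≠ 0 := by positivity
  rw [yosida_apply, inv_smul_smul₀ this]; abel

namespace IsResolventSeq

variable {B : H →L[ℝ] H →L[ℝ] ℝ} {c : ℝ} {A : H → H → Prop} {R : ℕ → H →L[ℂ] H}

theorem yosida_mem (hR : IsResolventSeq A R) (hA : IsMDissipative B A) (n : ℕ) (Y : H) :
    A (resolventApprox R n Y) (yosida R n Y) := by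
  rw [yosida_apply]
  simp only [resolventApprox_apply]
  exact hA.rsmul _ (hR.mem n Y)

/-- The value of the Yosida approximation at `Y` is the value of `A` at `Y + (n + 1)⁻¹ yosida R n
Y`; dissipativity there leaves a surplus `(n + 1)⁻¹ B(yosida R n Y, yosida R n Y) ≥ 0`. -/
theorem yosida_diss (hR : IsResolventSeq A R) (hA : IsMDissipative B A) (hB : IsEquivInner B c)
    (n : ℕ) (Y : H) : B (yosida R n Y) Y ≤ 0 := by
  have h1 := hA.diss (hR.yosida_mem hA n Y)
  rw [resolventApprox_eq, map_add, map_smul, smul_eq_mul] at h1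
  have h2 := hB.nonneg (yosida R n Y)
  have h3 : (0 : ℝ) ≤ (n + 1 : ℝ)⁻¹ := by positivity
  nlinarith [mul_nonneg h3 h2]

theorem resolvent_apply (hR : IsResolventSeq A R) (hA : IsMDissipative B A)
    (hB : IsEquivInner B c) (n : ℕ) {U W : H} (h : A U W) : R n ((n + 1 : ℝ) • U - W) = U := by
  refine hA.resolvent_unique hB (lam := n + 1) (by positivity) (hR.mem n _) ?_
  rwa [sub_sub_cancel]

theorem resolventApprox_of_mem (hR : IsResolventSeq A R) (hA : IsMDissipative B A)
    (hB : IsEquivInner B c) (n : ℕ) {U W : H} (h : A U W) :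
    resolventApprox R n W = yosida R n U := by
  have h1 := hR.resolvent_apply hA hB n h
  rw [map_sub, ContinuousLinearMap.map_smul_of_tower] at h1
  rw [yosida_apply, resolventApprox_apply, resolventApprox_apply]
  congr 1
  exact eq_sub_of_add_eq (sub_eq_iff_eq_add'.1 h1).symm

theorem resolventApprox_contraction (hR : IsResolventSeq A R) (hA : IsMDissipative B A)
    (hB : IsEquivInner B c) (n : ℕ) (Y : H) :
    B (resolventApprox R n Y) (resolventApprox R n Y) ≤ B Y Y := by
  have h1 := hA.resolvent_bound hB (lam := n + 1) (by positivity) (hR.mem n Y)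
  rw [sub_sub_cancel] at h1
  refine le_trans (le_of_eq ?_) h1
  simp only [resolventApprox_apply, map_smul, _root_.smul_apply, smul_eq_mul]
  ring

theorem resolvent_comm (hR : IsResolventSeq A R) (hA : IsMDissipative B A)
    (hB : IsEquivInner B c) (m n : ℕ) (Y : H) : R m (R n Y) = R n (R m Y) := by
  rcases eq_or_ne m n with rfl | hmn
  · rfl
  -- This is the resolvent identity; comparing it with the one for `m` and `n` exchanged gives
  -- commutation.
  have key : ∀ m n : ℕ, R n Y = ((m : ℝ) - n) • R m (R n Y) + R m Y := by
    intro m n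
    have h1 := hR.resolvent_apply hA hB m (hR.mem n Y)
    have h2 : (m + 1 : ℝ) • R n Y - ((n + 1 : ℝ) • R n Y - Y) = ((m : ℝ) - n) • R n Y + Y := by
      module
    rw [h2, map_add, ContinuousLinearMap.map_smul_of_tower] at h1
    exact h1.symm
  have h1 := key m n
  have h2 := key n m
  have h3 : ((m : ℝ) - n) • (R m (R n Y) - R n (R m Y)) = 0 := by
    have e : ((m : ℝ) - n) • (R m (R n Y) - R n (R m Y)) =
      (((m : ℝ) - n) • R m (R n Y) + R m Y) + (((n : ℝ) - m) • R n (R m Y) + R n Y)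
        - R m Y - R n Y := by module
    rw [e, ← h1, ← h2]; abel
  have h4 : ((m : ℝ) - n) ≠ 0 := sub_ne_zero.2 (by exact_mod_cast hmn)
  exact sub_eq_zero.1 ((smul_eq_zero.1 h3).resolve_left h4)

theorem yosida_commute (hR : IsResolventSeq A R) (hA : IsMDissipative B A)
    (hB : IsEquivInner B c) (m n : ℕ) : Commute (yosida R m) (yosida R n) := by
  have h : Commute (R m) (R n) := ContinuousLinearMap.ext (hR.resolvent_comm hA hB m n)
  unfold yosida resolventApprox
  refine Commute.smul_left (Commute.smul_right ?_ _) _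
  exact ((((h.smul_left _).smul_right _).sub_left (Commute.one_left _))).sub_right
    (Commute.one_right _)

/-- The derivative of `B(T s, T s)` is twice `B(yosida R n (T s), T s)`, which is nonpositive. -/
theorem expGroup_contraction [CompleteSpace H] (hR : IsResolventSeq A R)
    (hA : IsMDissipative B A) (hB : IsEquivInner B c) (n : ℕ) {t : ℝ} (ht : 0 ≤ t) (Y : H) :
    B (expGroup (yosida R n) t Y) (expGroup (yosida R n) t Y) ≤ B Y Y := by
  set T := fun s => expGroup (yosida R n) s Y with hT
  have hd : ∀ s, HasDerivAt (fun s => B (T s) (T s))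
      (B (T s) (yosida R n (T s)) + B (yosida R n (T s)) (T s)) s := fun s => by
    have h1 := hasDerivAt_expGroup (yosida R n) Y s
    rw [expGroup_commute_apply] at h1
    rw [← hasDerivWithinAt_univ] at h1 ⊢
    exact B.hasDerivWithinAt_of_bilinear h1 h1
  have hanti : AntitoneOn (fun s => B (T s) (T s)) univ := by
    refine antitoneOn_of_deriv_nonpos convex_univ
      (fun s _ => (hd s).continuousAt.continuousWithinAt)
      (fun s _ => (hd s).differentiableAt.differentiableWithinAt) fun s _ => ?_
    rw [(hd s).deriv, hB.symm (T s)]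
    linarith [hR.yosida_diss hA hB n (T s)]
  have := hanti (mem_univ 0) (mem_univ t) ht
  simpa [hT, expGroup_zero] using this

/-- On the domain the error is `(n + 1)⁻¹` times the approximation applied to `W`, which stays
bounded. -/
theorem resolventApprox_tendsto_of_mem (hR : IsResolventSeq A R) (hA : IsMDissipative B A)
    (hB : IsEquivInner B c) {U W : H} (h : A U W) :
    Tendsto (fun n => resolventApprox R n U) atTop (𝓝 U) := by
  rw [tendsto_iff_norm_sub_tendsto_zero]
  have h0 : Tendsto (fun n : ℕ => 1 / ((n : ℝ) + 1) * (c * ‖W‖)) atTop (𝓝 0) := by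
    simpa using tendsto_one_div_add_atTop_nhds_zero_nat.mul_const (c * ‖W‖)
  refine squeeze_zero (fun _ => norm_nonneg _) (fun n => ?_) h0
  rw [resolventApprox_eq, add_sub_cancel_left, ← hR.resolventApprox_of_mem hA hB n h, norm_smul,
    one_div, Real.norm_of_nonneg (by positivity)]
  gcongr
  exact hB.norm_le_of_le (hR.resolventApprox_contraction hA hB n W)

/-- The approximations `(n + 1) R n Y` form a Cauchy sequence. -/
theorem resolventApprox_cauchySeq (hR : IsResolventSeq A R) (hA : IsMDissipative B A)
    (hB : IsEquivInner B c) (Y : H) : CauchySeq fun n => resolventApprox R n Y := by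
  set a := fun n => resolventApprox R n Y - Y with ha
  set f := fun n => B (a n) (a n) with hf
  have hay : ∀ n, yosida R n Y = (n + 1 : ℝ) • a n := fun n => yosida_apply R n Y
  -- The errors `a n` have decreasing energies `f n`, and the distance of two of them is controlled
  -- by the drop of energy, which tends to `0`.
  have key : ∀ m n : ℕ, m ≤ n → B (a m - a n) (a m - a n) ≤ f m - f n := by
    intro m n hmn
    have h1 := hA.diss (hA.sub (hR.yosida_mem hA m Y) (hR.yosida_mem hA n Y))
    have h2 : resolventApprox R m Y - resolventApprox R n Y = a m - a n := by
      simp only [ha]; abel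
    rw [h2, hay, hay] at h1
    have h3 := hB.nonneg (a m - a n)
    have hmn' : (m : ℝ) ≤ n := by exact_mod_cast hmn
    rw [hB.sub_sub] at h3 ⊢
    simp only [map_sub, map_smul, _root_.sub_apply, _root_.smul_apply,
      smul_eq_mul, hB.symm (a n) (a m)] at h1
    simp only [hf]
    set p := B (a m) (a m)
    set q := B (a n) (a n)
    set r := B (a m) (a n)
    have hm : (0 : ℝ) ≤ m := m.cast_nonneg
    -- Twice the dissipativity inequality `(m + 1) p - (m + n + 2) r + (n + 1) q ≤ 0`, rearranged.
    -- As `n - m ≤ m + n + 2`, the factor can be dropped once `p ≥ q` is known.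
    have e : ((m : ℝ) + 1 + (n + 1)) * (p - 2 * r + q) ≤ ((n : ℝ) - m) * (p - q) := by
      nlinarith
    have hpq : 0 ≤ p - q ∨ (n : ℝ) = m := by
      rcases hmn'.eq_or_lt with h | h
      · exact Or.inr h.symm
      · left
        by_contra! hc
        have : ((n : ℝ) - m) * (p - q) < 0 := mul_neg_of_pos_of_neg (sub_pos.2 h) hc
        have : 0 ≤ ((m : ℝ) + 1 + (n + 1)) * (p - 2 * r + q) :=
          mul_nonneg (by positivity) h3
        linarith
    rcases hpq with h | h
    · by_contra! hc
      have h4 : ((m : ℝ) + 1 + (n + 1)) * (p - q) < ((m : ℝ) + 1 + (n + 1)) * (p - 2 * r + q) :=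
        mul_lt_mul_of_pos_left hc (by positivity)
      nlinarith
    · have hmn : m = n := by exact_mod_cast h.symm
      subst hmn
      simp only [p, q, r]; linarith
  have hanti : Antitone f := fun m n hmn => by
    linarith [key m n hmn, hB.nonneg (a m - a n)]
  have hbdd : BddBelow (range f) := ⟨0, by rintro _ ⟨n, rfl⟩; exact hB.nonneg _⟩
  have hconv := tendsto_atTop_ciInf hanti hbdd
  have hle : ∀ n, (⨅ i, f i) ≤ f n := fun n => ciInf_le hbdd n
  have hcs : CauchySeq a := by
    refine cauchySeq_of_le_tendsto_0 (fun N => Real.sqrt (c * (f N - ⨅ i, f i)) +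
      Real.sqrt (c * (f N - ⨅ i, f i))) (fun n m N hn hm => ?_) ?_
    · have hb : ∀ n, N ≤ n → ‖a N - a n‖ ≤ Real.sqrt (c * (f N - ⨅ i, f i)) := fun n hn => by
        refine Real.le_sqrt_of_sq_le ((hB.lower _).trans ?_)
        have := hB.pos.le
        gcongr
        linarith [key N n hn, hle n]
      rw [dist_eq_norm]
      calc ‖a n - a m‖ = ‖(a N - a m) - (a N - a n)‖ := by congr 1; abel
        _ ≤ ‖a N - a m‖ + ‖a N - a n‖ := norm_sub_le _ _
        _ ≤ _ := add_le_add (hb m hm) (hb n hn)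
    · have h1 : Tendsto (fun N => Real.sqrt (c * (f N - ⨅ i, f i))) atTop (𝓝 0) := by
        have h2 := ((hconv.sub_const (⨅ i, f i)).const_mul c)
        rw [sub_self, mul_zero] at h2
        have h3 := (Real.continuous_sqrt.tendsto 0).comp h2
        rwa [Real.sqrt_zero] at h3
      simpa using h1.add h1
  have := hcs.add_const (x := Y)
  simpa [ha] using this

/-- Density of the domain comes out here instead of being assumed. The limit `Z` of the
approximations of `Y` is itself well approximated, so the approximations of `Y - Z` tend to `0`.
Then `R 0` kills `Y - Z`, and single-valuedness of the graph at `0` gives `Y = Z`. -/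
theorem resolventApprox_tendsto [CompleteSpace H] (hR : IsResolventSeq A R)
    (hA : IsMDissipative B A) (hB : IsEquivInner B c) (Y : H) :
    Tendsto (fun n => resolventApprox R n Y) atTop (𝓝 Y) := by
  obtain ⟨Z, hZ⟩ := cauchySeq_tendsto_of_complete (hR.resolventApprox_cauchySeq hA hB Y)
  have hbound : ∀ n X, ‖resolventApprox R n X‖ ≤ c * ‖X‖ := fun n X =>
    hB.norm_le_of_le (hR.resolventApprox_contraction hA hB n X)
  have hfix : Tendsto (fun n => resolventApprox R n Z) atTop (𝓝 Z) := by
    rw [Metric.tendsto_atTop]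
    intro ε hε
    have hc := hB.pos
    obtain ⟨k, hk⟩ := (Metric.tendsto_atTop.1 hZ (ε / (2 * (c + 1))) (by positivity))
    have hk := hk k le_rfl
    set X := resolventApprox R k Y
    obtain ⟨N, hN⟩ := Metric.tendsto_atTop.1
      (hR.resolventApprox_tendsto_of_mem hA hB (hR.yosida_mem hA k Y)) (ε / 2) (by positivity)
    refine ⟨N, fun n hn => ?_⟩
    have h1 := hN n hn
    rw [dist_eq_norm] at h1 hk ⊢
    have h2 : resolventApprox R n Z - Z =
        (resolventApprox R n X - X) - resolventApprox R n (X - Z) + (X - Z) := by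
      rw [map_sub]; abel
    rw [h2]
    calc _ ≤ ‖resolventApprox R n X - X‖ + ‖resolventApprox R n (X - Z)‖ + ‖X - Z‖ :=
          (norm_add_le _ _).trans (by gcongr; exact norm_sub_le _ _)
      _ ≤ ‖resolventApprox R n X - X‖ + c * ‖X - Z‖ + ‖X - Z‖ := by gcongr; exact hbound _ _
      _ < ε / 2 + (c + 1) * (ε / (2 * (c + 1))) := by nlinarith
      _ = ε := by field_simp; ring
  have hzero : Tendsto (fun n => resolventApprox R n (Y - Z)) atTop (𝓝 0) := by
    simpa using hZ.sub hfix
  -- `R 0 (Y - Z)` lies in the domain, hence is the limit of its approximations; since the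
  -- resolvents commute, these are `R 0` applied to a sequence tending to `0`.
  have hR0 : R 0 (Y - Z) = 0 := by
    have h1 : Tendsto (fun n => R 0 (resolventApprox R n (Y - Z))) atTop (𝓝 0) := by
      have := ((R 0).continuous.tendsto 0).comp hzero
      rwa [map_zero] at this
    have h2 := hR.resolventApprox_tendsto_of_mem hA hB (hR.mem 0 (Y - Z))
    refine tendsto_nhds_unique (h2.congr fun n => ?_) h1
    rw [resolventApprox_apply, resolventApprox_apply, ContinuousLinearMap.map_smul_of_tower,
      hR.resolvent_comm hA hB]
  have h3 := hR.mem 0 (Y - Z)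
  rw [hR0] at h3
  have h4 := hA.func h3
  rw [smul_zero, zero_sub, neg_eq_zero, sub_eq_zero] at h4
  rwa [← h4] at hZ

end IsResolventSeq

end Yosida

/-! ### The limit of the exponentials of the Yosida approximations. -/

section Generation

variable {H : Type*} [NormedAddCommGroup H] [NormedSpace ℂ H] [CompleteSpace H]
  {B : H →L[ℝ] H →L[ℝ] ℝ} {c : ℝ} {A : H → H → Prop} {R : ℕ → H →L[ℂ] H}

namespace IsResolventSeq

theorem norm_expGroup_le (hR : IsResolventSeq A R) (hA : IsMDissipative B A)
    (hB : IsEquivInner B c) (n : ℕ) {t : ℝ} (ht : 0 ≤ t) (Y : H) :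
    ‖expGroup (yosida R n) t Y‖ ≤ c * ‖Y‖ :=
  hB.norm_le_of_le (hR.expGroup_contraction hA hB n ht Y)

/-- The interpolation between the two groups has derivative `exp(s Aₙ) exp((t - s) Aₘ) (Aₙ - Aₘ) Y`,
where `Aₙ`, `Aₘ` are the Yosida approximations. For `0 ≤ s ≤ t` each exponential costs at most a
factor `c`. -/
theorem norm_expGroup_sub_le (hR : IsResolventSeq A R) (hA : IsMDissipative B A)
    (hB : IsEquivInner B c) (m n : ℕ) {t : ℝ} (ht : 0 ≤ t) (Y : H) :
    ‖expGroup (yosida R n) t Y - expGroup (yosida R m) t Y‖ ≤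
      c * (c * ‖yosida R n Y - yosida R m Y‖) * t := by
  have hcomm := hR.yosida_commute hA hB n m
  have hd : ∀ s : ℝ, HasDerivAt
      (fun s => expGroup (yosida R m) t (expGroup (yosida R n - yosida R m) s Y))
      (expGroup (yosida R m) t (expGroup (yosida R n - yosida R m) s
        ((yosida R n - yosida R m) Y))) s := fun s => by
    have h1 := hasDerivAt_expGroup (yosida R n - yosida R m) Y s
    exact ((expGroup (yosida R m) t).restrictScalars ℝ).hasFDerivAt.comp_hasDerivAt s h1
  have hmul : ∀ s X, expGroup (yosida R m) t (expGroup (yosida R n - yosida R m) s X) =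
      expGroup (yosida R n) s (expGroup (yosida R m) (t - s) X) := fun s X =>
    congrArg (fun L : H →L[ℂ] H => L X) (expGroup_mul_of_commute hcomm s t).symm
  have hbd := norm_image_sub_le_of_norm_deriv_le_segment' (a := 0) (b := t)
    (fun s _ => (hd s).hasDerivWithinAt)
    (C := c * (c * ‖yosida R n Y - yosida R m Y‖)) (fun s hs => by
      rw [hmul]
      refine (hR.norm_expGroup_le hA hB n hs.1 _).trans ?_
      have := hB.pos.le
      gcongr
      exact hR.norm_expGroup_le hA hB m (by linarith [hs.2]) _) t ⟨ht, le_rfl⟩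
  rw [hmul t, hmul 0] at hbd
  simpa [expGroup_zero] using hbd

theorem norm_expGroup_sub_self_le (hR : IsResolventSeq A R) (hA : IsMDissipative B A)
    (hB : IsEquivInner B c) (n : ℕ) {t : ℝ} (ht : 0 ≤ t) (Y : H) :
    ‖expGroup (yosida R n) t Y - Y‖ ≤ c * ‖yosida R n Y‖ * t := by
  have hbd := norm_image_sub_le_of_norm_deriv_le_segment' (a := 0) (b := t)
    (fun s _ => (hasDerivAt_expGroup (yosida R n) Y s).hasDerivWithinAt)
    (C := c * ‖yosida R n Y‖) (fun s hs => hR.norm_expGroup_le hA hB n hs.1 _) t ⟨ht, le_rfl⟩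
  simpa [expGroup_zero] using hbd

/-- Only `yosida R n Y` enters, and it converges for `Y` in the domain; choosing such a `Y` near `X`
makes the estimate uniform in `n`. -/
theorem norm_expGroup_sub_self_le' (hR : IsResolventSeq A R) (hA : IsMDissipative B A)
    (hB : IsEquivInner B c) (n : ℕ) {t : ℝ} (ht : 0 ≤ t) (X Y : H) :
    ‖expGroup (yosida R n) t X - X‖ ≤ (c + 1) * ‖X - Y‖ + c * ‖yosida R n Y‖ * t := by
  have h1 := hR.norm_expGroup_le hA hB n ht (X - Y)
  have h2 := hR.norm_expGroup_sub_self_le hA hB n ht Y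
  have e : expGroup (yosida R n) t X - X =
      expGroup (yosida R n) t (X - Y) - (X - Y) + (expGroup (yosida R n) t Y - Y) := by
    rw [map_sub]; abel
  rw [e]
  refine (norm_add_le _ _).trans (add_le_add ((norm_sub_le _ _).trans ?_) h2)
  linarith

/-- A first-order Taylor bound that survives `n → ∞`: the derivative of the remainder is `exp(s Aₙ)
Aₙ U - Aₙ U`, with `Aₙ` the Yosida approximation. Comparison with `Y` avoids `Aₙ² U`, which need not
converge. -/
theorem norm_expGroup_taylor_le (hR : IsResolventSeq A R) (hA : IsMDissipative B A)
    (hB : IsEquivInner B c) (n : ℕ) {t : ℝ} (ht : 0 ≤ t) (U Y : H) :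
    ‖expGroup (yosida R n) t U - U - t • yosida R n U‖ ≤
      ((c + 1) * ‖yosida R n U - Y‖ + c * ‖yosida R n Y‖ * t) * t := by
  have hd : ∀ s : ℝ, HasDerivAt (fun s => expGroup (yosida R n) s U - s • yosida R n U)
      (expGroup (yosida R n) s (yosida R n U) - yosida R n U) s := fun s => by
    have h2 := (hasDerivAt_id s).smul_const (yosida R n U)
    rw [one_smul] at h2
    exact (hasDerivAt_expGroup (yosida R n) U s).sub h2
  have hbd := norm_image_sub_le_of_norm_deriv_le_segment' (a := 0) (b := t)
    (fun s _ => (hd s).hasDerivWithinAt)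
    (C := (c + 1) * ‖yosida R n U - Y‖ + c * ‖yosida R n Y‖ * t) (fun s hs => by
      refine (hR.norm_expGroup_sub_self_le' hA hB n hs.1 _ Y).trans ?_
      have := hB.pos.le
      gcongr
      exact hs.2.le) t ⟨ht, le_rfl⟩
  simp only [expGroup_zero, zero_smul, sub_zero] at hbd
  rw [sub_right_comm]
  exact hbd

theorem yosida_tendsto (hR : IsResolventSeq A R) (hA : IsMDissipative B A)
    (hB : IsEquivInner B c) {U W : H} (h : A U W) :
    Tendsto (fun n => yosida R n U) atTop (𝓝 W) :=
  (hR.resolventApprox_tendsto hA hB W).congr fun n => hR.resolventApprox_of_mem hA hB n h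

theorem exists_mem_near (hR : IsResolventSeq A R) (hA : IsMDissipative B A)
    (hB : IsEquivInner B c) (X : H) {ε : ℝ} (hε : 0 < ε) : ∃ Y W, A Y W ∧ ‖X - Y‖ < ε := by
  obtain ⟨k, hk⟩ := Metric.tendsto_atTop.1 (hR.resolventApprox_tendsto hA hB X) ε hε
  refine ⟨_, _, hR.yosida_mem hA k X, ?_⟩
  rw [← dist_eq_norm, dist_comm]
  exact hk k le_rfl

theorem cauchySeq_expGroup (hR : IsResolventSeq A R) (hA : IsMDissipative B A)
    (hB : IsEquivInner B c) {t : ℝ} (ht : 0 ≤ t) (X : H) :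
    CauchySeq fun n => expGroup (yosida R n) t X := by
  rw [Metric.cauchySeq_iff]
  intro ε hε
  have hc := hB.pos
  -- Replacing `X` by `Y` costs at most `ε / 4` for each of the two exponentials; the difference on
  -- `Y` takes the remaining `ε / 2`. The factor `t + 1` below keeps the denominator positive at `t
  -- = 0`.
  obtain ⟨Y, W, hYW, hY⟩ := hR.exists_mem_near hA hB X (ε := ε / (4 * c)) (by positivity)
  obtain ⟨N, hN⟩ := Metric.cauchySeq_iff.1 (hR.yosida_tendsto hA hB hYW).cauchySeq
    (ε / (2 * (c * c * (t + 1)))) (by positivity)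
  refine ⟨N, fun m hm n hn => ?_⟩
  have h1 := hN m hm n hn
  rw [dist_eq_norm] at h1 ⊢
  have h2 := hR.norm_expGroup_sub_le hA hB n m ht Y
  have h3 := hR.norm_expGroup_le hA hB m ht (X - Y)
  have h4 := hR.norm_expGroup_le hA hB n ht (X - Y)
  have e : expGroup (yosida R m) t X - expGroup (yosida R n) t X =
      expGroup (yosida R m) t (X - Y) - expGroup (yosida R n) t (X - Y) +
        (expGroup (yosida R m) t Y - expGroup (yosida R n) t Y) := by
    simp only [map_sub]; abel
  have h5 : c * ‖X - Y‖ < ε / 4 := by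
    rw [lt_div_iff₀ (by positivity)] at hY ⊢
    linarith
  have h6 : c * (c * ‖yosida R m Y - yosida R n Y‖) * t ≤ ε / 2 := by
    rw [lt_div_iff₀ (by positivity)] at h1
    have : 0 ≤ c * c * ‖yosida R m Y - yosida R n Y‖ := by positivity
    linarith
  rw [e]
  calc _ ≤ _ := norm_add_le _ _
    _ ≤ _ := add_le_add (norm_sub_le _ _) h2
    _ < ε := by linarith

/-- The limit of the semigroups generated by the Yosida approximations. -/
theorem exists_limit (hR : IsResolventSeq A R) (hA : IsMDissipative B A)
    (hB : IsEquivInner B c) : ∃ S : ℝ≥0 → H →L[ℂ] H, ∀ (t : ℝ≥0) Y,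
      Tendsto (fun n => expGroup (yosida R n) t Y) atTop (𝓝 (S t Y)) := by
  have h : ∀ t : ℝ≥0, ∃ L : H →L[ℂ] H, ∀ Y,
      Tendsto (fun n => expGroup (yosida R n) t Y) atTop (𝓝 (L Y)) := fun t => by
    choose f hf using fun Y =>
      cauchySeq_tendsto_of_complete (hR.cauchySeq_expGroup hA hB t.2 Y)
    exact ⟨continuousLinearMapOfTendsto (fun n => expGroup (yosida R n) t)
      (tendsto_pi_nhds.2 hf), hf⟩
  choose S hS using h
  exact ⟨S, hS⟩

end IsResolventSeq

/-- An m-dissipative operator generates a strongly continuous semigroup. -/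
theorem IsMDissipative.exists_semigroup (hA : IsMDissipative B A) (hB : IsEquivInner B c) :
    ∃ S : ℝ≥0 → H →L[ℂ] H, IsSemigroupGeneratedBy S A := by
  choose R hRmem using fun n : ℕ => hA.exists_resolvent hB (lam := n + 1) (by positivity)
  have hR : IsResolventSeq A R := ⟨hRmem⟩
  obtain ⟨S, hS⟩ := hR.exists_limit hA hB
  have hc := hB.pos
  have hnorm : ∀ (t : ℝ≥0) Y, ‖S t Y‖ ≤ c * ‖Y‖ := fun t Y =>
    le_of_tendsto (hS t Y).norm (Eventually.of_forall fun n => hR.norm_expGroup_le hA hB n t.2 Y)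
  have hcontr : ∀ (t : ℝ≥0) Y, B (S t Y) (S t Y) ≤ B Y Y := fun t Y => by
    have hcont : Continuous fun X => B X X := by fun_prop
    exact le_of_tendsto ((hcont.tendsto _).comp (hS t Y))
      (Eventually.of_forall fun n => hR.expGroup_contraction hA hB n t.2 Y)
  have hself : ∀ (t : ℝ≥0) X {Y W}, A Y W →
      ‖S t X - X‖ ≤ (c + 1) * ‖X - Y‖ + c * ‖W‖ * t := fun t X Y W h => by
    refine le_of_tendsto_of_tendsto ((hS t X).sub_const X).norm
      ((((hR.yosida_tendsto hA hB h).norm.const_mul c).mul_const (t : ℝ)).const_add _)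
      (Eventually.of_forall fun n => hR.norm_expGroup_sub_self_le' hA hB n t.2 X Y)
  have htaylor : ∀ (t : ℝ≥0) {U V Y W}, A U V → A Y W →
      ‖S t U - U - (t : ℝ) • V‖ ≤ ((c + 1) * ‖V - Y‖ + c * ‖W‖ * t) * t :=
    fun t U V Y W h h' => by
      have hU := hR.yosida_tendsto hA hB h
      have hY := hR.yosida_tendsto hA hB h'
      refine le_of_tendsto_of_tendsto (((hS t U).sub_const U).sub (hU.const_smul (t : ℝ))).norm
        (((((hU.sub_const Y).norm.const_mul (c + 1))).add
          ((hY.norm.const_mul c).mul_const (t : ℝ))).mul_const (t : ℝ))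
        (Eventually.of_forall fun n => hR.norm_expGroup_taylor_le hA hB n t.2 U Y)
  have hC0 : IsC0Semigroup S := by
    refine ⟨?_, ?_, ?_⟩
    · ext Y
      refine tendsto_nhds_unique (hS 0 Y) ?_
      simp [expGroup_zero]
    · intro s t
      ext Y
      refine tendsto_nhds_unique (hS (s + t) Y) ?_
      have h1 : Tendsto (fun n => expGroup (yosida R n) s (expGroup (yosida R n) t Y - S t Y))
          atTop (𝓝 0) := by
        have h0 : Tendsto (fun n => c * ‖expGroup (yosida R n) t Y - S t Y‖) atTop (𝓝 0) := by
          simpa using (((hS t Y).sub_const (S t Y)).norm.const_mul c)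
        exact squeeze_zero_norm (fun n => hR.norm_expGroup_le hA hB n s.2 _) h0
      have h2 := h1.add (hS s (S t Y))
      rw [zero_add] at h2
      refine h2.congr fun n => ?_
      rw [map_sub, sub_add_cancel, NNReal.coe_add, expGroup_add]
      rfl
    · intro X
      rw [Metric.tendsto_nhds]
      intro ε hε
      obtain ⟨Y, W, hYW, hY⟩ := hR.exists_mem_near hA hB X (ε := ε / (2 * (c + 1)))
        (by positivity)
      have h1 : Tendsto (fun t : ℝ≥0 => c * ‖W‖ * (t : ℝ)) (𝓝 0) (𝓝 0) := by
        have : Continuous fun t : ℝ≥0 => c * ‖W‖ * (t : ℝ) := by fun_prop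
        simpa using this.tendsto 0
      filter_upwards [h1.eventually (gt_mem_nhds (show (0 : ℝ) < ε / 2 by positivity))] with t ht
      rw [dist_eq_norm]
      have h2 := hself t X hYW
      rw [lt_div_iff₀ (by positivity)] at hY
      linarith
  have hle : ∀ {U V}, A U V → GeneratorGraph S U V := by
    intro U V hUV
    rw [GeneratorGraph, Metric.tendsto_nhds]
    intro ε hε
    -- The vector `V` need not lie in the domain, so the Taylor bound is used with a nearby `Y` that
    -- does.
    obtain ⟨Y, W, hYW, hY⟩ := hR.exists_mem_near hA hB V (ε := ε / (2 * (c + 1)))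
      (by positivity)
    have h1 : Tendsto (fun t : ℝ≥0 => c * ‖W‖ * (t : ℝ)) (𝓝[>] 0) (𝓝 0) := by
      have : Continuous fun t : ℝ≥0 => c * ‖W‖ * (t : ℝ) := by fun_prop
      simpa using (this.tendsto 0).mono_left nhdsWithin_le_nhds
    filter_upwards [h1.eventually (gt_mem_nhds (show (0 : ℝ) < ε / 2 by positivity)),
      self_mem_nhdsWithin] with t ht htpos
    have htpos : (0 : ℝ) < t := by exact_mod_cast htpos
    have h2 := htaylor t hUV hYW
    have e : ((t : ℝ) : ℂ)⁻¹ • (S t U - U) - V = (t : ℝ)⁻¹ • (S t U - U - (t : ℝ) • V) := by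
      rw [← Complex.ofReal_inv, Complex.coe_smul, smul_sub _ (S t U - U), inv_smul_smul₀ htpos.ne']
    rw [dist_eq_norm, e, norm_smul, norm_inv, Real.norm_of_nonneg htpos.le, ← div_eq_inv_mul,
      div_lt_iff₀ htpos]
    refine h2.trans_lt ?_
    gcongr
    rw [lt_div_iff₀ (by positivity)] at hY
    linarith
  refine ⟨S, hC0, fun U W => ⟨hle, fun hgen => ?_⟩⟩
  -- Conversely, let `U` be in the domain of the generator with value `W`. The resolvent at `1`
  -- gives `Z` in the domain of `A` with `Z - AZ = U - W`. Then the generator maps `Z - U` to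
  -- itself, which a contraction semigroup allows only for `Z = U`.
  have hZ := hRmem 0 (U - W)
  set Z := R 0 (U - W)
  have e0 : ((0 : ℕ) + 1 : ℝ) • Z - (U - W) = Z - U + W := by
    rw [Nat.cast_zero, zero_add, one_smul]; abel
  rw [e0] at hZ
  have hV : GeneratorGraph S (Z - U) (Z - U) := by
    have h1 : Tendsto _ _ _ := (hle hZ).sub hgen
    rw [add_sub_cancel_right] at h1
    refine h1.congr fun t => ?_
    rw [← smul_sub, map_sub]
    congr 1
    abel
  have hzero : B (Z - U) (Z - U) ≤ 0 := by
    have h1 := generatorGraph_iff_real.1 hV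
    have hcont : Continuous fun X => B X (Z - U) := by fun_prop
    refine le_of_tendsto ((hcont.tendsto _).comp h1) ?_
    filter_upwards [self_mem_nhdsWithin] with t ht
    simp only [Function.comp_apply, map_smul, map_sub B (S _ _), _root_.sub_apply,
      _root_.smul_apply, smul_eq_mul]
    -- By Cauchy–Schwarz and contractivity `B(S t X, X) ≤ B(X, X)`, so the difference quotients
    -- paired with `X = Z - U` are nonpositive.
    have h2 := hB.two_mul_le (S t.toNNReal (Z - U)) (Z - U)
    have h3 := hcontr t.toNNReal (Z - U)
    have h4 : (0 : ℝ) ≤ t⁻¹ := inv_nonneg.2 (le_of_lt ht)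
    nlinarith
  have hZU : Z = U := sub_eq_zero.1 (hB.eq_zero hzero)
  rwa [hZU, sub_self, zero_add] at hZ

omit [CompleteSpace H] in
theorem GeneratorGraph.exp_smul {S : ℝ≥0 → H →L[ℂ] H} {U W : H}
    (h : GeneratorGraph S U W) (om : ℝ) :
    GeneratorGraph (fun t => (Real.exp (om * t) : ℂ) • S t) U (W + om • U) := by
  rw [generatorGraph_iff_real] at h ⊢
  have hexp : HasDerivAt (fun t : ℝ => Real.exp (om * t)) om 0 := by
    have := ((hasDerivAt_id (0 : ℝ)).const_mul om).exp
    simpa using this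
  have h1 := (hasDerivAt_iff_tendsto_slope.1 hexp).mono_left
    (nhdsWithin_mono 0 (fun x (hx : 0 < x) => hx.ne'))
  have h2 : Tendsto (fun t : ℝ => Real.exp (om * t)) (𝓝[>] 0) (𝓝 1) := by
    have : Continuous fun t : ℝ => Real.exp (om * t) := by fun_prop
    simpa using (this.tendsto 0).mono_left nhdsWithin_le_nhds
  have h3 := (h2.smul h).add (h1.smul_const U)
  rw [one_smul] at h3
  refine h3.congr' ?_
  filter_upwards [self_mem_nhdsWithin] with t ht
  rw [_root_.smul_apply, Complex.coe_smul, Real.coe_toNNReal _ (le_of_lt ht)]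
  simp only [slope, vsub_eq_sub, sub_zero, mul_zero, Real.exp_zero, smul_eq_mul]
  module

omit [CompleteSpace H] in
theorem IsC0Semigroup.exp_smul {S : ℝ≥0 → H →L[ℂ] H} (hS : IsC0Semigroup S) (om : ℝ) :
    IsC0Semigroup fun t => (Real.exp (om * t) : ℂ) • S t := by
  refine ⟨?_, ?_, fun U => ?_⟩
  · simp [hS.zero]
  · intro s t
    rw [hS.add, ContinuousLinearMap.smul_comp, ContinuousLinearMap.comp_smul, smul_smul]
    congr 1
    push_cast
    rw [mul_add, Complex.exp_add]
  · have h1 : Tendsto (fun t : ℝ≥0 => (Real.exp (om * t) : ℂ)) (𝓝 0) (𝓝 1) := by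
      have : Continuous fun t : ℝ≥0 => (Real.exp (om * t) : ℂ) := by fun_prop
      simpa using this.tendsto 0
    simpa using h1.smul (hS.continuous_at_zero U)

/-- A quasi-dissipative operator that satisfies the range condition generates a strongly
continuous semigroup. -/
theorem exists_semigroup_of_quasiDissipative (hB : IsEquivInner B c) (om : ℝ)
    (hadd : ∀ {U W U' W'}, A U W → A U' W' → A (U + U') (W + W'))
    (hsmul : ∀ (a : ℂ) {U W}, A U W → A (a • U) (a • W))
    (hfunc : ∀ {W}, A 0 W → W = 0)
    (hdiss : ∀ {U W}, A U W → B W U ≤ om * B U U)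
    (hrange : ∀ lam : ℝ, om < lam → ∀ Y, ∃ U, A U (lam • U - Y)) :
    ∃ S : ℝ≥0 → H →L[ℂ] H, IsSemigroupGeneratedBy S A := by
  -- This relation is the graph of `A - om`; the shift is undone by multiplying its semigroup by
  -- `exp(om t)`.
  have hA : IsMDissipative B fun U W => A U (W + om • U) := by
    refine ⟨fun {U W U' W'} h h' => ?_, fun a {U W} h => ?_, fun {W} h => ?_, fun {U W} h => ?_,
      fun lam hlam Y => ?_⟩
    · convert hadd h h' using 1
      module
    · convert hsmul a h using 1
      rw [smul_add, smul_comm]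
    · exact hfunc (by simpa using h)
    · have := hdiss h
      simp only [map_add, map_smul, _root_.add_apply, _root_.smul_apply, smul_eq_mul] at this
      linarith
    · obtain ⟨U, hU⟩ := hrange (lam + om) (by linarith) Y
      refine ⟨U, ?_⟩
      convert hU using 1
      module
  obtain ⟨S, hS, hgen⟩ := hA.exists_semigroup hB
  refine ⟨_, hS.exp_smul om, fun U W => ⟨fun h => ?_, fun h => ?_⟩⟩
  · have h1 : GeneratorGraph S U (W - om • U) := (hgen _ _).1 (by simpa using h)
    have h2 := h1.exp_smul om
    rwa [sub_add_cancel] at h2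
  · have h1 := GeneratorGraph.exp_smul h (-om)
    have e : (fun t : ℝ≥0 => (Real.exp (-om * t) : ℂ) • (Real.exp (om * t) : ℂ) • S t) = S := by
      funext t
      rw [smul_smul, ← Complex.ofReal_mul, ← Real.exp_add]
      simp
    rw [e] at h1
    have h2 := (hgen _ _).2 h1
    simpa using h2

end Generation

/-! ### Absolutely continuous vector-valued functions and weak derivatives -/

section AbsolutelyContinuous

variable {E F G : Type*} [NormedAddCommGroup E] [NormedSpace ℝ E] [NormedAddCommGroup F]
  [NormedSpace ℝ F] [NormedAddCommGroup G] [NormedSpace ℝ G]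

/-- A bilinear expression in absolutely continuous functions is absolutely continuous. -/
theorem AbsolutelyContinuousOnInterval.bilinear (B : E →L[ℝ] F →L[ℝ] G) {f : ℝ → E} {g : ℝ → F}
    {a b : ℝ} (hf : AbsolutelyContinuousOnInterval f a b)
    (hg : AbsolutelyContinuousOnInterval g a b) :
    AbsolutelyContinuousOnInterval (fun x => B (f x) (g x)) a b := by
  obtain ⟨C, hC⟩ := hf.exists_bound
  obtain ⟨D, hD⟩ := hg.exists_bound
  unfold AbsolutelyContinuousOnInterval at hf hg
  refine squeeze_zero' (Eventually.of_forall fun _ => Finset.sum_nonneg fun _ _ => dist_nonneg)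
    ?_ (by simpa using (hg.const_mul (‖B‖ * C)).add (hf.const_mul (‖B‖ * D)))
  rw [eventually_inf_principal]
  filter_upwards with (n, I) hnI
  simp only [Finset.mul_sum, ← Finset.sum_add_distrib]
  refine Finset.sum_le_sum fun i hi => ?_
  simp only [AbsolutelyContinuousOnInterval.disjWithin, mem_ofPred_eq] at hnI
  refine (dist_triangle _ (B (f (I i).1) (g (I i).2)) _).trans (add_le_add ?_ ?_)
  · rw [dist_eq_norm, dist_eq_norm, ← map_sub]
    refine (B.le_opNorm₂ _ _).trans ?_
    gcongr
    exact hC _ (hnI.left i hi |>.left)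
  · rw [dist_eq_norm, dist_eq_norm, ← _root_.sub_apply, ← map_sub]
    refine (B.le_opNorm₂ _ _).trans ?_
    rw [mul_right_comm]
    gcongr
    exact hD _ (hnI.left i hi |>.right)

/-- Each increment is dominated by the increment of the scalar integral of `‖g‖`. -/
theorem absolutelyContinuousOnInterval_integral {g : ℝ → E} {a b : ℝ}
    (hg : IntervalIntegrable g volume a b) :
    AbsolutelyContinuousOnInterval (fun x => ∫ s in a..x, g s) a b := by
  have h := hg.norm.absolutelyContinuousOnInterval_intervalIntegral (c := a) (by simp)
  unfold AbsolutelyContinuousOnInterval at h ⊢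
  refine squeeze_zero' (Eventually.of_forall fun _ => Finset.sum_nonneg fun _ _ => dist_nonneg)
    ?_ h
  rw [eventually_inf_principal]
  filter_upwards with (n, I) hnI
  refine Finset.sum_le_sum fun i hi => ?_
  simp only [AbsolutelyContinuousOnInterval.disjWithin, mem_ofPred_eq] at hnI
  have h1 := (hnI.left i hi).left
  have h2 := (hnI.left i hi).right
  have i1 : IntervalIntegrable g volume a (I i).1 := by
    apply IntervalIntegrable.mono_set' hg; grind [uIoc, uIcc]
  have i2 : IntervalIntegrable g volume a (I i).2 := by
    apply IntervalIntegrable.mono_set' hg; grind [uIoc, uIcc]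
  rw [dist_comm, dist_comm (∫ v in a..(I i).1, ‖g v‖), dist_eq_norm, dist_eq_norm,
    intervalIntegral.integral_interval_sub_left i2 i1,
    intervalIntegral.integral_interval_sub_left i2.norm i1.norm]
  exact intervalIntegral.norm_integral_le_abs_integral_norm

variable [CompleteSpace E]

/-- The fundamental theorem of calculus for absolutely continuous vector-valued functions. -/
theorem AbsolutelyContinuousOnInterval.integral_eq_sub_of_ae_hasDerivAt {f f' : ℝ → E} {a b : ℝ}
    (hf : AbsolutelyContinuousOnInterval f a b)
    (hd : ∀ᵐ x, x ∈ uIcc a b → HasDerivAt f (f' x) x)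
    (hi : IntervalIntegrable f' volume a b) : ∫ x in a..b, f' x = f b - f a := by
  -- The difference of `f` and the integral of `f'` is absolutely continuous with derivative zero
  -- almost everywhere, hence constant.
  have hac := hf.sub (absolutelyContinuousOnInterval_integral hi)
  have h0 : ∀ᵐ x, x ∈ uIcc a b → HasDerivAt (f - fun x => ∫ s in a..x, f' s) 0 x := by
    filter_upwards [hd, hi.ae_hasDerivAt_integral] with x h1 h2 hx
    have := (h1 hx).sub (h2 hx a left_mem_uIcc)
    rwa [sub_self] at this
  obtain ⟨C, hC⟩ := hac.const_of_ae_hasDerivAt_zero h0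
  have ha := hC a left_mem_uIcc
  have hb := hC b right_mem_uIcc
  simp only [Pi.sub_apply, intervalIntegral.integral_same, sub_zero] at ha hb
  rw [ha, ← hb]; abel

end AbsolutelyContinuous

section WeakDeriv

variable {E : Type*} [NormedAddCommGroup E] [NormedSpace ℝ E]

theorem integral_Ioo_eq_interval {l : ℝ} (hl : 0 ≤ l) (f : ℝ → E) :
    ∫ x in Ioo 0 l, f x = ∫ x in (0 : ℝ)..l, f x := by
  rw [intervalIntegral.integral_of_le hl, integral_Ioc_eq_integral_Ioo]

omit [NormedSpace ℝ E] in
theorem intervalIntegrable_iff_Ioo {l : ℝ} (hl : 0 ≤ l) {f : ℝ → E} :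
    IntervalIntegrable f volume 0 l ↔ Integrable f (volume.restrict (Ioo 0 l)) := by
  rw [intervalIntegrable_iff_integrableOn_Ioc_of_le hl, integrableOn_Ioc_iff_integrableOn_Ioo]
  rfl

/-- On `[0, l]`, the function `f` is a primitive of the integrable function `g`. -/
def IsPrimitive (l : ℝ) (f g : ℝ → E) : Prop :=
  IntervalIntegrable g volume 0 l ∧ ∀ x ∈ Icc 0 l, f x = f 0 + ∫ s in (0 : ℝ)..x, g s

variable [CompleteSpace E]

/-- Integrate the derivative of `φ • F` over `[0, l]`, where `φ` vanishes at both ends. `F` extends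
`f` beyond the interval, so that two-sided derivatives make sense. -/
theorem IsPrimitive.hasWeakDerivOn {l : ℝ} (hl : 0 < l) {f g u : ℝ → E}
    (h : IsPrimitive l f g) (hu : u =ᵐ[volume.restrict (Ioo 0 l)] f) : HasWeakDerivOn l u g := by
  intro φ hφ _ hsupp
  set F : ℝ → E := fun x => f 0 + ∫ s in (0 : ℝ)..x, g s with hF
  have hFac : AbsolutelyContinuousOnInterval F 0 l := by
    have hc : AbsolutelyContinuousOnInterval (fun _ : ℝ => f 0) 0 l :=
      ((LipschitzWith.const (f 0)).lipschitzOnWith).absolutelyContinuousOnInterval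
    exact hc.add (absolutelyContinuousOnInterval_integral h.1)
  have hφac : AbsolutelyContinuousOnInterval φ 0 l :=
    (hφ.of_le (by exact_mod_cast le_top)).contDiffOn.absolutelyContinuousOnInterval
  have hφd : ∀ x, HasDerivAt φ (deriv φ x) x := fun x =>
    ((hφ.differentiable (by simp)) x).hasDerivAt
  have hφ' : Continuous (deriv φ) := hφ.continuous_deriv (by exact_mod_cast le_top)
  have hac := hφac.bilinear (ContinuousLinearMap.lsmul ℝ ℝ) hFac
  simp only [ContinuousLinearMap.lsmul_apply] at hac
  have hd : ∀ᵐ x, x ∈ uIcc 0 l →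
      HasDerivAt (fun x => φ x • F x) (φ x • g x + deriv φ x • F x) x := by
    filter_upwards [h.1.ae_hasDerivAt_integral] with x hx hmem
    exact (hφd x).smul ((hx hmem 0 left_mem_uIcc).const_add (f 0))
  have i1 : IntervalIntegrable (fun x => φ x • g x) volume 0 l :=
    h.1.continuousOn_smul hφ.continuous.continuousOn
  have i2 : IntervalIntegrable (fun x => deriv φ x • F x) volume 0 l :=
    (hφ'.continuousOn.smul hFac.continuousOn).intervalIntegrable
  have hint := hac.integral_eq_sub_of_ae_hasDerivAt hd (i1.add i2)
  have hz : ∀ x, x ∉ Ioo 0 l → φ x = 0 := fun x hx =>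
    image_eq_zero_of_notMem_tsupport fun hx' => hx (hsupp hx')
  rw [intervalIntegral.integral_add i1 i2, hz 0 (by simp), hz l (by simp)] at hint
  have e : ∫ x in Ioo 0 l, deriv φ x • u x = ∫ x in Ioo 0 l, deriv φ x • F x := by
    refine integral_congr_ae ?_
    filter_upwards [hu, ae_restrict_mem measurableSet_Ioo] with x hx hmem
    rw [hx, h.2 x (Ioo_subset_Icc_self hmem)]
  rw [e, integral_Ioo_eq_interval hl.le, integral_Ioo_eq_interval hl.le]
  simp only [zero_smul, sub_self] at hint
  exact eq_neg_of_add_eq_zero_right hint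

omit [CompleteSpace E] in
theorem IsPrimitive.continuousOn {l : ℝ} (hl : 0 ≤ l) {f g : ℝ → E} (h : IsPrimitive l f g) :
    ContinuousOn f (Icc 0 l) := by
  have h1 := (absolutelyContinuousOnInterval_integral h.1).continuousOn
  rw [uIcc_of_le hl] at h1
  exact (continuousOn_const.add h1).congr h.2

/-- A test function with vanishing integral has a primitive that is a test function. -/
theorem exists_testFunction_primitive {l : ℝ} {φ : ℝ → ℝ} (hφ : ContDiff ℝ ∞ φ)
    (hc : HasCompactSupport φ) (hs : tsupport φ ⊆ Ioo 0 l) (h0 : ∫ x, φ x = 0) :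
    ∃ χ : ℝ → ℝ, ContDiff ℝ ∞ χ ∧ HasCompactSupport χ ∧ tsupport χ ⊆ Ioo 0 l ∧
      deriv χ = φ := by
  rcases (tsupport φ).eq_empty_or_nonempty with hemp | hne
  · have : φ = 0 := tsupport_eq_empty_iff.1 hemp
    refine ⟨0, contDiff_const, HasCompactSupport.zero, by simp, ?_⟩
    rw [this]; funext x; simp
  have hcomp : IsCompact (tsupport φ) := hc
  -- The primitive starts at the left end `α` of the support: it vanishes to the left of `α`, and
  -- beyond the right end `β` because the total integral is zero.
  obtain ⟨α, hα, hαm⟩ := hcomp.exists_isLeast hne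
  obtain ⟨β, hβ, hβm⟩ := hcomp.exists_isGreatest hne
  have hz : ∀ x, x ∉ Icc α β → φ x = 0 := fun x hx =>
    image_eq_zero_of_notMem_tsupport fun hx' => hx ⟨hαm hx', hβm hx'⟩
  have hd : ∀ x, HasDerivAt (fun x => ∫ s in α..x, φ s) (φ x) x := fun x =>
    intervalIntegral.integral_hasDerivAt_right (hφ.continuous.intervalIntegrable _ _)
      (hφ.continuous.stronglyMeasurableAtFilter _ _) hφ.continuous.continuousAt
  have hderiv : deriv (fun x => ∫ s in α..x, φ s) = φ := funext fun x => (hd x).deriv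
  have hsub : Function.support (fun x => ∫ s in α..x, φ s) ⊆ Icc α β := by
    intro x hx
    by_contra hcon
    refine hx ?_
    rcases lt_or_ge x α with h | h
    · have h1 : ∀ s ∈ uIcc α x, s ≠ α → φ s = 0 := fun s hs hsα => by
        rw [uIcc_of_ge h.le] at hs
        exact hz s fun hs' => hsα (le_antisymm hs.2 hs'.1)
      show ∫ s in α..x, φ s = 0
      rw [intervalIntegral.integral_symm, intervalIntegral.integral_of_le h.le,
        integral_Ioc_eq_integral_Ioo, setIntegral_eq_zero_of_forall_eq_zero, neg_zero]
      exact fun s hs => hz s fun hs' => absurd hs.2 (not_lt.2 hs'.1)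
    · have hxβ : β < x := by
        by_contra! h2
        exact hcon ⟨h, h2⟩
      show ∫ s in α..x, φ s = 0
      rw [intervalIntegral.integral_of_le h, ← integral_Icc_eq_integral_Ioc,
        setIntegral_eq_integral_of_forall_compl_eq_zero, h0]
      exact fun s hs => hz s fun hs' => hs ⟨hs'.1, hs'.2.trans hxβ.le⟩
  have hts : tsupport (fun x => ∫ s in α..x, φ s) ⊆ Icc α β :=
    closure_minimal hsub isClosed_Icc
  refine ⟨fun x => ∫ s in α..x, φ s, ?_, HasCompactSupport.of_support_subset_isCompact
    isCompact_Icc hsub, hts.trans fun x hx => ⟨(hs hα).1.trans_le hx.1, hx.2.trans_lt (hs hβ).2⟩,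
    hderiv⟩
  rw [contDiff_infty_iff_deriv, hderiv]
  exact ⟨fun x => (hd x).differentiableAt, hφ⟩

theorem exists_testFunction_integral_eq_one {l : ℝ} (hl : 0 < l) :
    ∃ ψ : ℝ → ℝ, ContDiff ℝ ∞ ψ ∧ HasCompactSupport ψ ∧ tsupport ψ ⊆ Ioo 0 l ∧
      ∫ x, ψ x = 1 := by
  obtain ⟨f, hf1, hf2, hf3, hf4, hf5⟩ := exists_contDiff_tsupport_subset (n := ⊤)
    (Ioo_mem_nhds (show (0 : ℝ) < l / 2 by positivity) (show l / 2 < l by linarith))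
  have hpos : 0 < ∫ x, f x := by
    refine hf3.continuous.integral_pos_of_hasCompactSupport_nonneg_nonzero hf2
      (fun x => (hf4 ⟨x, rfl⟩).1) (x := l / 2) ?_
    rw [hf5]; exact one_ne_zero
  refine ⟨fun x => (∫ x, f x)⁻¹ * f x, contDiff_const.mul hf3, hf2.mul_left,
    (closure_mono (Function.support_mul_subset_right _ _)).trans hf1, ?_⟩
  rw [integral_const_mul, inv_mul_cancel₀ hpos.ne']

/-- The du Bois-Reymond lemma. -/
theorem eq_const_of_hasWeakDerivOn_zero {l : ℝ} (hl : 0 < l) {w : ℝ → E}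
    (hw : ContinuousOn w (Icc 0 l)) (h : HasWeakDerivOn l w 0) : ∀ x ∈ Icc 0 l, w x = w 0 := by
  obtain ⟨ψ, hψ, hψc, hψs, hψ1⟩ := exists_testFunction_integral_eq_one hl
  have hwi : IntegrableOn w (Ioo 0 l) volume :=
    (hw.integrableOn_Icc).mono_set Ioo_subset_Icc_self
  -- The constant value of `w` must be its mean with respect to the weight `ψ` of integral one.
  set κ : E := ∫ x in Ioo 0 l, ψ x • w x with hκ
  have hsm : ∀ φ : ℝ → ℝ, Continuous φ → HasCompactSupport φ →
      IntegrableOn (fun x => φ x • w x) (Ioo 0 l) volume := fun φ hφ _ =>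
    (((hφ.continuousOn).smul hw).integrableOn_Icc).mono_set Ioo_subset_Icc_self
  have hae : ∀ᵐ x ∂volume, x ∈ Ioo 0 l → w x - κ = 0 := by
    refine isOpen_Ioo.ae_eq_zero_of_integral_contDiff_smul_eq_zero
      (f := fun x => w x - κ) ?_ fun φ hφ hφc hφs => ?_
    · exact (hwi.sub (integrableOn_const (by simp))).locallyIntegrableOn
    · have hφi : Integrable φ := hφ.continuous.integrable_of_hasCompactSupport hφc
      have hψi : Integrable ψ := hψ.continuous.integrable_of_hasCompactSupport hψc
      have hset : ∀ g : ℝ → E, ∫ x, φ x • g x = ∫ x in Ioo 0 l, φ x • g x := fun g => by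
        rw [setIntegral_eq_integral_of_forall_compl_eq_zero]
        intro x hx
        rw [image_eq_zero_of_notMem_tsupport fun hx' => hx (hφs hx'), zero_smul]
      set m := ∫ x, φ x with hm
      -- Subtracting `m ψ` makes the integral vanish, so this function is the derivative of a test
      -- function and is annihilated by `w`.
      have hη : ContDiff ℝ ∞ fun x => φ x - m * ψ x := hφ.sub (contDiff_const.mul hψ)
      have hsub : Function.support (fun x => φ x - m * ψ x) ⊆ tsupport φ ∪ tsupport ψ := by
        intro x hx
        by_contra hcon
        rw [mem_union, not_or] at hcon
        apply hx
        simp only [image_eq_zero_of_notMem_tsupport hcon.1,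
          image_eq_zero_of_notMem_tsupport hcon.2, mul_zero, sub_zero]
      have hcompact : IsCompact (tsupport φ ∪ tsupport ψ) := IsCompact.union hφc hψc
      obtain ⟨χ, hχ, hχc, hχs, hχd⟩ := exists_testFunction_primitive hη
        (HasCompactSupport.of_support_subset_isCompact hcompact hsub)
        ((closure_minimal hsub hcompact.isClosed).trans (union_subset hφs hψs))
        (by rw [integral_sub hφi (hψi.const_mul m), integral_const_mul, hψ1, mul_one, sub_self])
      have h1 := h χ hχ hχc hχs
      simp only [hχd, Pi.zero_apply, smul_zero, integral_zero, neg_zero, sub_smul, mul_smul]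
        at h1
      have hmi : Integrable (fun x => m • ψ x • w x) (volume.restrict (Ioo 0 l)) :=
        (hsm ψ hψ.continuous hψc).smul m
      rw [integral_sub (hsm φ hφ.continuous hφc) hmi, integral_smul, sub_eq_zero] at h1
      simp only [smul_sub]
      rw [integral_sub, integral_smul_const, hset, h1, sub_self]
      · rw [← integrableOn_iff_integrable_of_support_subset (s := Ioo 0 l)]
        · exact hsm φ hφ.continuous hφc
        · intro x hx
          by_contra hcon
          refine hx ?_
          simp only [image_eq_zero_of_notMem_tsupport fun hx' => hcon (hφs hx'), zero_smul]
      · exact hφi.smul_const κ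
  have heq : EqOn w (fun _ => κ) (Icc 0 l) := by
    refine Measure.eqOn_Icc_of_ae_eq volume hl.ne ?_ hw continuousOn_const
    rw [← restrict_Ioo_eq_restrict_Icc, Filter.EventuallyEq, ae_restrict_iff' measurableSet_Ioo]
    filter_upwards [hae] with x hx hmem
    exact sub_eq_zero.1 (hx hmem)
  intro x hx
  rw [heq hx, heq ⟨le_rfl, hl.le⟩]

/-- The continuous representative of a function with an integrable weak derivative is a
primitive of this derivative. -/
theorem HasWeakDerivOn.isPrimitive {l : ℝ} (hl : 0 < l) {u f g : ℝ → E}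
    (h : HasWeakDerivOn l u g) (hg : Integrable g (volume.restrict (Ioo 0 l)))
    (hf : ContinuousOn f (Icc 0 l)) (hu : u =ᵐ[volume.restrict (Ioo 0 l)] f) :
    IsPrimitive l f g := by
  have hg' : IntervalIntegrable g volume 0 l := (intervalIntegrable_iff_Ioo hl.le).2 hg
  set F : ℝ → E := fun x => ∫ s in (0 : ℝ)..x, g s with hF
  have hFp : IsPrimitive l F g := ⟨hg', fun x _ => by simp [hF]⟩
  have hFc := hFp.continuousOn hl.le
  have hFw := hFp.hasWeakDerivOn hl (EventuallyEq.refl _ _)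
  have hw : HasWeakDerivOn l (fun x => f x - F x) 0 := by
    intro φ hφ hφc hφs
    have hφ' : Continuous (deriv φ) := hφ.continuous_deriv (by exact_mod_cast le_top)
    have hi : ∀ v : ℝ → E, ContinuousOn v (Icc 0 l) →
        IntegrableOn (fun x => deriv φ x • v x) (Ioo 0 l) volume := fun v hv =>
      ((hφ'.continuousOn.smul hv).integrableOn_Icc).mono_set Ioo_subset_Icc_self
    have e1 : ∫ x in Ioo 0 l, deriv φ x • u x = ∫ x in Ioo 0 l, deriv φ x • f x := by
      refine integral_congr_ae ?_
      filter_upwards [hu] with x hx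
      rw [hx]
    simp only [smul_sub, Pi.zero_apply, smul_zero, integral_zero, neg_zero]
    rw [integral_sub (hi f hf) (hi F hFc), ← e1, h φ hφ hφc hφs, hFw φ hφ hφc hφs, sub_self]
  refine ⟨hg', fun x hx => ?_⟩
  have h1 := eq_const_of_hasWeakDerivOn_zero hl (hf.sub hFc) hw x hx
  have h2 : F 0 = 0 := by simp [hF]
  simp only [Pi.sub_apply] at h1
  rw [h2, sub_zero, sub_eq_iff_eq_add] at h1
  exact h1

end WeakDeriv

/-! ### Integration by parts for a Hermitian field. -/

section Energy

variable {E : Type*} [NormedAddCommGroup E] [InnerProductSpace ℂ E] [FiniteDimensional ℂ E]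

/-- The energy identity for a Hermitian Lipschitz continuous field `S`, up to the contribution of
the derivative of `S`. -/
theorem IsPrimitive.energy_estimate {l : ℝ} (hl : 0 < l) {f g : ℝ → E} (h : IsPrimitive l f g)
    {S : ℝ → E →L[ℂ] E} {L : ℝ≥0} (hS : LipschitzOnWith L S (Icc 0 l))
    (hsymm : ∀ x ∈ Icc 0 l, ∀ ξ η, inner ℂ (S x ξ) η = inner ℂ ξ (S x η)) :
    |(inner ℂ (f l) (S l (f l))).re - (inner ℂ (f 0) (S 0 (f 0))).re
      - 2 * ∫ x in Ioo 0 l, (inner ℂ (f x) (S x (g x))).re| ≤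
      L * ∫ x in Ioo 0 l, ‖f x‖ ^ 2 := by
  have : CompleteSpace E := FiniteDimensional.complete ℂ E
  have : FiniteDimensional ℝ E := FiniteDimensional.complexToReal E
  have hIcc : uIcc 0 l = Icc 0 l := uIcc_of_le hl.le
  set F : ℝ → E := fun x => f 0 + ∫ s in (0 : ℝ)..x, g s with hF
  have hfF : ∀ x ∈ Icc 0 l, f x = F x := h.2
  have hFac : AbsolutelyContinuousOnInterval F 0 l := by
    have hc : AbsolutelyContinuousOnInterval (fun _ : ℝ => f 0) 0 l :=
      ((LipschitzWith.const (f 0)).lipschitzOnWith).absolutelyContinuousOnInterval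
    exact hc.add (absolutelyContinuousOnInterval_integral h.1)
  have hSac : AbsolutelyContinuousOnInterval S 0 l :=
    (hIcc ▸ hS : LipschitzOnWith L S (uIcc 0 l)).absolutelyContinuousOnInterval
  let b1 : (E →L[ℂ] E) →L[ℝ] E →L[ℝ] E := ContinuousLinearMap.restrictScalarsL ℂ E E ℝ ℝ
  let b2 : E →L[ℝ] E →L[ℝ] ℝ := 
    letI : InnerProductSpace ℝ E := InnerProductSpace.complexToReal
    (isBoundedBilinearMap_inner (𝕜 := ℝ) (E := E)).toContinuousLinearMap
  have hb1 : ∀ T ξ, b1 T ξ = T ξ := fun _ _ => rfl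
  have hb2 : ∀ ξ η, b2 ξ η = (inner ℂ ξ η).re := fun _ _ => rfl
  have hyac := hSac.bilinear b1 hFac
  have hhac := hFac.bilinear b2 hyac
  -- The energy density is absolutely continuous as a bilinear expression, so its end values differ
  -- by the integral of its derivative. The two terms containing `g` agree by symmetry of `S`.
  set H : ℝ → ℝ := fun x => b2 (F x) (b1 (S x) (F x)) with hH
  have hderiv : ∀ᵐ x ∂volume.restrict (Ioo 0 l),
      |deriv H x - 2 * (inner ℂ (f x) (S x (g x))).re| ≤ L * ‖f x‖ ^ 2 := by
    rw [ae_restrict_iff' measurableSet_Ioo]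
    -- Rademacher's theorem gives almost everywhere a derivative of `S`, of norm at most `L`; it
    -- needs a finite-dimensional target.
    have : FiniteDimensional ℝ (E →L[ℂ] E) := FiniteDimensional.complexToReal _
    filter_upwards [h.1.ae_hasDerivAt_integral, hS.ae_differentiableWithinAt_of_mem]
      with x h1 h2 hx
    have hxI : x ∈ Icc 0 l := Ioo_subset_Icc_self hx
    have hnhds : Icc 0 l ∈ 𝓝 x := Icc_mem_nhds hx.1 hx.2
    have hSd : HasDerivAt S (deriv S x) x :=
      ((h2 hxI).differentiableAt hnhds).hasDerivAt
    have hSn : ‖deriv S x‖ ≤ L := norm_deriv_le_of_lipschitzOn hnhds hS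
    have hFd : HasDerivAt F (g x) x :=
      ((h1 (hIcc ▸ hxI) 0 left_mem_uIcc)).const_add (f 0)
    have hyd : HasDerivAt (fun x => b1 (S x) (F x)) (b1 (S x) (g x) + b1 (deriv S x) (F x)) x := by
      rw [← hasDerivWithinAt_univ] at hSd hFd ⊢
      exact b1.hasDerivWithinAt_of_bilinear hSd hFd
    have hHd : HasDerivAt H (b2 (F x) (b1 (S x) (g x) + b1 (deriv S x) (F x)) +
        b2 (g x) (b1 (S x) (F x))) x := by
      rw [← hasDerivWithinAt_univ] at hyd hFd ⊢
      exact b2.hasDerivWithinAt_of_bilinear hFd hyd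
    rw [hHd.deriv, hfF x hxI, map_add]
    simp only [hb1, hb2]
    have e : (inner ℂ (g x) (S x (F x))).re = (inner ℂ (F x) (S x (g x))).re := by
      rw [← hsymm x hxI, ← inner_conj_symm, Complex.conj_re]
    have e2 : (inner ℂ (F x) (S x (g x))).re + (inner ℂ (F x) (deriv S x (F x))).re +
        (inner ℂ (g x) (S x (F x))).re - 2 * (inner ℂ (F x) (S x (g x))).re =
        (inner ℂ (F x) (deriv S x (F x))).re := by rw [e]; ring
    rw [e2]
    calc _ ≤ ‖inner ℂ (F x) (deriv S x (F x))‖ := Complex.abs_re_le_norm _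
      _ ≤ ‖F x‖ * ‖deriv S x (F x)‖ := norm_inner_le_norm _ _
      _ ≤ ‖F x‖ * (L * ‖F x‖) := by
        gcongr
        exact ((deriv S x).le_opNorm _).trans (by gcongr)
      _ = L * ‖F x‖ ^ 2 := by ring
  have hfc : ContinuousOn f (Icc 0 l) := h.continuousOn hl.le
  have hSc : ContinuousOn S (Icc 0 l) := hS.continuousOn
  have hyc : ContinuousOn (fun x => S x (f x)) (Icc 0 l) := hSc.clm_apply hfc
  have hi1 : IntervalIntegrable (deriv H) volume 0 l := hhac.intervalIntegrable_deriv
  have hi2 : IntervalIntegrable (fun x => (inner ℂ (f x) (S x (g x))).re) volume 0 l := by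
    rw [intervalIntegrable_iff_Ioo hl.le]
    have hgi := (intervalIntegrable_iff_Ioo hl.le).1 h.1
    obtain ⟨C, hC⟩ := isCompact_Icc.exists_bound_of_continuousOn hyc
    have hae : (fun x => (inner ℂ (S x (f x)) (g x)).re) =ᵐ[volume.restrict (Ioo 0 l)]
        fun x => (inner ℂ (f x) (S x (g x))).re := by
      filter_upwards [ae_restrict_mem measurableSet_Ioo] with x hx
      rw [hsymm x (Ioo_subset_Icc_self hx)]
    refine Integrable.congr ?_ hae
    refine (hgi.norm.const_mul C).mono' ?_ ?_
    · have hm : AEStronglyMeasurable (fun x => S x (f x)) (volume.restrict (Ioo 0 l)) :=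
        (hyc.mono Ioo_subset_Icc_self).aestronglyMeasurable measurableSet_Ioo
      exact Complex.continuous_re.comp_aestronglyMeasurable (hm.inner hgi.aestronglyMeasurable)
    · filter_upwards [ae_restrict_mem measurableSet_Ioo] with x hx
      refine (Complex.abs_re_le_norm _).trans ((norm_inner_le_norm _ _).trans ?_)
      gcongr
      exact hC x (Ioo_subset_Icc_self hx)
  have hi3 : IntegrableOn (fun x => ‖f x‖ ^ 2) (Ioo 0 l) volume :=
    ((hfc.norm.pow 2).integrableOn_Icc).mono_set Ioo_subset_Icc_self
  have hftc := hhac.integral_deriv_eq_sub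
  have hends : ∀ x ∈ Icc 0 l, H x = (inner ℂ (f x) (S x (f x))).re := fun x hx => by
    rw [hfF x hx]
    simp only [hH, hb1, hb2]
  rw [← hends l ⟨hl.le, le_rfl⟩, ← hends 0 ⟨le_rfl, hl.le⟩, ← hftc, ← integral_Ioo_eq_interval hl.le,
    ← integral_const_mul, ← integral_sub ((intervalIntegrable_iff_Ioo hl.le).1 hi1)
      (((intervalIntegrable_iff_Ioo hl.le).1 hi2).const_mul 2), ← integral_const_mul]
  exact norm_integral_le_of_norm_le
    (f := fun x => deriv H x - 2 * (inner ℂ (f x) (S x (g x))).re) (hi3.const_mul (L : ℝ)) hderiv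

end Energy

/-! ### Linear differential equations with bounded measurable coefficients -/

section Volterra

variable {E : Type*} [NormedAddCommGroup E] [NormedSpace ℂ E]

/-- `a` is measurable and bounded by `C` on `(0, l)`. -/
structure IsBoundedCoeff (l : ℝ) (a : ℝ → E →L[ℂ] E) (C : ℝ) : Prop where
  nonneg : 0 ≤ C
  meas : AEStronglyMeasurable a (volume.restrict (Ioo 0 l))
  bound : ∀ᵐ x ∂volume.restrict (Ioo 0 l), ‖a x‖ ≤ C

namespace IsBoundedCoeff

variable {l C : ℝ} {a : ℝ → E →L[ℂ] E}

theorem aestronglyMeasurable_apply (ha : IsBoundedCoeff l a C) {u : ℝ → E}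
    (hu : AEStronglyMeasurable u (volume.restrict (Ioo 0 l))) :
    AEStronglyMeasurable (fun x => a x (u x)) (volume.restrict (Ioo 0 l)) :=
  (ContinuousLinearMap.id ℂ (E →L[ℂ] E)).aestronglyMeasurable_comp₂ ha.meas hu

theorem integrable_apply (ha : IsBoundedCoeff l a C) {u : ℝ → E}
    (hu : Integrable u (volume.restrict (Ioo 0 l))) :
    Integrable (fun x => a x (u x)) (volume.restrict (Ioo 0 l)) := by
  refine (hu.norm.const_mul C).mono' (ha.aestronglyMeasurable_apply hu.aestronglyMeasurable) ?_
  filter_upwards [ha.bound] with x hx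
  exact ((a x).le_opNorm _).trans (by gcongr)

theorem memLp_apply (ha : IsBoundedCoeff l a C) {u : ℝ → E}
    (hu : MemLp u 2 (volume.restrict (Ioo 0 l))) :
    MemLp (fun x => a x (u x)) 2 (volume.restrict (Ioo 0 l)) := by
  refine hu.of_le_mul (c := C) (ha.aestronglyMeasurable_apply hu.aestronglyMeasurable) ?_
  filter_upwards [ha.bound] with x hx
  exact ((a x).le_opNorm _).trans (by gcongr)

end IsBoundedCoeff

variable [CompleteSpace E] {l C : ℝ} {a : ℝ → E →L[ℂ] E}

omit [NormedSpace ℂ E] [CompleteSpace E] in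
theorem continuousOn_integrable {l : ℝ} {u : ℝ → E} (hu : ContinuousOn u (Icc 0 l)) :
    Integrable u (volume.restrict (Ioo 0 l)) :=
  (hu.integrableOn_Icc).mono_set Ioo_subset_Icc_self

omit [CompleteSpace E] in
/-- The Volterra operator with kernel `a`. -/
theorem exists_volterra_operator (hl : 0 < l) (ha : IsBoundedCoeff l a C) :
    ∃ T : C(Icc 0 l, E) →L[ℂ] C(Icc 0 l, E), ∀ u (x : Icc 0 l),
      T u x = ∫ s in (0 : ℝ)..x, a s (IccExtend hl.le u s) := by
  have hint : ∀ u : C(Icc 0 l, E),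
      IntervalIntegrable (fun s => a s (IccExtend hl.le u s)) volume 0 l := fun u => by
    rw [intervalIntegrable_iff_Ioo hl.le]
    exact ha.integrable_apply (continuousOn_integrable
      (u.continuous.Icc_extend' (h := hl.le)).continuousOn)
  have hint' : ∀ (u : C(Icc 0 l, E)) (x : Icc 0 l),
      IntervalIntegrable (fun s => a s (IccExtend hl.le u s)) volume 0 x := fun u x =>
    (hint u).mono_set (by
      rw [uIcc_of_le hl.le, uIcc_of_le x.2.1]
      exact Icc_subset_Icc_right x.2.2)
  let f : C(Icc 0 l, E) → C(Icc 0 l, E) := fun u =>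
    ⟨fun x => ∫ s in (0 : ℝ)..x, a s (IccExtend hl.le u s), by
      have := (absolutelyContinuousOnInterval_integral (hint u)).continuousOn
      rw [uIcc_of_le hl.le] at this
      exact this.domRestrict⟩
  have hf : ∀ u x, f u x = ∫ s in (0 : ℝ)..x, a s (IccExtend hl.le u s) := fun _ _ => rfl
  refine ⟨LinearMap.mkContinuous ⟨⟨f, fun u v => ?_⟩, fun c u => ?_⟩ (C * l) fun u => ?_, hf⟩
  · ext x
    rw [ContinuousMap.add_apply, hf, hf, hf,
      ← intervalIntegral.integral_add (hint' u x) (hint' v x)]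
    refine intervalIntegral.integral_congr fun s _ => ?_
    simp [IccExtend]
  · ext x
    rw [ContinuousMap.smul_apply, hf]
    simp only [RingHom.id_apply, hf]
    rw [← intervalIntegral.integral_smul]
    refine intervalIntegral.integral_congr fun s _ => ?_
    simp [IccExtend]
  · refine (ContinuousMap.norm_le _ (by have := ha.nonneg; positivity)).2 fun x => ?_
    change ‖∫ s in (0 : ℝ)..x, a s (IccExtend hl.le u s)‖ ≤ _
    have hb : ∀ᵐ s, s ∈ uIoc 0 (x : ℝ) → ‖a s (IccExtend hl.le u s)‖ ≤ C * ‖u‖ := by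
      have h1 := (ae_restrict_iff' measurableSet_Ioo).1 ha.bound
      -- The coefficient is bounded only on the open interval, so the right endpoint is discarded as
      -- a null set.
      have h2 : ∀ᵐ s : ℝ, s ≠ l := by simp [ae_iff, measure_singleton]
      filter_upwards [h1, h2] with s hs hsl hsx
      rw [uIoc_of_le x.2.1] at hsx
      refine ((a s).le_opNorm _).trans ?_
      have := hs ⟨hsx.1, lt_of_le_of_ne (hsx.2.trans x.2.2) hsl⟩
      have := ha.nonneg
      gcongr
      exact u.norm_coe_le_norm _
    refine (intervalIntegral.norm_integral_le_of_norm_le_const_ae hb).trans ?_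
    rw [sub_zero, abs_of_nonneg x.2.1]
    have h0 := mul_nonneg ha.nonneg (norm_nonneg u)
    nlinarith [mul_le_mul_of_nonneg_left x.2.2 h0]

omit [CompleteSpace E] in
-- Keeping the dependence on `x` lets each integration raise the power of `x` and produce the
-- factorial.
theorem volterra_pow_bound (hl : 0 < l) (ha : IsBoundedCoeff l a C)
    {T : C(Icc 0 l, E) →L[ℂ] C(Icc 0 l, E)}
    (hT : ∀ u (x : Icc 0 l), T u x = ∫ s in (0 : ℝ)..x, a s (IccExtend hl.le u s)) (n : ℕ)
    (u : C(Icc 0 l, E)) (x : Icc 0 l) :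
    ‖(T ^ n) u x‖ ≤ C ^ n * (x : ℝ) ^ n / n.factorial * ‖u‖ := by
  induction n generalizing x with
  | zero => simpa using u.norm_coe_le_norm x
  | succ n ih =>
    rw [pow_succ', mul_apply_eq_comp, hT]
    have hb : ∀ᵐ s, s ∈ uIoc 0 (x : ℝ) → ‖a s (IccExtend hl.le ((T ^ n) u) s)‖ ≤
        C * (C ^ n * s ^ n / n.factorial * ‖u‖) := by
      have h1 := (ae_restrict_iff' measurableSet_Ioo).1 ha.bound
      have h2 : ∀ᵐ s : ℝ, s ≠ l := by simp [ae_iff, measure_singleton]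
      filter_upwards [h1, h2] with s hs hsl hsx
      rw [uIoc_of_le x.2.1] at hsx
      have hsI : s ∈ Icc 0 l := ⟨hsx.1.le, hsx.2.trans x.2.2⟩
      refine ((a s).le_opNorm _).trans ?_
      have h3 := hs ⟨hsx.1, lt_of_le_of_ne (hsx.2.trans x.2.2) hsl⟩
      rw [IccExtend_of_mem hl.le _ hsI]
      have h4 := ha.nonneg
      gcongr
      exact ih ⟨s, hsI⟩
    rw [uIoc_of_le x.2.1] at hb
    refine (intervalIntegral.norm_integral_le_of_norm_le x.2.1 hb ?_).trans (le_of_eq ?_)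
    · exact Continuous.intervalIntegrable (by fun_prop) _ _
    · have e : ∀ s : ℝ, C * (C ^ n * s ^ n / n.factorial * ‖u‖) =
          (C ^ (n + 1) / n.factorial * ‖u‖) * s ^ n := fun s => by ring
      simp only [e]
      rw [intervalIntegral.integral_const_mul, integral_pow, Nat.factorial_succ]
      push_cast
      have : (n.factorial : ℝ) ≠ 0 := by positivity
      have : (n + 1 : ℝ) ≠ 0 := by positivity
      field_simp
      ring

/-- Volterra equations are uniquely solvable, and the solution depends linearly on the data. -/
theorem exists_volterra_solution (hl : 0 < l) (ha : IsBoundedCoeff l a C) :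
    ∃ Φ : C(Icc 0 l, E) →ₗ[ℂ] C(Icc 0 l, E), ∀ F (x : Icc 0 l),
      Φ F x = F x + ∫ s in (0 : ℝ)..x, a s (IccExtend hl.le (Φ F) s) := by
  obtain ⟨T, hT⟩ := exists_volterra_operator hl ha
  obtain ⟨n, hn⟩ := ((FloorSemiring.tendsto_pow_div_factorial_atTop (C * l)).eventually
    (gt_mem_nhds zero_lt_one)).exists
  have hC := ha.nonneg
  have hTn : ‖T ^ n‖ < 1 := by
    refine lt_of_le_of_lt (ContinuousLinearMap.opNorm_le_bound _ (by positivity) fun u => ?_) hn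
    refine (ContinuousMap.norm_le _ (by positivity)).2 fun x => ?_
    refine (volterra_pow_bound hl ha hT n u x).trans ?_
    rw [mul_pow]
    have := x.2.1
    gcongr
    exact x.2.2
  -- Some power of `T` has norm less than one, and `1 - T` is a commuting factor of the invertible
  -- operator `1 - T ^ n`.
  have hunit : IsUnit (1 - T) := by
    have h1 : IsUnit (1 - T ^ n) :=
      isUnit_one_sub_of_norm_lt_one (R := C(Icc 0 l, E) →L[ℂ] C(Icc 0 l, E)) hTn
    rw [← mul_neg_geom_sum T n] at h1
    have hc : Commute (1 - T) (∑ i ∈ Finset.range n, T ^ i) :=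
      Commute.sum_right _ _ _ fun i _ => ((Commute.one_left _).sub_left
        ((Commute.refl T).pow_right i))
    exact (hc.isUnit_mul_iff.1 h1).1
  obtain ⟨v, hv⟩ := hunit
  refine ⟨((v⁻¹ : (C(Icc 0 l, E) →L[ℂ] C(Icc 0 l, E))ˣ) :
    C(Icc 0 l, E) →L[ℂ] C(Icc 0 l, E)).toLinearMap, fun F x => ?_⟩
  rw [← hT]
  have h2 : ((1 - T) * (v⁻¹ : (C(Icc 0 l, E) →L[ℂ] C(Icc 0 l, E))ˣ)) F = F := by
    rw [← hv, Units.mul_inv]; rfl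
  have h3 := congrArg (fun G : C(Icc 0 l, E) => G x) h2
  simp only [mul_apply_eq_comp, _root_.sub_apply, one_apply_eq_self,
    ContinuousMap.sub_apply] at h3
  rw [← h3]
  simp

/-- Solutions of `f' = a f` with arbitrary initial values. -/
theorem exists_linear_flow (hl : 0 < l) (ha : IsBoundedCoeff l a C) :
    ∃ Φ : E →ₗ[ℂ] (ℝ → E), (∀ c, Continuous (Φ c)) ∧ (∀ c, Φ c 0 = c) ∧
      ∀ c, IsPrimitive l (Φ c) fun s => a s (Φ c s) := by
  obtain ⟨Φ, hΦ⟩ := exists_volterra_solution hl ha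
  let Ψ : E →ₗ[ℂ] (ℝ → E) :=
    { toFun := fun c => IccExtend hl.le (Φ (ContinuousMap.const _ c))
      map_add' := fun c d => by
        have : ContinuousMap.const (Icc 0 l) (c + d) =
          ContinuousMap.const _ c + ContinuousMap.const _ d := rfl
        rw [this, map_add]; rfl
      map_smul' := fun r c => by
        have : ContinuousMap.const (Icc 0 l) (r • c) = r • ContinuousMap.const _ c := rfl
        rw [this, map_smul]; rfl }
  have hc : ∀ c, Continuous (Ψ c) := fun c =>
    (Φ (ContinuousMap.const _ c)).continuous.Icc_extend' (h := hl.le)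
  have h0 : (0 : ℝ) ∈ Icc 0 l := ⟨le_rfl, hl.le⟩
  have hval : ∀ c, ∀ x ∈ Icc 0 l, Ψ c x = c + ∫ s in (0 : ℝ)..x, a s (Ψ c s) := fun c x hx => by
    have h1 := hΦ (ContinuousMap.const _ c) ⟨x, hx⟩
    change IccExtend hl.le _ x = _
    rw [IccExtend_of_mem hl.le _ hx]
    exact h1
  have hz : ∀ c, Ψ c 0 = c := fun c => by
    rw [hval c 0 h0, intervalIntegral.integral_same, add_zero]
  refine ⟨Ψ, hc, hz, fun c => ⟨?_, fun x hx => by rw [hz]; exact hval c x hx⟩⟩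
  rw [intervalIntegrable_iff_Ioo hl.le]
  exact ha.integrable_apply (continuousOn_integrable (hc c).continuousOn)

/-- A solution of `f' = a f + b` with initial value zero. -/
theorem exists_inhomogeneous_solution (hl : 0 < l) (ha : IsBoundedCoeff l a C) {b : ℝ → E}
    (hb : Integrable b (volume.restrict (Ioo 0 l))) :
    ∃ f : ℝ → E, Continuous f ∧ f 0 = 0 ∧ IsPrimitive l f fun s => a s (f s) + b s := by
  obtain ⟨Φ, hΦ⟩ := exists_volterra_solution hl ha
  have hb' := (intervalIntegrable_iff_Ioo hl.le).2 hb
  let F : C(Icc 0 l, E) := ⟨fun x => ∫ s in (0 : ℝ)..x, b s, by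
      have := (absolutelyContinuousOnInterval_integral hb').continuousOn
      rw [uIcc_of_le hl.le] at this
      exact this.domRestrict⟩
  set f : ℝ → E := IccExtend hl.le (Φ F) with hf
  have hfc : Continuous f := (Φ F).continuous.Icc_extend' (h := hl.le)
  have hi : IntervalIntegrable (fun s => a s (f s)) volume 0 l := by
    rw [intervalIntegrable_iff_Ioo hl.le]
    exact ha.integrable_apply (continuousOn_integrable hfc.continuousOn)
  have hval : ∀ x ∈ Icc 0 l, f x = ∫ s in (0 : ℝ)..x, (a s (f s) + b s) := fun x hx => by
    have hsub : uIcc 0 x ⊆ uIcc 0 l := by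
      rw [uIcc_of_le hl.le, uIcc_of_le hx.1]
      exact Icc_subset_Icc_right hx.2
    rw [intervalIntegral.integral_add (hi.mono_set hsub) (hb'.mono_set hsub)]
    have h1 := hΦ F ⟨x, hx⟩
    rw [hf, IccExtend_of_mem hl.le _ hx, h1, add_comm]
    rfl
  have h0 : f 0 = 0 := by
    rw [hval 0 ⟨le_rfl, hl.le⟩, intervalIntegral.integral_same]
  exact ⟨f, hfc, h0, hi.add hb', fun x hx => by rw [h0, zero_add]; exact hval x hx⟩

end Volterra

/-! ### The coefficients as operator-valued functions -/

section MatrixFields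

variable {n : ℕ}

/-- A matrix acting on the Euclidean space. -/
noncomputable abbrev matOp (A : Matrix (Fin n) (Fin n) ℂ) :
    EuclideanSpace ℂ (Fin n) →L[ℂ] EuclideanSpace ℂ (Fin n) := Matrix.toEuclideanCLM (𝕜 := ℂ) A

/-- With constant operators and scalar coefficients, entrywise regularity passes to operator-valued
fields. -/
theorem matOp_eq_sum (A : Matrix (Fin n) (Fin n) ℂ) :
    matOp A = ∑ p : Fin n × Fin n, A p.1 p.2 • matOp (Matrix.single p.1 p.2 1) := by
  rw [Fintype.sum_prod_type]
  conv_lhs => rw [Matrix.matrix_eq_sum_single A]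
  simp only [matOp, map_sum]
  refine Finset.sum_congr rfl fun i _ => Finset.sum_congr rfl fun j _ => ?_
  rw [← map_smul, Matrix.smul_single, smul_eq_mul, mul_one]

theorem exists_lipschitzOnWith_sum_smul {ι X : Type*} [Fintype ι] [NormedAddCommGroup X]
    [NormedSpace ℂ X] {a : ι → ℝ → ℂ} (T : ι → X) {s : Set ℝ} {L : ℝ≥0}
    (h : ∀ i, LipschitzOnWith L (a i) s) :
    ∃ L' : ℝ≥0, LipschitzOnWith L' (fun x => ∑ i, a i x • T i) s := by
  refine ⟨∑ i, L * ‖T i‖₊, LipschitzOnWith.of_dist_le_mul fun x hx y hy => ?_⟩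
  rw [dist_eq_norm, ← Finset.sum_sub_distrib]
  push_cast
  rw [Finset.sum_mul]
  refine (norm_sum_le _ _).trans (Finset.sum_le_sum fun i _ => ?_)
  rw [← sub_smul, norm_smul, mul_right_comm]
  gcongr
  rw [← dist_eq_norm]
  exact (h i).dist_le_mul x hx y hy

theorem memLp_sum_smul {ι X : Type*} [Fintype ι] [NormedAddCommGroup X]
    [NormedSpace ℂ X] {a : ι → ℝ → ℂ} (T : ι → X) {μ : Measure ℝ} {p : ℝ≥0∞}
    (h : ∀ i, MemLp (a i) p μ) : MemLp (fun x => ∑ i, a i x • T i) p μ :=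
  memLp_finsetSum _ fun i _ => ((ContinuousLinearMap.id ℂ ℂ).smulRight (T i)).comp_memLp' (h i)

theorem exists_lipschitzOnWith_matOp {A : ℝ → Matrix (Fin n) (Fin n) ℂ} {s : Set ℝ} {L : ℝ≥0}
    (h : ∀ i j, LipschitzOnWith L (fun x => A x i j) s) :
    ∃ L' : ℝ≥0, LipschitzOnWith L' (fun x => matOp (A x)) s := by
  rw [funext fun x => matOp_eq_sum (A x)]
  exact exists_lipschitzOnWith_sum_smul (ι := Fin n × Fin n) (a := fun p x => A x p.1 p.2)
    (fun p => matOp (Matrix.single p.1 p.2 1)) fun p => h p.1 p.2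

theorem memLp_top_matOp {A : ℝ → Matrix (Fin n) (Fin n) ℂ} {μ : Measure ℝ}
    (h : ∀ i j, MemLp (fun x => A x i j) ∞ μ) : MemLp (fun x => matOp (A x)) ∞ μ := by
  rw [funext fun x => matOp_eq_sum (A x)]
  exact memLp_sum_smul (ι := Fin n × Fin n) (a := fun p x => A x p.1 p.2)
    (fun p => matOp (Matrix.single p.1 p.2 1)) fun p => h p.1 p.2

theorem exists_isBoundedCoeff_of_memLp_top {E : Type*} [NormedAddCommGroup E] [NormedSpace ℂ E]
    {l : ℝ} {a : ℝ → E →L[ℂ] E} (h : MemLp a ∞ (volume.restrict (Ioo 0 l))) :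
    ∃ C, IsBoundedCoeff l a C := by
  have h1 := h.2
  rw [eLpNorm_exponent_top, eLpNormEssSup_lt_top_iff_isBoundedUnder] at h1
  obtain ⟨C, hC⟩ := h1
  refine ⟨C, C.2, h.1, ?_⟩
  rw [eventually_map] at hC
  filter_upwards [hC] with x hx
  exact_mod_cast hx

theorem exists_isBoundedCoeff_of_continuousOn {E : Type*} [NormedAddCommGroup E]
    [NormedSpace ℂ E] {l : ℝ} {a : ℝ → E →L[ℂ] E} (h : ContinuousOn a (Icc 0 l)) :
    ∃ C, IsBoundedCoeff l a C := by
  obtain ⟨C, hC⟩ := isCompact_Icc.exists_bound_of_continuousOn h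
  refine ⟨max C 0, le_max_right _ _, (h.mono Ioo_subset_Icc_self).aestronglyMeasurable
    measurableSet_Ioo, ?_⟩
  filter_upwards [ae_restrict_mem measurableSet_Ioo] with x hx
  exact (hC x (Ioo_subset_Icc_self hx)).trans (le_max_left _ _)

theorem IsBoundedCoeff.mul {E : Type*} [NormedAddCommGroup E] [NormedSpace ℂ E]
    {l C D : ℝ} {a b : ℝ → E →L[ℂ] E} (ha : IsBoundedCoeff l a C) (hb : IsBoundedCoeff l b D) :
    IsBoundedCoeff l (fun x => a x * b x) (C * D) := by
  refine ⟨mul_nonneg ha.nonneg hb.nonneg, ha.meas.mul hb.meas, ?_⟩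
  filter_upwards [ha.bound, hb.bound] with x h1 h2
  exact (norm_mul_le _ _).trans (mul_le_mul h1 h2 (norm_nonneg _) ha.nonneg)

theorem IsBoundedCoeff.const_sub {E : Type*} [NormedAddCommGroup E] [NormedSpace ℂ E]
    {l C : ℝ} {a : ℝ → E →L[ℂ] E} (ha : IsBoundedCoeff l a C) (T : E →L[ℂ] E) :
    IsBoundedCoeff l (fun x => T - a x) (‖T‖ + C) := by
  refine ⟨add_nonneg (norm_nonneg _) ha.nonneg, aestronglyMeasurable_const.sub ha.meas, ?_⟩
  filter_upwards [ha.bound] with x h1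
  exact (norm_sub_le _ _).trans (by gcongr)

theorem LipschitzOnWith.exists_mul {R : Type*} [SeminormedRing R] {a b : ℝ → R} {s : Set ℝ}
    (hs : IsCompact s) {L L' : ℝ≥0} (ha : LipschitzOnWith L a s) (hb : LipschitzOnWith L' b s) :
    ∃ L'' : ℝ≥0, LipschitzOnWith L'' (fun x => a x * b x) s := by
  obtain ⟨C, hC⟩ := hs.exists_bound_of_continuousOn ha.continuousOn
  obtain ⟨D, hD⟩ := hs.exists_bound_of_continuousOn hb.continuousOn
  refine ⟨C.toNNReal * L' + L * D.toNNReal, LipschitzOnWith.of_dist_le_mul fun x hx y hy => ?_⟩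
  have h1 := ha.dist_le_mul x hx y hy
  have h2 := hb.dist_le_mul x hx y hy
  rw [dist_eq_norm] at h1 h2 ⊢
  have e : a x * b x - a y * b y = a x * (b x - b y) + (a x - a y) * b y := by noncomm_ring
  rw [e]
  push_cast
  rw [add_mul, mul_assoc, mul_right_comm]
  refine (norm_add_le _ _).trans (add_le_add ?_ ?_)
  · refine (norm_mul_le _ _).trans ?_
    gcongr
    exact (hC x hx).trans (Real.le_coe_toNNReal C)
  · refine (norm_mul_le _ _).trans ?_
    gcongr
    exact (hD y hy).trans (Real.le_coe_toNNReal D)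

theorem inner_matOp_of_isHermitian {A : Matrix (Fin n) (Fin n) ℂ} (h : A.IsHermitian)
    (ξ η : EuclideanSpace ℂ (Fin n)) : inner ℂ (matOp A ξ) η = inner ℂ ξ (matOp A η) :=
  (Matrix.isSymmetric_toEuclideanLin_iff.2 h) ξ η

end MatrixFields

namespace EdgeCoefficients

variable {V E : Type*} {G : Network V E} (K : EdgeCoefficients G) (e : E)

/-- `Q_e` as an operator-valued function. -/
noncomputable def opQ (x : ℝ) : G.EdgeVec e →L[ℂ] G.EdgeVec e := matOp (K.Q e x)

/-- `M_e` as an operator-valued function. -/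
noncomputable def opM (x : ℝ) : G.EdgeVec e →L[ℂ] G.EdgeVec e := matOp (K.M e x)

/-- `N_e` as an operator-valued function. -/
noncomputable def opN (x : ℝ) : G.EdgeVec e →L[ℂ] G.EdgeVec e := matOp (K.N e x)

/-- `Q_e M_e` as an operator-valued function. -/
noncomputable def opS (x : ℝ) : G.EdgeVec e →L[ℂ] G.EdgeVec e := K.opQ e x * K.opM e x

/-- The pointwise inverse of `M_e` as an operator-valued function. -/
noncomputable def opMinv (x : ℝ) : G.EdgeVec e →L[ℂ] G.EdgeVec e := Ring.inverse (K.opM e x)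

theorem opS_eq (x : ℝ) : K.opS e x = matOp (K.Q e x * K.M e x) :=
  (map_mul _ _ _).symm

theorem exists_lipschitz_opQ : ∃ L : ℝ≥0, LipschitzOnWith L (K.opQ e) (Icc 0 (G.len e)) :=
  (K.Q_lipschitz e).elim fun _ h => exists_lipschitzOnWith_matOp h

theorem exists_lipschitz_opM : ∃ L : ℝ≥0, LipschitzOnWith L (K.opM e) (Icc 0 (G.len e)) :=
  (K.M_lipschitz e).elim fun _ h => exists_lipschitzOnWith_matOp h

theorem exists_lipschitz_opS : ∃ L : ℝ≥0, LipschitzOnWith L (K.opS e) (Icc 0 (G.len e)) := by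
  obtain ⟨L, hL⟩ := K.exists_lipschitz_opQ e
  obtain ⟨L', hL'⟩ := K.exists_lipschitz_opM e
  exact hL.exists_mul isCompact_Icc hL'

theorem isUnit_opM {x : ℝ} (hx : x ∈ Icc 0 (G.len e)) : IsUnit (K.opM e x) :=
  (K.M_invertible e x hx).map (Matrix.toEuclideanCLM (𝕜 := ℂ))

theorem opM_mul_opMinv {x : ℝ} (hx : x ∈ Icc 0 (G.len e)) : K.opM e x * K.opMinv e x = 1 :=
  Ring.mul_inverse_cancel _ (K.isUnit_opM e hx)

theorem continuousOn_opMinv : ContinuousOn (K.opMinv e) (Icc 0 (G.len e)) := by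
  obtain ⟨L, hL⟩ := K.exists_lipschitz_opM e
  intro x hx
  obtain ⟨v, hv⟩ := K.isUnit_opM e hx
  have h1 := NormedRing.inverse_continuousAt v
  rw [hv] at h1
  exact h1.comp_continuousWithinAt (hL.continuousOn x hx)

theorem exists_bound_opQ : ∃ C, IsBoundedCoeff (G.len e) (K.opQ e) C :=
  (K.exists_lipschitz_opQ e).elim fun _ h => exists_isBoundedCoeff_of_continuousOn h.continuousOn

theorem exists_bound_opMinv : ∃ C, IsBoundedCoeff (G.len e) (K.opMinv e) C :=
  exists_isBoundedCoeff_of_continuousOn (K.continuousOn_opMinv e)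

theorem exists_bound_opN : ∃ C, IsBoundedCoeff (G.len e) (K.opN e) C :=
  exists_isBoundedCoeff_of_memLp_top (memLp_top_matOp (K.N_bounded e))

theorem inner_opQ {x : ℝ} (hx : x ∈ Icc 0 (G.len e)) (ξ η : G.EdgeVec e) :
    inner ℂ (K.opQ e x ξ) η = inner ℂ ξ (K.opQ e x η) :=
  inner_matOp_of_isHermitian (K.Q_hermitian e x hx) ξ η

theorem inner_opS {x : ℝ} (hx : x ∈ Icc 0 (G.len e)) (ξ η : G.EdgeVec e) :
    inner ℂ (K.opS e x ξ) η = inner ℂ ξ (K.opS e x η) := by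
  rw [opS_eq]
  exact inner_matOp_of_isHermitian (K.QM_hermitian e x hx) ξ η

/-- The multiplication operator by `Q_e` on `L²`. -/
noncomputable def mulQ (u : G.EdgeL2 e) : G.EdgeL2 e :=
  ((K.exists_bound_opQ e).choose_spec.memLp_apply (Lp.memLp u)).toLp fun x => K.opQ e x (u x)

theorem coeFn_mulQ (u : G.EdgeL2 e) :
    K.mulQ e u =ᵐ[volume.restrict (Ioo 0 (G.len e))] fun x => K.opQ e x (u x) :=
  MemLp.coeFn_toLp _

theorem inner_mulQ (u w : G.EdgeL2 e) :
    inner ℂ u (K.mulQ e w) = ∫ x in Ioo 0 (G.len e), inner ℂ (u x) (K.opQ e x (w x)) := by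
  rw [L2.inner_def]
  refine integral_congr_ae ?_
  filter_upwards [K.coeFn_mulQ e w] with x hx
  rw [hx]

theorem inner_mulQ_symm (u w : G.EdgeL2 e) :
    (inner ℂ u (K.mulQ e w)).re = (inner ℂ w (K.mulQ e u)).re := by
  rw [← inner_conj_symm w, Complex.conj_re, inner_mulQ, L2.inner_def]
  congr 1
  refine integral_congr_ae ?_
  filter_upwards [K.coeFn_mulQ e u, ae_restrict_mem measurableSet_Ioo] with x hx hmem
  rw [hx, K.inner_opQ e (Ioo_subset_Icc_self hmem)]

theorem norm_sq_eq_integral (u : G.EdgeL2 e) :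
    ‖u‖ ^ 2 = ∫ x in Ioo 0 (G.len e), ‖u x‖ ^ 2 := by
  have h : (inner ℂ u u : ℂ) = ((∫ x in Ioo 0 (G.len e), ‖u x‖ ^ 2 : ℝ) : ℂ) := by
    rw [L2.inner_def, ← integral_complex_ofReal]
    refine integral_congr_ae (Eventually.of_forall fun x => ?_)
    simp only [inner_self_eq_norm_sq_to_K]
    norm_cast
  rw [← inner_self_eq_norm_sq (𝕜 := ℂ) u]
  exact (congrArg Complex.re h).trans (Complex.ofReal_re _)

theorem exists_mulQ_upper : ∃ C : ℝ, 0 ≤ C ∧ ∀ u : G.EdgeL2 e,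
    (inner ℂ u (K.mulQ e u)).re ≤ C * ‖u‖ ^ 2 := by
  obtain ⟨C, hC⟩ := K.exists_bound_opQ e
  refine ⟨C, hC.nonneg, fun u => ?_⟩
  have h1 : ‖K.mulQ e u‖ ≤ C * ‖u‖ := by
    refine Lp.norm_le_mul_norm_of_ae_le_mul ?_
    filter_upwards [K.coeFn_mulQ e u, hC.bound] with x hx hb
    rw [hx]
    exact ((K.opQ e x).le_opNorm _).trans (by gcongr)
  calc _ ≤ ‖inner ℂ u (K.mulQ e u)‖ := Complex.re_le_norm _
    _ ≤ ‖u‖ * ‖K.mulQ e u‖ := norm_inner_le_norm _ _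
    _ ≤ ‖u‖ * (C * ‖u‖) := by gcongr
    _ = C * ‖u‖ ^ 2 := by ring

theorem integrable_inner_mulQ (u w : G.EdgeL2 e) :
    Integrable (fun x => inner ℂ (u x) (K.opQ e x (w x))) (volume.restrict (Ioo 0 (G.len e))) := by
  refine (L2.integrable_inner (𝕜 := ℂ) u (K.mulQ e w)).congr ?_
  filter_upwards [K.coeFn_mulQ e w] with x hx
  rw [hx]

theorem integrable_norm_sq (u : G.EdgeL2 e) :
    Integrable (fun x => ‖u x‖ ^ 2) (volume.restrict (Ioo 0 (G.len e))) :=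
  (Lp.memLp u).integrable_norm_pow two_ne_zero

theorem exists_mulQ_lower : ∃ q : ℝ, 0 < q ∧ ∀ u : G.EdgeL2 e,
    q * ‖u‖ ^ 2 ≤ (inner ℂ u (K.mulQ e u)).re := by
  obtain ⟨q, hq, h⟩ := K.Q_posDef e
  refine ⟨q, hq, fun u => ?_⟩
  have h2 : (inner ℂ u (K.mulQ e u)).re =
      ∫ x in Ioo 0 (G.len e), (inner ℂ (u x) (K.opQ e x (u x))).re := by
    rw [inner_mulQ]
    exact (integral_re (𝕜 := ℂ) (K.integrable_inner_mulQ e u u)).symm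
  rw [h2, norm_sq_eq_integral, ← integral_const_mul]
  refine integral_mono_ae ((integrable_norm_sq e u).const_mul q)
    (K.integrable_inner_mulQ e u u).re ?_
  filter_upwards [ae_restrict_mem measurableSet_Ioo] with x hx
  exact h x (Ioo_subset_Icc_self hx) (u x)

end EdgeCoefficients

/-! ### The energy inner product of the system -/

/-- A symmetric form that is equivalent to the squared norm is a bounded bilinear form. -/
theorem exists_isEquivInner {H : Type*} [NormedAddCommGroup H] [NormedSpace ℂ H]
    (b : H → H → ℝ) {c : ℝ} (hc : 0 < c) (hadd : ∀ x y z, b (x + y) z = b x z + b y z)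
    (hsmul : ∀ (r : ℝ) x y, b ((r : ℂ) • x) y = r * b x y) (hsymm : ∀ x y, b x y = b y x)
    (hlower : ∀ x, ‖x‖ ^ 2 ≤ c * b x x) (hupper : ∀ x, b x x ≤ c * ‖x‖ ^ 2) :
    ∃ B : H →L[ℝ] H →L[ℝ] ℝ, (∀ x y, B x y = b x y) ∧ IsEquivInner B c := by
  have hsmul' : ∀ (r : ℝ) x y, b (r • x) y = r * b x y := fun r x y => by
    rw [← hsmul, Complex.coe_smul]
  have hnonneg : ∀ x, 0 ≤ b x x := fun x =>
    nonneg_of_mul_nonneg_right ((sq_nonneg _).trans (hlower x)) hc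
  have hzero : ∀ y, b 0 y = 0 := fun y => by
    have := hsmul 0 0 y
    simpa using this
  have hexp : ∀ (r : ℝ) x y, b (x + r • y) (x + r • y) =
      b x x + 2 * r * b x y + r ^ 2 * b y y := fun r x y => by
    rw [hadd, hsmul', hsymm x (x + _), hsymm y (x + _), hadd, hadd, hsmul', hsmul', hsymm y x]
    ring
  have hbound : ∀ x y, ‖b x y‖ ≤ c * ‖x‖ * ‖y‖ := by
    have key : ∀ x y, -(b x y) ≤ c * ‖x‖ * ‖y‖ := fun x y => by
      rcases eq_or_ne x 0 with rfl | hx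
      · simp [hzero]
      rcases eq_or_ne y 0 with rfl | hy
      · simp [hsymm x, hzero]
      have hx' : 0 < ‖x‖ := norm_pos_iff.2 hx
      have hy' : 0 < ‖y‖ := norm_pos_iff.2 hy
      -- The ratio balances the two quadratic terms: each is at most `c ‖x‖ ^ 2`.
      have h1 := hnonneg (x + (‖x‖ / ‖y‖) • y)
      rw [hexp] at h1
      have h2 := hupper x
      have h3 : (‖x‖ / ‖y‖) ^ 2 * b y y ≤ c * ‖x‖ ^ 2 := by
        calc _ ≤ (‖x‖ / ‖y‖) ^ 2 * (c * ‖y‖ ^ 2) := by gcongr; exact hupper y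
          _ = c * ‖x‖ ^ 2 := by field_simp
      have h4 : (‖x‖ / ‖y‖) * -(b x y) ≤ c * ‖x‖ ^ 2 := by linarith
      rw [div_mul_eq_mul_div, div_le_iff₀ hy'] at h4
      have h5 : ‖x‖ * -(b x y) ≤ ‖x‖ * (c * ‖x‖ * ‖y‖) := by linarith
      exact le_of_mul_le_mul_left h5 hx'
    intro x y
    rw [Real.norm_eq_abs, abs_le]
    refine ⟨by linarith [key x y], ?_⟩
    have h1 := key ((-1 : ℝ) • x) y
    rw [hsmul', norm_smul, norm_neg, norm_one, one_mul] at h1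
    linarith
  refine ⟨LinearMap.mkContinuous₂ (LinearMap.mk₂ ℝ b hadd (fun r x y => hsmul' r x y)
    (fun x y z => by rw [hsymm, hadd, hsymm y, hsymm z])
    (fun r x y => by rw [hsymm, hsmul', hsymm y]; rfl)) c hbound, fun _ _ => rfl,
    ⟨hc, hsymm, hlower, hupper⟩⟩

/-- The inner product of an inner product space, given priority over the other instances. -/
@[reducible] def innerOfInnerProductSpace {F : Type*} [NormedAddCommGroup F]
    [InnerProductSpace ℂ F] : Inner ℂ F := InnerProductSpace.toInner

section InnerProduct

attribute [local instance] innerOfInnerProductSpace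

variable {F : Type*} [NormedAddCommGroup F] [InnerProductSpace ℂ F]

theorem re_inner_real_smul_left (r : ℝ) (x y : F) :
    (inner ℂ ((r : ℂ) • x) y).re = r * (inner ℂ x y).re := by
  rw [inner_smul_left, Complex.conj_ofReal, Complex.re_ofReal_mul]

theorem re_inner_real_smul_right (r : ℝ) (x y : F) :
    (inner ℂ x ((r : ℂ) • y)).re = r * (inner ℂ x y).re := by
  rw [inner_smul_right, Complex.re_ofReal_mul]

theorem re_inner_comm (x y : F) : (inner ℂ x y).re = (inner ℂ y x).re := by
  rw [← inner_conj_symm, Complex.conj_re]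

/-- The minimum over the compact unit sphere is positive; homogeneity does the rest. The sphere is
empty when the space is trivial. -/
theorem exists_re_inner_lower [FiniteDimensional ℂ F] (Q : F →ₗ[ℂ] F)
    (hQ : ∀ x, x ≠ 0 → 0 < (inner ℂ x (Q x)).re) :
    ∃ q : ℝ, 0 < q ∧ ∀ x : F, q * ‖x‖ ^ 2 ≤ (inner ℂ x (Q x)).re := by
  have hc : Continuous fun x : F => (inner ℂ x (Q x)).re := by
    have : Continuous (Q) := (Q).continuous_of_finiteDimensional
    exact Complex.continuous_re.comp (continuous_id.inner this)
  have key : ∃ q : ℝ, 0 < q ∧ ∀ x : F, ‖x‖ = 1 → q ≤ (inner ℂ x (Q x)).re := by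
    rcases (Metric.sphere (0 : F) 1).eq_empty_or_nonempty with h | h
    · refine ⟨1, one_pos, fun x hx => ?_⟩
      have : x ∈ Metric.sphere (0 : F) 1 := by simpa using hx
      rw [h] at this
      exact absurd this (notMem_empty _)
    · obtain ⟨x₀, hx₀, hmin⟩ := (isCompact_sphere (0 : F) 1).exists_isMinOn h hc.continuousOn
      refine ⟨_, hQ x₀ ?_, fun x hx => hmin (by simpa using hx)⟩
      rintro rfl
      simp at hx₀
  obtain ⟨q, hq, h⟩ := key
  refine ⟨q, hq, fun x => ?_⟩
  rcases eq_or_ne x 0 with rfl | hx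
  · simp
  have hx' : 0 < ‖x‖ := norm_pos_iff.2 hx
  have h1 := h (((‖x‖⁻¹ : ℝ) : ℂ) • x) (by
    rw [norm_smul, Complex.norm_real, norm_inv, norm_norm, inv_mul_cancel₀ hx'.ne'])
  rw [map_smul, re_inner_real_smul_left, re_inner_real_smul_right] at h1
  have h2 : ‖x‖⁻¹ * (‖x‖⁻¹ * (inner ℂ x (Q x)).re) =
      (inner ℂ x (Q x)).re / ‖x‖ ^ 2 := by field_simp
  rw [h2, le_div_iff₀ (by positivity)] at h1
  exact h1

theorem exists_re_inner_le [FiniteDimensional ℂ F] (S T : F →ₗ[ℂ] F) :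
    ∃ C : ℝ, 0 ≤ C ∧ ∀ x, (inner ℂ (S x) (T x)).re ≤ C * ‖x‖ ^ 2 := by
  refine ⟨‖S.toContinuousLinearMap‖ * ‖T.toContinuousLinearMap‖, by positivity, fun x => ?_⟩
  calc _ ≤ ‖inner ℂ (S x) (T x)‖ := Complex.re_le_norm _
    _ ≤ ‖S x‖ * ‖T x‖ := norm_inner_le_norm _ _
    _ ≤ (‖S.toContinuousLinearMap‖ * ‖x‖) * (‖T.toContinuousLinearMap‖ * ‖x‖) := by
      gcongr
      · exact S.toContinuousLinearMap.le_opNorm x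
      · exact T.toContinuousLinearMap.le_opNorm x
    _ = _ := by ring

end InnerProduct

section EnergyForm

attribute [local instance] innerOfInnerProductSpace

variable {V E : Type*} [Fintype V] [Fintype E] [DecidableEq V] [DecidableEq E]
  {G : Network V E}

namespace VertexConditions

theorem inner_Q_symm (D : VertexConditions G) (v : V) (x y : D.Yd v) :
    inner ℂ (D.Q v x) y = inner ℂ x (D.Q v y) := D.Q_symmetric v x y

theorem exists_Q_lower (D : VertexConditions G) (v : V) : ∃ q : ℝ, 0 < q ∧ ∀ x : D.Yd v,
    q * ‖x‖ ^ 2 ≤ (inner ℂ x (D.Q v x)).re := by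
  have hpos : ∀ x : D.Yd v, x ≠ 0 → 0 < (inner ℂ x (D.Q v x)).re := D.Q_posDef v
  have h := exists_re_inner_lower (F := D.Yd v) (D.Q v)
  replace h := h hpos
  exact h

theorem norm_sq_state (D : VertexConditions G) (U : D.State) :
    ‖U‖ ^ 2 = ∑ e, ‖U.fst e‖ ^ 2 + ∑ v, ‖U.snd v‖ ^ 2 := by
  rw [WithLp.prod_norm_sq_eq_of_L2, PiLp.norm_sq_eq_of_L2, PiLp.norm_sq_eq_of_L2]

/-- The energy form of the system. -/
noncomputable def energy (D : VertexConditions G) (K : EdgeCoefficients G) (U W : D.State) : ℝ :=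
  ∑ e, (inner ℂ (U.fst e) (K.mulQ e (W.fst e))).re +
    ∑ v, (inner ℂ (U.snd v) (D.Q v (W.snd v))).re

theorem exists_energy_inner (D : VertexConditions G) (K : EdgeCoefficients G) :
    ∃ (c : ℝ) (B : D.State →L[ℝ] D.State →L[ℝ] ℝ),
      (∀ U W, B U W = D.energy K U W) ∧ IsEquivInner B c := by
  choose q hq hlow using fun e => K.exists_mulQ_lower e
  choose C hC hup using fun e => K.exists_mulQ_upper e
  choose q' hq' hlow' using D.exists_Q_lower
  choose C' hC' hup' using fun v => exists_re_inner_le (F := D.Yd v) LinearMap.id (D.Q v)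
  -- One constant dominating all upper bounds and all inverse lower bounds; the `1` keeps it
  -- positive when there are no edges and vertices.
  set c : ℝ := 1 + ∑ e, ((q e)⁻¹ + C e) + ∑ v, ((q' v)⁻¹ + C' v) with hc
  have he : ∀ e, (q e)⁻¹ + C e ≤ ∑ e, ((q e)⁻¹ + C e) := fun e =>
    Finset.single_le_sum (f := fun e => (q e)⁻¹ + C e)
      (fun e _ => add_nonneg (inv_nonneg.2 (hq e).le) (hC e)) (Finset.mem_univ e)
  have hv : ∀ v, (q' v)⁻¹ + C' v ≤ ∑ v, ((q' v)⁻¹ + C' v) := fun v =>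
    Finset.single_le_sum (f := fun v => (q' v)⁻¹ + C' v)
      (fun v _ => add_nonneg (inv_nonneg.2 (hq' v).le) (hC' v)) (Finset.mem_univ v)
  have he0 : 0 ≤ ∑ e, ((q e)⁻¹ + C e) :=
    Finset.sum_nonneg fun e _ => add_nonneg (inv_nonneg.2 (hq e).le) (hC e)
  have hv0 : 0 ≤ ∑ v, ((q' v)⁻¹ + C' v) :=
    Finset.sum_nonneg fun v _ => add_nonneg (inv_nonneg.2 (hq' v).le) (hC' v)
  have aux : ∀ {q n b : ℝ}, 0 < q → q⁻¹ ≤ c → q * n ^ 2 ≤ b → n ^ 2 ≤ c * b :=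
    fun {q n b} hq hqc h => by
      have hb : 0 ≤ b := (mul_nonneg hq.le (sq_nonneg n)).trans h
      calc n ^ 2 = q⁻¹ * (q * n ^ 2) := by field_simp
        _ ≤ c * b := by gcongr
  refine ⟨c, exists_isEquivInner (D.energy K) (by positivity) ?_ ?_ ?_ ?_ ?_⟩
  · intro x y z
    simp only [energy, WithLp.add_fst, WithLp.add_snd, PiLp.add_apply, inner_add_left,
      Complex.add_re, Finset.sum_add_distrib]
    ring
  · intro r x y
    simp only [energy, mul_add, Finset.mul_sum]
    refine congrArg₂ (· + ·) (Finset.sum_congr rfl fun e _ => ?_)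
      (Finset.sum_congr rfl fun v _ => ?_)
    · exact re_inner_real_smul_left r _ _
    · have h := re_inner_real_smul_left r (x.snd v) (D.Q v (y.snd v))
      exact h
  · intro x y
    simp only [energy]
    congr 1
    · exact Finset.sum_congr rfl fun e _ => K.inner_mulQ_symm e _ _
    · refine Finset.sum_congr rfl fun v _ => ?_
      rw [← D.inner_Q_symm, ← inner_conj_symm, Complex.conj_re]
  · intro x
    rw [norm_sq_state, energy, mul_add, Finset.mul_sum, Finset.mul_sum]
    refine add_le_add (Finset.sum_le_sum fun e _ => ?_) (Finset.sum_le_sum fun v _ => ?_)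
    · exact aux (hq e) (by linarith [he e, hC e]) (hlow e _)
    · exact aux (hq' v) (by linarith [hv v, hC' v]) (hlow' v _)
  · intro x
    rw [norm_sq_state, energy, mul_add, Finset.mul_sum, Finset.mul_sum]
    refine add_le_add (Finset.sum_le_sum fun e _ => ?_) (Finset.sum_le_sum fun v _ => ?_)
    · refine (hup e _).trans ?_
      gcongr
      linarith [he e, inv_nonneg.2 (hq e).le]
    · refine (hup' v _).trans ?_
      gcongr
      linarith [hv v, inv_nonneg.2 (hq' v).le]

end VertexConditions

end EnergyForm

set_option linter.unusedSectionVars false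

/-! ### Boundary terms and dissipativity -/

section Incidence

variable {V E : Type*} [Fintype V] [Fintype E] [DecidableEq V] [DecidableEq E]
  {G : Network V E}

attribute [local instance] innerOfInnerProductSpace

namespace Network

/-- A sum over all vertices and all edges incident in them is a sum over the edges. -/
theorem sum_edgesAt {X : Type*} [AddCommMonoid X] (G : Network V E) (F : V → E → X) :
    ∑ v, ∑ e : G.EdgesAt v, F v e = ∑ e, (F (G.term e) e + F (G.init e) e) := by
  have h1 : ∀ v, ∑ e : G.EdgesAt v, F v e = ∑ e, if G.Inc v e then F v e else 0 := fun v => by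
    rw [← Finset.sum_filter]
    exact (Finset.sum_subtype (p := G.Inc v) (Finset.univ.filter (G.Inc v)) (by simp) (F v)).symm
  rw [Finset.sum_congr rfl fun v _ => h1 v, Finset.sum_comm]
  refine Finset.sum_congr rfl fun e _ => ?_
  have h2 : Finset.univ.filter (fun v => G.Inc v e) = {G.term e, G.init e} := by
    ext v
    rw [Finset.mem_filter, Finset.mem_insert, Finset.mem_singleton, Inc]
    simp only [Finset.mem_univ, true_and, eq_comm, or_comm]
  rw [← Finset.sum_filter, h2, Finset.sum_pair (G.init_ne_term e).symm]

theorem incidence_init (G : Network V E) (e : E) : G.incidence (G.init e) e = -1 := by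
  simp [incidence, (G.init_ne_term e).symm]

theorem incidence_term (G : Network V E) (e : E) : G.incidence (G.term e) e = 1 := by
  simp [incidence, G.init_ne_term e]

theorem pos_init (G : Network V E) (e : E) : G.pos (G.init e) e = 0 := by simp [pos]

theorem pos_term (G : Network V E) (e : E) : G.pos (G.term e) e = G.len e := by
  simp [pos, G.init_ne_term e]

theorem pos_mem (G : Network V E) (v : V) (e : E) : G.pos v e ∈ Icc 0 (G.len e) := by
  unfold pos
  split_ifs
  · exact ⟨le_rfl, (G.len_pos e).le⟩
  · exact ⟨(G.len_pos e).le, le_rfl⟩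

/-- The component of a vector of `ℂ^{k_v}` that belongs to an edge. -/
noncomputable def slice (G : Network V E) {v : V} (ξ : G.VertexVec v) (e : G.EdgesAt v) : G.EdgeVec e :=
  WithLp.toLp 2 fun i => ξ ⟨e, i⟩

theorem slice_trace (G : Network V E) (v : V) (f : ∀ e, ℝ → G.EdgeVec e) (e : G.EdgesAt v) :
    G.slice (G.trace v f) e = f e (G.pos v e) := rfl

theorem inner_eq_sum_slice (G : Network V E) {v : V} (ξ η : G.VertexVec v) :
    inner ℂ ξ η = ∑ e, inner ℂ (G.slice ξ e) (G.slice η e) := by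
  rw [PiLp.inner_apply, Fintype.sum_sigma]
  refine Finset.sum_congr rfl fun e _ => ?_
  rw [PiLp.inner_apply]
  rfl

end Network

theorem slice_vertexT (K : EdgeCoefficients G) (v : V) (ξ : G.VertexVec v) (e : G.EdgesAt v) :
    G.slice (vertexT K v ξ) e = G.incidence v e • K.opS e (G.pos v e) (G.slice ξ e) := by
  rw [K.opS_eq]
  ext i
  rw [PiLp.smul_apply]
  change (vertexT K v ξ) ⟨e, i⟩ = _
  simp only [vertexT, Matrix.ofLp_toLpLin, Matrix.toLin'_apply, matOp,
    Matrix.ofLp_toEuclideanCLM, Matrix.mulVec, dotProduct]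
  rw [Fintype.sum_sigma, Finset.sum_eq_single e]
  · rw [smul_eq_mul, Finset.mul_sum]
    refine Finset.sum_congr rfl fun j _ => ?_
    rw [Matrix.blockDiagonal'_apply_eq, Matrix.smul_apply, smul_eq_mul, mul_assoc]
    rfl
  · intro e' _ hne
    refine Finset.sum_eq_zero fun j _ => ?_
    rw [Matrix.blockDiagonal'_apply_ne _ _ _ hne.symm, zero_mul]
  · simp

/-- The sum of the boundary forms over all vertices. -/
theorem sum_inner_trace_vertexT (K : EdgeCoefficients G) (f : ∀ e, ℝ → G.EdgeVec e) :
    ∑ v, (inner ℂ (G.trace v f) (vertexT K v (G.trace v f))).re =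
      ∑ e, ((inner ℂ (f e (G.len e)) (K.opS e (G.len e) (f e (G.len e)))).re -
        (inner ℂ (f e 0) (K.opS e 0 (f e 0))).re) := by
  have h1 : ∀ v, (inner ℂ (G.trace v f) (vertexT K v (G.trace v f))).re =
      ∑ e : G.EdgesAt v, (G.incidence v e *
        inner ℂ (f e (G.pos v e)) (K.opS e (G.pos v e) (f e (G.pos v e)))).re := fun v => by
    rw [G.inner_eq_sum_slice, Complex.re_sum]
    refine Finset.sum_congr rfl fun e _ => ?_
    rw [slice_vertexT, G.slice_trace, inner_smul_right]
  -- Every edge occurs at its two distinct endpoints, with sign `+1` at the terminal and `-1` at the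
  -- initial one, which gives the difference of its end values.
  rw [Finset.sum_congr rfl fun v _ => h1 v, G.sum_edgesAt fun v e => (G.incidence v e *
        inner ℂ (f e (G.pos v e)) (K.opS e (G.pos v e) (f e (G.pos v e)))).re]
  refine Finset.sum_congr rfl fun e _ => ?_
  rw [G.incidence_init, G.incidence_term, G.pos_init, G.pos_term, one_mul, neg_one_mul,
    Complex.neg_re, sub_eq_add_neg]

namespace VertexConditions

theorem inner_Pd (D : VertexConditions G) (v : V) (ξ : G.VertexVec v) (y : D.Yd v) :
    inner ℂ ξ (y : G.VertexVec v) = inner ℂ (D.Pd v ξ) y :=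
  (Submodule.inner_orthogonalProjectionOnto_eq_of_mem_right (K := D.Yd v) y ξ).symm

theorem inner_Bstar (D : VertexConditions G) (v : V) (ξ : D.Y v) (y : D.Yd v) :
    inner ℂ (ξ : G.VertexVec v) (D.Bstar v y : G.VertexVec v) = inner ℂ (D.B v ξ) y := by
  have h := LinearMap.adjoint_inner_right (𝕜 := ℂ) (E := D.Y v) (F := D.Yd v) (D.B v) ξ y
  rw [Submodule.coe_inner] at h
  exact h

theorem re_inner_Q_comm (D : VertexConditions G) (v : V) (x y : D.Yd v) :
    (inner ℂ x (D.Q v y)).re = (inner ℂ y (D.Q v x)).re := by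
  rw [← D.inner_Q_symm, ← inner_conj_symm, Complex.conj_re]

/-- `Q_v B_v` and its adjoint contribute the same real part, hence the factor `2`. What remains is
the energy pairing of `B_v ξ` with the projected trace. -/
theorem formY_eq (D : VertexConditions G) (K : EdgeCoefficients G) (lam : ℝ) (v : V) (ξ : D.Y v) :
    D.formY K lam v ξ = (inner ℂ (ξ : G.VertexVec v) (vertexT K v ξ)).re +
      2 * (inner ℂ (D.B v ξ) (D.Q v (D.Pd v ξ))).re -
      lam * (inner ℂ (D.Pd v (ξ : G.VertexVec v)) (D.Q v (D.Pd v ξ))).re := by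
  have h : D.formY K lam v ξ = (inner ℂ (ξ : G.VertexVec v)
    (vertexT K v ξ + (D.Q v (D.B v ξ) : G.VertexVec v)
      + (D.Bstar v (D.Q v (D.Pd v ξ)) : G.VertexVec v)
      - (lam : ℂ) • (D.Q v (D.Pd v ξ) : G.VertexVec v))).re := rfl
  rw [h, inner_sub_right, inner_add_right, inner_add_right, inner_smul_right, D.inner_Pd,
    D.inner_Pd, D.inner_Bstar, Complex.sub_re, Complex.add_re, Complex.add_re,
    Complex.re_ofReal_mul, D.re_inner_Q_comm v (D.Pd v ξ) (D.B v ξ)]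
  ring

end VertexConditions

end Incidence

/-! ### Algebra of the operator -/

section PrimitiveAlgebra

variable {E : Type*} [NormedAddCommGroup E] [NormedSpace ℝ E] {l : ℝ} {f f' g g' : ℝ → E}

theorem intervalIntegrable_of_mem_Icc {x : ℝ} (h : IntervalIntegrable g volume 0 l)
    (hx : x ∈ Icc 0 l) : IntervalIntegrable g volume 0 x :=
  h.mono_set (by
    rw [uIcc_of_le hx.1, uIcc_of_le (hx.1.trans hx.2)]
    exact Icc_subset_Icc_right hx.2)

theorem IsPrimitive.add (h : IsPrimitive l f g) (h' : IsPrimitive l f' g') :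
    IsPrimitive l (f + f') (g + g') := by
  refine ⟨h.1.add h'.1, fun x hx => ?_⟩
  have := intervalIntegral.integral_add (intervalIntegrable_of_mem_Icc h.1 hx)
    (intervalIntegrable_of_mem_Icc h'.1 hx)
  simp only [Pi.add_apply] at this ⊢
  rw [this, h.2 x hx, h'.2 x hx]
  abel

theorem IsPrimitive.map {F : Type*} [NormedAddCommGroup F] [NormedSpace ℝ F] [CompleteSpace E]
    [CompleteSpace F] (h : IsPrimitive l f g) (T : E →L[ℝ] F) :
    IsPrimitive l (fun x => T (f x)) (fun x => T (g x)) := by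
  refine ⟨⟨T.integrable_comp h.1.1, T.integrable_comp h.1.2⟩, fun x hx => ?_⟩
  rw [T.intervalIntegral_comp_comm (intervalIntegrable_of_mem_Icc h.1 hx), ← map_add,
    ← h.2 x hx]

theorem IsPrimitive.congr_ae (hl : 0 ≤ l) (h : IsPrimitive l f g)
    (hg : g =ᵐ[volume.restrict (Ioo 0 l)] g') : IsPrimitive l f g' := by
  refine ⟨(intervalIntegrable_iff_Ioo hl).2 (((intervalIntegrable_iff_Ioo hl).1 h.1).congr hg),
    fun x hx => ?_⟩
  rw [h.2 x hx, ← integral_Ioo_eq_interval hx.1, ← integral_Ioo_eq_interval hx.1]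
  congr 1
  exact integral_congr_ae (ae_restrict_of_ae_restrict_of_subset (Ioo_subset_Ioo_right hx.2) hg)

theorem IsPrimitive.eq_const_of_ae_zero (hl : 0 ≤ l) (h : IsPrimitive l f g)
    (hg : g =ᵐ[volume.restrict (Ioo 0 l)] 0) {x : ℝ} (hx : x ∈ Icc 0 l) : f x = f 0 := by
  rw [(h.congr_ae hl hg).2 x hx]
  simp

/-- A function that vanishes almost everywhere has no other primitive than itself. -/
theorem IsPrimitive.ae_zero [CompleteSpace E] (hl : 0 < l) (h : IsPrimitive l f g)
    (hf : f =ᵐ[volume.restrict (Ioo 0 l)] 0) : g =ᵐ[volume.restrict (Ioo 0 l)] 0 := by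
  have hw := h.hasWeakDerivOn hl (u := 0) hf.symm
  have hgi := (intervalIntegrable_iff_Ioo hl.le).1 h.1
  have h1 : ∀ᵐ x, x ∈ Ioo 0 l → g x = 0 := by
    refine isOpen_Ioo.ae_eq_zero_of_integral_contDiff_smul_eq_zero ?_ fun φ hφ hc hs => ?_
    · exact IntegrableOn.locallyIntegrableOn hgi
    · have h2 := hw φ hφ hc hs
      simp only [Pi.zero_apply, smul_zero, integral_zero] at h2
      rw [eq_comm, neg_eq_zero] at h2
      rw [← h2]
      refine (setIntegral_eq_integral_of_forall_compl_eq_zero fun x hx => ?_).symm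
      rw [image_eq_zero_of_notMem_tsupport fun hx' => hx (hs hx'), zero_smul]
  exact (ae_restrict_iff' measurableSet_Ioo).2 h1

/-- The derivative vanishes almost everywhere, so `f` is constant, and it vanishes at some point of
an interval of positive length. This reaches the endpoints, where traces are taken. -/
theorem IsPrimitive.eq_zero_of_ae_zero [CompleteSpace E] (hl : 0 < l) (h : IsPrimitive l f g)
    (hf : f =ᵐ[volume.restrict (Ioo 0 l)] 0) {x : ℝ} (hx : x ∈ Icc 0 l) : f x = 0 := by
  have hconst := fun {x : ℝ} hx => h.eq_const_of_ae_zero hl.le (h.ae_zero hl hf) (x := x) hx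
  have hne : NeBot (ae (volume.restrict (Ioo 0 l))) := by
    rw [ae_neBot, Ne, Measure.restrict_eq_zero, Real.volume_Ioo, sub_zero,
      ENNReal.ofReal_eq_zero, not_le]
    exact hl
  obtain ⟨y, hy, hymem⟩ := (hf.and (ae_restrict_mem measurableSet_Ioo)).exists
  rw [hconst hx, ← hconst (Ioo_subset_Icc_self hymem), hy]
  rfl

end PrimitiveAlgebra

section OperatorAlgebra

variable {V E : Type*} [Fintype V] [Fintype E] [DecidableEq V] [DecidableEq E]
  {G : Network V E}

namespace VertexConditions

/-- Weak derivatives are traded for integral representations, which behave well under linear maps,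
boundary evaluation and differential equations. -/
theorem isA_iff (D : VertexConditions G) (K : EdgeCoefficients G) (U W : D.State) :
    D.IsA K U W ↔ ∃ (f : ∀ e, ℝ → G.EdgeVec e) (g : ∀ e, G.EdgeL2 e),
      (∀ e, U.fst e =ᵐ[volume.restrict (Ioo 0 (G.len e))] f e ∧
        IsPrimitive (G.len e) (f e) (g e)) ∧
      (∀ e, W.fst e =ᵐ[volume.restrict (Ioo 0 (G.len e))] fun x =>
        K.opM e x (g e x) + K.opN e x (f e x)) ∧
      ∀ v, U.snd v = D.Pd v (G.trace v f) ∧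
        ∃ h : G.trace v f ∈ D.Y v, W.snd v = D.B v ⟨G.trace v f, h⟩ + D.C v (U.snd v) := by
  constructor
  · rintro ⟨f, g, h1, h2, h3⟩
    refine ⟨f, g, fun e => ⟨(h1 e).2.1, ?_⟩, h2, h3⟩
    exact (h1 e).2.2.isPrimitive (G.len_pos e) ((Lp.memLp (g e)).integrable one_le_two)
      (h1 e).1 (h1 e).2.1
  · rintro ⟨f, g, h1, h2, h3⟩
    exact ⟨f, g, fun e => ⟨(h1 e).2.continuousOn (G.len_pos e).le, (h1 e).1,
      (h1 e).2.hasWeakDerivOn (G.len_pos e) (h1 e).1⟩, h2, h3⟩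

theorem trace_add (v : V) (f f' : ∀ e, ℝ → G.EdgeVec e) :
    G.trace v (fun e => f e + f' e) = G.trace v f + G.trace v f' := rfl

theorem trace_smul (a : ℂ) (v : V) (f : ∀ e, ℝ → G.EdgeVec e) :
    G.trace v (fun e => fun x => a • f e x) = a • G.trace v f := rfl

theorem Pd_add (D : VertexConditions G) (v : V) (ξ η : G.VertexVec v) :
    D.Pd v (ξ + η) = D.Pd v ξ + D.Pd v η := map_add _ _ _

theorem Pd_smul (D : VertexConditions G) (v : V) (a : ℂ) (ξ : G.VertexVec v) :
    D.Pd v (a • ξ) = a • D.Pd v ξ := map_smul _ _ _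

theorem IsA.add {D : VertexConditions G} {K : EdgeCoefficients G} {U W U' W' : D.State}
    (h : D.IsA K U W) (h' : D.IsA K U' W') : D.IsA K (U + U') (W + W') := by
  rw [isA_iff] at h h' ⊢
  obtain ⟨f, g, h1, h2, h3⟩ := h
  obtain ⟨f', g', h1', h2', h3'⟩ := h'
  refine ⟨fun e => f e + f' e, fun e => g e + g' e, fun e => ⟨?_, ?_⟩, fun e => ?_, fun v => ?_⟩
  · rw [WithLp.add_fst, PiLp.add_apply]
    exact (Lp.coeFn_add _ _).trans ((h1 e).1.add (h1' e).1)
  · exact ((h1 e).2.add (h1' e).2).congr_ae (G.len_pos e).le (Lp.coeFn_add _ _).symm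
  · rw [WithLp.add_fst, PiLp.add_apply]
    filter_upwards [Lp.coeFn_add (W.fst e) (W'.fst e), Lp.coeFn_add (g e) (g' e), h2 e, h2' e]
      with x e1 e2 e3 e4
    rw [e1, Pi.add_apply, e2, e3, e4]
    simp only [Pi.add_apply, map_add]
    abel
  · obtain ⟨hU, hY, hW⟩ := h3 v
    obtain ⟨hU', hY', hW'⟩ := h3' v
    rw [WithLp.add_snd, WithLp.add_snd, PiLp.add_apply, PiLp.add_apply, trace_add, Pd_add]
    refine ⟨by rw [hU, hU'], (D.Y v).add_mem hY hY', ?_⟩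
    have e1 : (⟨G.trace v f + G.trace v f', (D.Y v).add_mem hY hY'⟩ : D.Y v) =
      ⟨G.trace v f, hY⟩ + ⟨G.trace v f', hY'⟩ := rfl
    rw [e1, map_add, map_add, hW, hW']
    abel

theorem IsA.smul {D : VertexConditions G} {K : EdgeCoefficients G} {U W : D.State}
    (a : ℂ) (h : D.IsA K U W) : D.IsA K (a • U) (a • W) := by
  rw [isA_iff] at h ⊢
  obtain ⟨f, g, h1, h2, h3⟩ := h
  refine ⟨fun e x => a • f e x, fun e => a • g e, fun e => ⟨?_, ?_⟩, fun e => ?_, fun v => ?_⟩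
  · rw [WithLp.smul_fst, PiLp.smul_apply]
    exact (Lp.coeFn_smul _ _).trans ((h1 e).1.const_smul a)
  · have := (h1 e).2.map ((a • ContinuousLinearMap.id ℂ (G.EdgeVec e)).restrictScalars ℝ)
    refine this.congr_ae (G.len_pos e).le ?_
    filter_upwards [Lp.coeFn_smul a (g e)] with x hx
    rw [hx]
    rfl
  · rw [WithLp.smul_fst, PiLp.smul_apply]
    filter_upwards [Lp.coeFn_smul a (W.fst e), Lp.coeFn_smul a (g e), h2 e] with x e1 e2 e3
    rw [e1, Pi.smul_apply, e2, e3]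
    simp only [Pi.smul_apply, map_smul, smul_add]
  · obtain ⟨hU, hY, hW⟩ := h3 v
    rw [WithLp.smul_snd, WithLp.smul_snd, PiLp.smul_apply, PiLp.smul_apply, trace_smul, Pd_smul]
    refine ⟨by rw [hU], (D.Y v).smul_mem a hY, ?_⟩
    have e1 : (⟨a • G.trace v f, (D.Y v).smul_mem a hY⟩ : D.Y v) =
      a • ⟨G.trace v f, hY⟩ := rfl
    rw [e1, map_smul, map_smul, hW, smul_add]

theorem IsA.eq_zero {D : VertexConditions G} {K : EdgeCoefficients G} {W : D.State}
    (h : D.IsA K 0 W) : W = 0 := by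
  rw [isA_iff] at h
  obtain ⟨f, g, h1, h2, h3⟩ := h
  have hf0 : ∀ e, f e =ᵐ[volume.restrict (Ioo 0 (G.len e))] 0 := fun e =>
    (h1 e).1.symm.trans (Lp.coeFn_zero _ _ _)
  have hg0 : ∀ e, g e =ᵐ[volume.restrict (Ioo 0 (G.len e))] 0 := fun e =>
    (h1 e).2.ae_zero (G.len_pos e) (hf0 e)
  have hf : ∀ e, ∀ x ∈ Icc 0 (G.len e), f e x = 0 := fun e x =>
    (h1 e).2.eq_zero_of_ae_zero (G.len_pos e) (hf0 e)
  have htr : ∀ v, G.trace v f = 0 := fun v => by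
    ext p
    change f p.1 (G.pos v p.1) p.2 = 0
    rw [hf _ _ (G.pos_mem v p.1)]
    rfl
  have hfst : ∀ e, W.fst e = 0 := fun e => by
    refine Lp.ext ?_
    filter_upwards [h2 e, hf0 e, hg0 e, Lp.coeFn_zero (G.EdgeVec e) 2
      (volume.restrict (Ioo 0 (G.len e)))] with x e1 e2 e3 e4
    rw [e1, e2, e3, e4]
    simp
  have hsnd : ∀ v, W.snd v = 0 := fun v => by
    obtain ⟨_, hY, hW⟩ := h3 v
    have e1 : (⟨G.trace v f, hY⟩ : D.Y v) = 0 := Subtype.ext (htr v)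
    rw [hW, e1, map_zero, zero_add]
    exact map_zero (D.C v)
  have := D.norm_sq_state W
  simp only [hfst, hsnd, norm_zero] at this
  simpa using this

end VertexConditions

end OperatorAlgebra

/-! ### Quasi-dissipativity -/

section Dissipativity

variable {V E : Type*} [Fintype V] [Fintype E] [DecidableEq V] [DecidableEq E]
  {G : Network V E}

attribute [local instance] innerOfInnerProductSpace

/-- Pointwise the energy pairing is that of `f` with `Q M g`, plus a term from `N`. Twice the former
integrates to the boundary difference up to the Lipschitz constant `L` of `Q M`; the latter is
bounded by `CN * CQ`. -/
theorem EdgeCoefficients.exists_edge_estimate (K : EdgeCoefficients G) (e : E) :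
    ∃ om : ℝ, 0 ≤ om ∧ ∀ (u w g : G.EdgeL2 e) (f : ℝ → G.EdgeVec e),
      u =ᵐ[volume.restrict (Ioo 0 (G.len e))] f → IsPrimitive (G.len e) f g →
      (w =ᵐ[volume.restrict (Ioo 0 (G.len e))] fun x => K.opM e x (g x) + K.opN e x (f x)) →
      2 * (inner ℂ w (K.mulQ e u)).re ≤ (inner ℂ (f (G.len e)) (K.opS e (G.len e) (f (G.len e)))).re -
        (inner ℂ (f 0) (K.opS e 0 (f 0))).re + om * ‖u‖ ^ 2 := by
  obtain ⟨L, hL⟩ := K.exists_lipschitz_opS e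
  obtain ⟨CN, hN⟩ := K.exists_bound_opN e
  obtain ⟨CQ, hQ⟩ := K.exists_bound_opQ e
  obtain ⟨CS, hS⟩ := exists_isBoundedCoeff_of_continuousOn hL.continuousOn
  have hCN := hN.nonneg
  have hCQ := hQ.nonneg
  refine ⟨L + 2 * (CN * CQ), by positivity, fun u w g f huf hfg hw => ?_⟩
  have hest := hfg.energy_estimate (G.len_pos e) hL fun x hx => K.inner_opS e hx
  have hSg := hS.memLp_apply (Lp.memLp g)
  have hint : Integrable (fun x => (inner ℂ (f x) (K.opS e x (g x))).re)
      (volume.restrict (Ioo 0 (G.len e))) := by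
    have h1 : Integrable (fun x => inner ℂ (u x) (hSg.toLp _ x))
      (volume.restrict (Ioo 0 (G.len e))) := L2.integrable_inner (𝕜 := ℂ) u (hSg.toLp _)
    refine h1.re.congr ?_
    filter_upwards [huf, hSg.coeFn_toLp] with x e1 e2
    rw [e1, e2]
    rfl
  have hnorm : ∫ x in Ioo 0 (G.len e), ‖f x‖ ^ 2 = ‖u‖ ^ 2 := by
    rw [EdgeCoefficients.norm_sq_eq_integral]
    refine integral_congr_ae ?_
    filter_upwards [huf] with x hx
    rw [hx]
  have hre : (inner ℂ w (K.mulQ e u)).re =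
      ∫ x in Ioo 0 (G.len e), (inner ℂ (w x) (K.opQ e x (u x))).re := by
    rw [K.inner_mulQ]
    exact (integral_re (𝕜 := ℂ) (K.integrable_inner_mulQ e w u)).symm
  have hle : (inner ℂ w (K.mulQ e u)).re ≤
      (∫ x in Ioo 0 (G.len e), (inner ℂ (f x) (K.opS e x (g x))).re) + CN * CQ * ‖u‖ ^ 2 := by
    rw [hre, EdgeCoefficients.norm_sq_eq_integral, ← integral_const_mul,
      ← integral_add hint ((EdgeCoefficients.integrable_norm_sq e u).const_mul _)]
    refine integral_mono_ae (K.integrable_inner_mulQ e w u).re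
      (hint.add ((EdgeCoefficients.integrable_norm_sq e u).const_mul _)) ?_
    filter_upwards [huf, hw, hN.bound, hQ.bound, ae_restrict_mem measurableSet_Ioo]
      with x e1 e2 e3 e4 hx
    have hx' := Ioo_subset_Icc_self hx
    have h1 : inner ℂ (K.opM e x (g x)) (K.opQ e x (f x)) = inner ℂ (K.opS e x (g x)) (f x) := by
      rw [← K.inner_opQ e hx']
      rfl
    have h2 : (inner ℂ (K.opN e x (f x)) (K.opQ e x (f x))).re ≤ CN * CQ * ‖f x‖ ^ 2 := by
      calc _ ≤ ‖inner ℂ (K.opN e x (f x)) (K.opQ e x (f x))‖ := Complex.re_le_norm _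
        _ ≤ ‖K.opN e x (f x)‖ * ‖K.opQ e x (f x)‖ := norm_inner_le_norm _ _
        _ ≤ (CN * ‖f x‖) * (CQ * ‖f x‖) := by
          gcongr
          · exact ((K.opN e x).le_opNorm _).trans (by gcongr)
          · exact ((K.opQ e x).le_opNorm _).trans (by gcongr)
        _ = _ := by ring
    have h3 : (inner ℂ (w x) (K.opQ e x (u x))).re =
        (inner ℂ (f x) (K.opS e x (g x))).re + (inner ℂ (K.opN e x (f x)) (K.opQ e x (f x))).re := by
      rw [e1, e2, inner_add_left, h1, Complex.add_re, re_inner_comm (K.opS e x (g x))]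
    have h4 : (inner ℂ (w x) (K.opQ e x (u x))).re ≤
        (inner ℂ (f x) (K.opS e x (g x))).re + CN * CQ * ‖u x‖ ^ 2 := by
      rw [h3, e1]
      linarith
    exact h4
  rw [hnorm] at hest
  have h5 := (abs_le.1 hest).1
  nlinarith [h5, hle]

namespace VertexConditions

/-- The form condition trades the `B_v` term for minus the boundary form of `T_v` plus `lam` times
an energy; the `C_v` term is bounded by the squared norm. -/
theorem exists_vertex_estimate (D : VertexConditions G) (K : EdgeCoefficients G) (v : V)
    (hform : ∃ lam : ℝ, 0 ≤ lam ∧ ∀ ξ : D.Y v, D.formY K lam v ξ ≤ 0) :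
    ∃ om : ℝ, 0 ≤ om ∧ ∀ ξ : D.Y v,
      2 * (inner ℂ (D.B v ξ + D.C v (D.Pd v ξ)) (D.Q v (D.Pd v ξ))).re ≤
        om * ‖D.Pd v ξ‖ ^ 2 - (inner ℂ (ξ : G.VertexVec v) (vertexT K v ξ)).re := by
  obtain ⟨lam, hlam, h⟩ := hform
  obtain ⟨C₁, hC₁, h₁⟩ := exists_re_inner_le (F := D.Yd v) LinearMap.id (D.Q v)
  obtain ⟨C₂, hC₂, h₂⟩ := exists_re_inner_le (F := D.Yd v) (D.C v) (D.Q v)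
  refine ⟨lam * C₁ + 2 * C₂, by positivity, fun ξ => ?_⟩
  have e1 := h ξ
  rw [formY_eq] at e1
  have e2 : (inner ℂ (D.Pd v (ξ : G.VertexVec v)) (D.Q v (D.Pd v ξ))).re ≤
    C₁ * ‖D.Pd v ξ‖ ^ 2 := h₁ _
  have e3 : (inner ℂ (D.C v (D.Pd v (ξ : G.VertexVec v))) (D.Q v (D.Pd v ξ))).re ≤
    C₂ * ‖D.Pd v ξ‖ ^ 2 := h₂ _
  have e4 := mul_le_mul_of_nonneg_left e2 hlam
  rw [inner_add_left, Complex.add_re]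
  linarith

/-- Summed over the edges, the boundary terms are exactly the vertex forms of `T_v`, which enter the
vertex estimates with the opposite sign and cancel. -/
theorem exists_quasiDissipative (D : VertexConditions G) (K : EdgeCoefficients G)
    (hform : ∀ v, ∃ lam : ℝ, 0 ≤ lam ∧ ∀ ξ : D.Y v, D.formY K lam v ξ ≤ 0) :
    ∃ om : ℝ, 0 ≤ om ∧ ∀ U W, D.IsA K U W → D.energy K W U ≤ om * ‖U‖ ^ 2 := by
  choose om hom hedge using K.exists_edge_estimate
  choose om' hom' hvert using fun v => D.exists_vertex_estimate K v (hform v)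
  have hE0 : 0 ≤ ∑ e, om e := Finset.sum_nonneg fun e _ => hom e
  have hV0 : 0 ≤ ∑ v, om' v := Finset.sum_nonneg fun v _ => hom' v
  refine ⟨(∑ e, om e + ∑ v, om' v) / 2, by positivity, fun U W h => ?_⟩
  rw [isA_iff] at h
  obtain ⟨f, g, h1, h2, h3⟩ := h
  have hE := Finset.sum_le_sum fun e (_ : e ∈ Finset.univ) =>
    hedge e (U.fst e) (W.fst e) (g e) (f e) (h1 e).1 (h1 e).2 (h2 e)
  have hV : ∀ v ∈ Finset.univ, 2 * (inner ℂ (W.snd v) (D.Q v (U.snd v))).re ≤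
      om' v * ‖U.snd v‖ ^ 2 - (inner ℂ (G.trace v f) (vertexT K v (G.trace v f))).re :=
    fun v _ => by
      obtain ⟨hU, hY, hW⟩ := h3 v
      rw [hW, hU]
      exact hvert v ⟨G.trace v f, hY⟩
  replace hV := Finset.sum_le_sum hV
  rw [Finset.sum_add_distrib, ← sum_inner_trace_vertexT, ← Finset.mul_sum] at hE
  rw [Finset.sum_sub_distrib, ← Finset.mul_sum] at hV
  have hE' : ∑ e, om e * ‖U.fst e‖ ^ 2 ≤ (∑ e, om e) * ∑ e, ‖U.fst e‖ ^ 2 := by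
    rw [Finset.mul_sum]
    refine Finset.sum_le_sum fun e _ => ?_
    gcongr
    exact Finset.single_le_sum (fun e _ => hom e) (Finset.mem_univ e)
  have hV' : ∑ v, om' v * ‖U.snd v‖ ^ 2 ≤ (∑ v, om' v) * ∑ v, ‖U.snd v‖ ^ 2 := by
    rw [Finset.mul_sum]
    refine Finset.sum_le_sum fun v _ => ?_
    gcongr
    exact Finset.single_le_sum (fun v _ => hom' v) (Finset.mem_univ v)
  have hEn : 0 ≤ ∑ e, ‖U.fst e‖ ^ 2 := Finset.sum_nonneg fun e _ => sq_nonneg _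
  have hVn : 0 ≤ ∑ v, ‖U.snd v‖ ^ 2 := Finset.sum_nonneg fun v _ => sq_nonneg _
  rw [energy, norm_sq_state]
  nlinarith [mul_nonneg hE0 hVn, mul_nonneg hV0 hEn]

end VertexConditions

end Dissipativity

/-! ### The range condition -/

section RangeCondition

variable {V E : Type*} [Fintype V] [Fintype E] [DecidableEq V] [DecidableEq E]
  {G : Network V E}

theorem ContinuousOn.memLp_Ioo {F : Type*} [NormedAddCommGroup F] {l : ℝ} {f : ℝ → F}
    {p : ℝ≥0∞} (hf : ContinuousOn f (Icc 0 l)) : MemLp f p (volume.restrict (Ioo 0 l)) := by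
  obtain ⟨C, hC⟩ := isCompact_Icc.exists_bound_of_continuousOn hf
  refine MemLp.of_bound ((hf.mono Ioo_subset_Icc_self).aestronglyMeasurable measurableSet_Ioo) C ?_
  filter_upwards [ae_restrict_mem measurableSet_Ioo] with x hx
  exact hC x (Ioo_subset_Icc_self hx)

namespace EdgeCoefficients

variable (K : EdgeCoefficients G) (e : E)

/-- The coefficient of the resolvent equation in normal form. -/
noncomputable def resolventCoeff (lam : ℂ) (x : ℝ) : G.EdgeVec e →L[ℂ] G.EdgeVec e :=
  K.opMinv e x * (lam • 1 - K.opN e x)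

theorem exists_bound_resolventCoeff (lam : ℂ) :
    ∃ C, IsBoundedCoeff (G.len e) (K.resolventCoeff e lam) C := by
  obtain ⟨C, hC⟩ := K.exists_bound_opN e
  obtain ⟨C', hC'⟩ := K.exists_bound_opMinv e
  exact ⟨_, hC'.mul (hC.const_sub (lam • 1))⟩

theorem opM_opMinv_apply {x : ℝ} (hx : x ∈ Icc 0 (G.len e)) (ξ : G.EdgeVec e) :
    K.opM e x (K.opMinv e x ξ) = ξ :=
  congrArg (fun T : G.EdgeVec e →L[ℂ] G.EdgeVec e => T ξ) (K.opM_mul_opMinv e hx)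

theorem opM_resolventCoeff (lam : ℂ) {x : ℝ} (hx : x ∈ Icc 0 (G.len e)) (ξ : G.EdgeVec e) :
    K.opM e x (K.resolventCoeff e lam x ξ) = lam • ξ - K.opN e x ξ := by
  have h := K.opM_opMinv_apply e hx ((lam • 1 - K.opN e x) ξ)
  exact h

end EdgeCoefficients

/-- Each edge is counted once at each of its two endpoints, which differ as there are no loops. -/
theorem Network.finrank_vertexVec (G : Network V E) :
    ∑ v, Module.finrank ℂ (G.VertexVec v) = 2 * ∑ e, G.k e := by
  have h : ∀ v, Module.finrank ℂ (G.VertexVec v) = ∑ e : G.EdgesAt v, G.k e := fun v => by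
    rw [finrank_euclideanSpace, Fintype.card_sigma]
    simp
  rw [Finset.sum_congr rfl fun v _ => h v, G.sum_edgesAt fun _ e => G.k e, Finset.mul_sum]
  exact Finset.sum_congr rfl fun e _ => (two_mul _).symm

namespace VertexConditions

/-- The boundary operator of the resolvent equation. -/
noncomputable def boundaryOp (D : VertexConditions G) (lam : ℂ) (v : V) :
    G.VertexVec v →ₗ[ℂ] (D.Y v)ᗮ × D.Yd v :=
  LinearMap.prod ((D.Y v)ᗮ.orthogonalProjectionOnto : G.VertexVec v →ₗ[ℂ] (D.Y v)ᗮ)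
    ((lam • LinearMap.id - D.C v) ∘ₗ
      ((D.Yd v).orthogonalProjectionOnto : G.VertexVec v →ₗ[ℂ] D.Yd v) -
      D.B v ∘ₗ ((D.Y v).orthogonalProjectionOnto : G.VertexVec v →ₗ[ℂ] D.Y v))

/-- Vanishing of the first component puts `ξ` into `Y_v`, where the projection that extends `B_v` to
all of `ℂ^{k_v}` acts as the identity. -/
theorem boundaryOp_eq (D : VertexConditions G) (lam : ℂ) (v : V) {ξ : G.VertexVec v}
    {y : D.Yd v} (h : D.boundaryOp lam v ξ = (0, y)) :
    ∃ hξ : ξ ∈ D.Y v, D.B v ⟨ξ, hξ⟩ + D.C v (D.Pd v ξ) = lam • D.Pd v ξ - y := by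
  have h1 : (D.Y v)ᗮ.orthogonalProjectionOnto ξ = 0 := congrArg Prod.fst h
  rw [Submodule.orthogonalProjectionOnto_eq_zero_iff, Submodule.orthogonal_orthogonal] at h1
  have h2 : lam • D.Pd v ξ - D.C v (D.Pd v ξ) - D.B v ((D.Y v).orthogonalProjectionOnto ξ) = y :=
    congrArg Prod.snd h
  have h3 : (D.Y v).orthogonalProjectionOnto ξ = ⟨ξ, h1⟩ :=
    Subtype.ext (Submodule.starProjection_eq_self_iff.2 h1)
  refine ⟨h1, ?_⟩
  rw [← h2, h3]
  abel

/-- A solution of the resolvent equation on the edges and in the vertices gives an element of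
the domain. -/
theorem exists_isA_of_solution (D : VertexConditions G) (K : EdgeCoefficients G) (lam : ℂ)
    (Y : D.State) (f : ∀ e, ℝ → G.EdgeVec e)
    (hf : ∀ e, IsPrimitive (G.len e) (f e) fun x =>
      K.resolventCoeff e lam x (f e x) - K.opMinv e x (Y.fst e x))
    (hv : ∀ v, D.boundaryOp lam v (G.trace v f) = (0, Y.snd v)) :
    ∃ U : D.State, (∀ e, U.fst e =ᵐ[volume.restrict (Ioo 0 (G.len e))] f e) ∧
      D.IsA K U (lam • U - Y) := by
  have hcont : ∀ e, ContinuousOn (f e) (Icc 0 (G.len e)) := fun e =>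
    (hf e).continuousOn (G.len_pos e).le
  have hfL : ∀ e, MemLp (f e) 2 (volume.restrict (Ioo 0 (G.len e))) := fun e =>
    (hcont e).memLp_Ioo
  have hgL : ∀ e, MemLp (fun x => K.resolventCoeff e lam x (f e x) - K.opMinv e x (Y.fst e x)) 2
      (volume.restrict (Ioo 0 (G.len e))) := fun e => by
    obtain ⟨C, hC⟩ := K.exists_bound_resolventCoeff e lam
    obtain ⟨C', hC'⟩ := K.exists_bound_opMinv e
    exact (hC.memLp_apply (hfL e)).sub (hC'.memLp_apply (Lp.memLp _))
  let U : D.State := WithLp.toLp 2 (WithLp.toLp 2 fun e => (hfL e).toLp (f e),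
    WithLp.toLp 2 fun v => D.Pd v (G.trace v f))
  have hU : ∀ e, U.fst e =ᵐ[volume.restrict (Ioo 0 (G.len e))] f e := fun e =>
    (hfL e).coeFn_toLp
  refine ⟨U, hU, (D.isA_iff K _ _).2 ⟨f, fun e => (hgL e).toLp _, fun e => ⟨hU e, ?_⟩,
    fun e => ?_, fun v => ⟨rfl, ?_⟩⟩⟩
  · exact (hf e).congr_ae (G.len_pos e).le (hgL e).coeFn_toLp.symm
  · rw [WithLp.sub_fst, PiLp.sub_apply, WithLp.smul_fst, PiLp.smul_apply]
    filter_upwards [Lp.coeFn_sub (lam • U.fst e) (Y.fst e), Lp.coeFn_smul lam (U.fst e), hU e,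
      (hgL e).coeFn_toLp, ae_restrict_mem measurableSet_Ioo] with x e1 e2 e3 e4 hx
    -- Applying `M` to the normal form `u' = M⁻¹((lam - N) u - Y)` gives `M u' + N u = lam u - Y`.
    have hx' := Ioo_subset_Icc_self hx
    rw [e1, Pi.sub_apply, e2, Pi.smul_apply, e3, e4, map_sub, K.opM_resolventCoeff e lam hx',
      K.opM_opMinv_apply e hx']
    abel
  · obtain ⟨h, e1⟩ := D.boundaryOp_eq lam v (hv v)
    exact ⟨h, e1.symm⟩

/-- Solutions on the edges are a particular one plus the flow of an initial vector in `ℂ^k`, so the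
problem becomes a finite linear system for that vector. Injectivity of the system gives one
inequality of dimensions and `hcount` the other, hence it is surjective. -/
theorem exists_isA_of_injective (D : VertexConditions G) (K : EdgeCoefficients G) (lam : ℂ)
    (hcount : ∑ v, (Module.finrank ℂ (D.Y v)ᗮ + Module.finrank ℂ (D.Yd v)) ≤ ∑ e, G.k e)
    (hinj : ∀ U, D.IsA K U (lam • U) → U = 0) (Y : D.State) :
    ∃ U, D.IsA K U (lam • U - Y) := by
  choose C hC using fun e => K.exists_bound_resolventCoeff e lam
  choose Φ hΦc hΦ0 hΦ using fun e => exists_linear_flow (G.len_pos e) (hC e)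
  have hb : ∀ e, Integrable (fun x => -K.opMinv e x (Y.fst e x))
      (volume.restrict (Ioo 0 (G.len e))) := fun e => by
    obtain ⟨C', hC'⟩ := K.exists_bound_opMinv e
    exact (hC'.integrable_apply ((Lp.memLp (Y.fst e)).integrable one_le_two)).neg
  choose f₀ hf₀c hf₀0 hf₀ using fun e =>
    exists_inhomogeneous_solution (G.len_pos e) (hC e) (hb e)
  let Γ : (∀ e, G.EdgeVec e) →ₗ[ℂ] ∀ v, (D.Y v)ᗮ × D.Yd v :=
    LinearMap.pi fun v => D.boundaryOp lam v ∘ₗ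
      { toFun := fun c => G.trace v fun e => Φ e (c e)
        map_add' := fun c c' => by
          simp only [Pi.add_apply, map_add]
          rfl
        map_smul' := fun a c => by
          simp only [Pi.smul_apply, map_smul]
          rfl }
  have hΓinj : Function.Injective Γ := by
    rw [injective_iff_map_eq_zero]
    intro c hc
    obtain ⟨U, hU, hA⟩ := D.exists_isA_of_solution K lam 0 (fun e => Φ e (c e)) (fun e => by
      refine (hΦ e (c e)).congr_ae (G.len_pos e).le ?_
      filter_upwards [Lp.coeFn_zero (G.EdgeVec e) 2 (volume.restrict (Ioo 0 (G.len e)))] with x hx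
      rw [WithLp.zero_fst, PiLp.zero_apply, hx, Pi.zero_apply, map_zero, sub_zero])
      fun v => congrFun hc v
    rw [sub_zero] at hA
    have hU0 := hinj U hA
    ext1 e
    rw [← hΦ0 e (c e)]
    refine (hΦ e (c e)).eq_zero_of_ae_zero (G.len_pos e) ((hU e).symm.trans ?_)
      ⟨le_rfl, (G.len_pos e).le⟩
    rw [hU0]
    exact Lp.coeFn_zero _ _ _
  have hdom : Module.finrank ℂ (∀ e, G.EdgeVec e) = ∑ e, G.k e := by
    rw [Module.finrank_pi_fintype]
    exact Finset.sum_congr rfl fun e _ => by simp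
  have hcod : Module.finrank ℂ (∀ v, (D.Y v)ᗮ × D.Yd v) =
      ∑ v, (Module.finrank ℂ (D.Y v)ᗮ + Module.finrank ℂ (D.Yd v)) := by
    rw [Module.finrank_pi_fintype]
    exact Finset.sum_congr rfl fun v _ => Module.finrank_prod
  have hle := LinearMap.finrank_le_finrank_of_injective hΓinj
  have hsurj : Function.Surjective Γ :=
    (LinearMap.injective_iff_surjective_of_finrank_eq_finrank
      (le_antisymm hle (by rw [hdom, hcod]; exact hcount))).1 hΓinj
  obtain ⟨c, hc⟩ := hsurj fun v => (0, Y.snd v) - D.boundaryOp lam v (G.trace v f₀)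
  obtain ⟨U, -, hU⟩ := D.exists_isA_of_solution K lam Y (fun e => Φ e (c e) + f₀ e)
    (fun e => by
      have h := (hΦ e (c e)).add (hf₀ e)
      refine h.congr_ae (G.len_pos e).le (Eventually.of_forall fun x => ?_)
      simp only [Pi.add_apply, map_add]
      abel)
    fun v => by
      have h1 : D.boundaryOp lam v (G.trace v fun e => Φ e (c e)) =
        (0, Y.snd v) - D.boundaryOp lam v (G.trace v f₀) := congrFun hc v
      rw [trace_add, map_add, h1, sub_add_cancel]
  exact ⟨U, hU⟩

end VertexConditions

end RangeCondition

/-! ### Dimension counts and generation -/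

theorem IsEquivInner.eq_zero_of_lt {H : Type*} [NormedAddCommGroup H] [NormedSpace ℂ H]
    {B : H →L[ℝ] H →L[ℝ] ℝ} {c om lam : ℝ} (hB : IsEquivInner B c) (hlam : om < lam) {U : H}
    (h : B ((lam : ℂ) • U) U ≤ om * B U U) : U = 0 := by
  rw [Complex.coe_smul, map_smul, _root_.smul_apply, smul_eq_mul] at h
  have h2 : B U U ≤ 0 := by
    by_contra! h3
    exact absurd (le_of_mul_le_mul_right h h3) (not_le.2 hlam)
  exact hB.eq_zero h2

section Generation

variable {V E : Type*} [Fintype V] [Fintype E] [DecidableEq V] [DecidableEq E]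
  {G : Network V E}

attribute [local instance] innerOfInnerProductSpace

/-- The kernel of the adjoint is the orthogonal complement of the range. -/
theorem LinearMap.finrank_range_add_finrank_ker_adjoint {F F' : Type*} [NormedAddCommGroup F]
    [InnerProductSpace ℂ F] [FiniteDimensional ℂ F] [NormedAddCommGroup F']
    [InnerProductSpace ℂ F'] [FiniteDimensional ℂ F'] (B : F →ₗ[ℂ] F') :
    Module.finrank ℂ (LinearMap.range B) + Module.finrank ℂ (LinearMap.ker (LinearMap.adjoint B)) =
      Module.finrank ℂ F' := by
  have h : LinearMap.ker (LinearMap.adjoint B) = (LinearMap.range B)ᗮ := by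
    ext y
    rw [LinearMap.mem_ker, Submodule.mem_orthogonal]
    constructor
    · rintro hy _ ⟨x, rfl⟩
      rw [← LinearMap.adjoint_inner_right, hy, inner_zero_right]
    · intro hy
      refine ext_inner_left ℂ fun x => ?_
      rw [LinearMap.adjoint_inner_right, inner_zero_right]
      exact hy _ ⟨x, rfl⟩
  rw [h, Submodule.finrank_add_finrank_orthogonal]

namespace VertexConditions

/-- At each vertex the family has `dim Y_v^⊥ + dim Ran B_v + dim Ker B_v^*` members, the last two
adding up to `dim Y_v^{(d)}`; linear independence in `ℂ^k` bounds the total. -/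
theorem BasisCondition.finrank_le {D : VertexConditions G} (h : D.BasisCondition) :
    ∑ v, (Module.finrank ℂ (D.Y v)ᗮ + Module.finrank ℂ (D.Yd v)) ≤ ∑ e, G.k e := by
  obtain ⟨w, y, z, hli, -⟩ := h
  have h1 := hli.fintype_card_le_finrank
  rw [finrank_euclideanSpace, Fintype.card_sigma, Fintype.card_sigma] at h1
  simp only [Fintype.card_sum, Fintype.card_fin] at h1
  refine le_trans (le_of_eq (Finset.sum_congr rfl fun v _ => ?_)) h1
  have h2 := LinearMap.finrank_range_add_finrank_ker_adjoint (F := D.Y v) (F' := D.Yd v) (D.B v)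
  congr 1
  exact h2.symm

theorem formYstar_zero_right (D : VertexConditions G) (K : EdgeCoefficients G) (mu : ℝ) (v : V)
    (ξ : G.VertexVec v) :
    D.formYstar K 0 mu v ξ 0 = -(inner ℂ ξ (vertexT K v ξ)).re := by
  have h : D.formYstar K 0 mu v ξ 0 = (inner ℂ ξ (-(vertexT K v ξ) - (2 * (0 : ℝ) : ℂ) • ξ +
      vertexT K v ((0 : D.Yd v) : G.VertexVec v))).re
    + (inner ℂ (0 : D.Yd v) (D.Pd v (vertexT K v ξ)
      + (D.Pd v (D.Bstar v (D.Q v 0) : G.VertexVec v) - (mu : ℂ) • D.Q v 0)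
      + D.Q v (D.B v (D.incl v 0) - (mu : ℂ) • 0))).re := rfl
  rw [h, inner_zero_left, Complex.zero_re, add_zero, Complex.ofReal_zero, mul_zero, zero_smul,
    sub_zero, Submodule.coe_zero, map_zero, add_zero, inner_neg_right, Complex.neg_re]

/-- A decaying flow on an edge whose boundary form controls its norm. -/
theorem exists_decaying_flow (K : EdgeCoefficients G) (e : E) :
    ∃ Φ : G.EdgeVec e →ₗ[ℂ] (ℝ → G.EdgeVec e), (∀ c, Continuous (Φ c)) ∧ (∀ c, Φ c 0 = c) ∧
      ∀ c, (inner ℂ (Φ c (G.len e)) (K.opS e (G.len e) (Φ c (G.len e)))).re -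
        (inner ℂ (Φ c 0) (K.opS e 0 (Φ c 0))).re ≤ -∫ x in Ioo 0 (G.len e), ‖Φ c x‖ ^ 2 := by
  obtain ⟨L, hL⟩ := K.exists_lipschitz_opS e
  obtain ⟨C, hC⟩ := K.exists_bound_opMinv e
  obtain ⟨q, hq, hQ⟩ := K.Q_posDef e
  -- For the flow `u' = -mu M⁻¹ u` one has `Q M u' = -mu Q u`, so the main term is at most `-2 mu q
  -- ∫ ‖u‖² = -(L + 1) ∫ ‖u‖²`. The Lipschitz error `L ∫ ‖u‖²` then leaves `-∫ ‖u‖²`.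
  set mu : ℝ := (L + 1) / (2 * q) with hmu
  have hmu0 : 0 ≤ mu := by positivity
  have ha : IsBoundedCoeff (G.len e) (fun x => (-mu : ℂ) • K.opMinv e x) (mu * C) := by
    refine ⟨mul_nonneg hmu0 hC.nonneg, AEStronglyMeasurable.const_smul hC.meas (-mu : ℂ), ?_⟩
    filter_upwards [hC.bound] with x hx
    rw [norm_smul, norm_neg, Complex.norm_real, Real.norm_of_nonneg hmu0]
    gcongr
  obtain ⟨Φ, h1, h2, h3⟩ := exists_linear_flow (G.len_pos e) ha
  refine ⟨Φ, h1, h2, fun c => ?_⟩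
  have hest := (h3 c).energy_estimate (G.len_pos e) hL fun x hx => K.inner_opS e hx
  have hn : Integrable (fun x => ‖Φ c x‖ ^ 2) (volume.restrict (Ioo 0 (G.len e))) :=
    (h1 c).continuousOn.memLp_Ioo.integrable_norm_pow two_ne_zero
  have hptw : ∀ x ∈ Icc 0 (G.len e),
      (inner ℂ (Φ c x) (K.opS e x (((-mu : ℂ) • K.opMinv e x) (Φ c x)))).re =
      -mu * (inner ℂ (Φ c x) (K.opQ e x (Φ c x))).re := fun x hx => by
    have e1 : K.opS e x (((-mu : ℂ) • K.opMinv e x) (Φ c x)) =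
        ((-mu : ℝ) : ℂ) • K.opQ e x (Φ c x) := by
      have e2 : K.opS e x (K.opMinv e x (Φ c x)) = K.opQ e x (Φ c x) :=
        congrArg (K.opQ e x) (K.opM_opMinv_apply e hx (Φ c x))
      rw [← e2, ← map_smul, Complex.ofReal_neg]
      rfl
    rw [e1, re_inner_real_smul_right]
  have hint : Integrable (fun x =>
      (inner ℂ (Φ c x) (K.opS e x (((-mu : ℂ) • K.opMinv e x) (Φ c x)))).re)
      (volume.restrict (Ioo 0 (G.len e))) := by
    have h4 : Integrable (fun x => -mu * (inner ℂ (Φ c x) (K.opQ e x (Φ c x))).re)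
        (volume.restrict (Ioo 0 (G.len e))) := by
      obtain ⟨LQ, hLQ⟩ := K.exists_lipschitz_opQ e
      refine (continuousOn_integrable ?_).const_mul _
      refine Complex.continuous_re.comp_continuousOn ?_
      exact (h1 c).continuousOn.inner (hLQ.continuousOn.clm_apply (h1 c).continuousOn)
    refine h4.congr ?_
    filter_upwards [ae_restrict_mem measurableSet_Ioo] with x hx
    exact (hptw x (Ioo_subset_Icc_self hx)).symm
  have hle : ∫ x in Ioo 0 (G.len e),
      (inner ℂ (Φ c x) (K.opS e x (((-mu : ℂ) • K.opMinv e x) (Φ c x)))).re ≤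
      -((L + 1) / 2) * ∫ x in Ioo 0 (G.len e), ‖Φ c x‖ ^ 2 := by
    rw [← integral_const_mul]
    refine integral_mono_ae hint (hn.const_mul _) ?_
    filter_upwards [ae_restrict_mem measurableSet_Ioo] with x hx
    have hx' := Ioo_subset_Icc_self hx
    have h5 : q * ‖Φ c x‖ ^ 2 ≤ (inner ℂ (Φ c x) (K.opQ e x (Φ c x))).re := hQ x hx' (Φ c x)
    have h6 := mul_le_mul_of_nonneg_left h5 hmu0
    have h7 : mu * (q * ‖Φ c x‖ ^ 2) = (L + 1) / 2 * ‖Φ c x‖ ^ 2 := by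
      rw [hmu]
      field_simp
    have h8 := hptw x hx'
    rw [h7] at h6
    rw [h8]
    linarith
  have h9 := (abs_le.1 hest).2
  linarith

/-- Send an initial vector in `ℂ^k` to the projections of `T_v γ_v` onto `Z_v = Y_v ⊖ Y_v^{(d)}`,
where `γ_v` is the trace of its decaying flow. On the kernel, `(γ_v, 0)` lies in `𝕐_v^*`, so all
boundary forms are nonnegative. Their sum is at most minus the squared norm of the flow, which
therefore vanishes, and `k ≤ ∑ dim Z_v`. -/
theorem WellPosedHyp₂'.finrank_le {D : VertexConditions G} {K : EdgeCoefficients G}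
    (h : D.WellPosedHyp₂' K) :
    ∑ v, (Module.finrank ℂ (D.Y v)ᗮ + Module.finrank ℂ (D.Yd v)) ≤ ∑ e, G.k e := by
  choose Φ hΦc hΦ0 hΦ using fun e => exists_decaying_flow K e
  let Z : ∀ v, Submodule ℂ (G.VertexVec v) := fun v => D.Y v ⊓ (D.Yd v)ᗮ
  let Γ : (∀ e, G.EdgeVec e) →ₗ[ℂ] ∀ v, Z v :=
    LinearMap.pi fun v => ((Z v).orthogonalProjectionOnto : G.VertexVec v →ₗ[ℂ] Z v) ∘ₗ
      vertexT K v ∘ₗ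
      { toFun := fun c => G.trace v fun e => Φ e (c e)
        map_add' := fun c c' => by
          simp only [Pi.add_apply, map_add]
          rfl
        map_smul' := fun a c => by
          simp only [Pi.smul_apply, map_smul]
          rfl }
  have hΓinj : Function.Injective Γ := by
    rw [injective_iff_map_eq_zero]
    intro c hc
    have hv : ∀ v, 0 ≤ (inner ℂ (G.trace v fun e => Φ e (c e))
        (vertexT K v (G.trace v fun e => Φ e (c e)))).re := fun v => by
      obtain ⟨mu, -, hmu⟩ := (h v).2
      have h1 : D.PdPerp v (vertexT K v (G.trace v fun e => Φ e (c e))) = 0 :=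
        congrArg Subtype.val (congrFun hc v)
      have h2 : D.YstarMem K v (G.trace v fun e => Φ e (c e)) 0 := by
        rw [YstarMem, h1, map_zero, map_zero, zero_add, Submodule.coe_zero]
        exact map_zero (D.Y v ⊓ (D.Yd v)ᗮ).starProjection
      have h3 := hmu _ _ h2
      rw [formYstar_zero_right] at h3
      linarith
    have hsum := Finset.sum_nonneg fun v (_ : v ∈ Finset.univ) => hv v
    rw [sum_inner_trace_vertexT K fun e => Φ e (c e)] at hsum
    have hle := Finset.sum_le_sum fun e (_ : e ∈ Finset.univ) => hΦ e (c e)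
    have hnn : ∀ e, 0 ≤ ∫ x in Ioo 0 (G.len e), ‖Φ e (c e) x‖ ^ 2 := fun e =>
      integral_nonneg fun x => sq_nonneg _
    rw [Finset.sum_neg_distrib] at hle
    have hzero : ∑ e, ∫ x in Ioo 0 (G.len e), ‖Φ e (c e) x‖ ^ 2 = 0 :=
      le_antisymm (by linarith) (Finset.sum_nonneg fun e _ => hnn e)
    ext1 e
    have h0 := (Finset.sum_eq_zero_iff_of_nonneg fun e _ => hnn e).1 hzero e (Finset.mem_univ e)
    have hint : Integrable (fun x => ‖Φ e (c e) x‖ ^ 2) (volume.restrict (Ioo 0 (G.len e))) :=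
      (hΦc e (c e)).continuousOn.memLp_Ioo.integrable_norm_pow two_ne_zero
    rw [integral_eq_zero_iff_of_nonneg (fun x => sq_nonneg _) hint] at h0
    have h1 : Φ e (c e) =ᵐ[volume.restrict (Ioo 0 (G.len e))] 0 := by
      filter_upwards [h0] with x hx
      simpa using hx
    rw [restrict_Ioo_eq_restrict_Icc] at h1
    have h2 := Measure.eqOn_Icc_of_ae_eq volume (G.len_pos e).ne h1
      (hΦc e (c e)).continuousOn continuousOn_const
    rw [← hΦ0 e (c e)]
    exact h2 ⟨le_rfl, (G.len_pos e).le⟩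
  have hle := LinearMap.finrank_le_finrank_of_injective hΓinj
  rw [Module.finrank_pi_fintype, Module.finrank_pi_fintype] at hle
  have hk : ∑ e, Module.finrank ℂ (G.EdgeVec e) = ∑ e, G.k e :=
    Finset.sum_congr rfl fun e _ => by simp
  -- `ℂ^{k_v}` splits into `Y_v^⊥`, `Y_v^{(d)}` and `Z v`. The total dimension being `2k`, the bound
  -- `∑ dim Z v ≥ k` leaves at most `k` for the first two.
  have hZ : ∀ v, Module.finrank ℂ (D.Y v)ᗮ + Module.finrank ℂ (D.Yd v) +
      Module.finrank ℂ (Z v) = Module.finrank ℂ (G.VertexVec v) := fun v => by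
    have h1 := Submodule.finrank_add_inf_finrank_orthogonal (D.Yd_le v)
    have h2 := Submodule.finrank_add_finrank_orthogonal (D.Y v)
    rw [inf_comm] at h1
    change _ + Module.finrank ℂ (D.Y v ⊓ (D.Yd v)ᗮ : Submodule ℂ (G.VertexVec v)) = _
    omega
  have hsum := Finset.sum_congr rfl fun v (_ : v ∈ Finset.univ) => hZ v
  rw [Finset.sum_add_distrib, G.finrank_vertexVec] at hsum
  omega

theorem existsUnique_semigroup (D : VertexConditions G) (K : EdgeCoefficients G)
    (hform : ∀ v, ∃ lam : ℝ, 0 ≤ lam ∧ ∀ ξ : D.Y v, D.formY K lam v ξ ≤ 0)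
    (hcount : ∑ v, (Module.finrank ℂ (D.Y v)ᗮ + Module.finrank ℂ (D.Yd v)) ≤ ∑ e, G.k e) :
    ∃! S : ℝ≥0 → D.State →L[ℂ] D.State, IsSemigroupGeneratedBy S (D.IsA K) := by
  obtain ⟨om, hom, hdiss⟩ := D.exists_quasiDissipative K hform
  obtain ⟨c, B, hBeq, hB⟩ := D.exists_energy_inner K
  -- The extra factor `c` converts the squared norm into the energy.
  have hdiss' : ∀ {U W}, D.IsA K U W → B W U ≤ om * c * B U U := fun {U W} h => by
    rw [hBeq W U, mul_assoc]
    exact (hdiss U W h).trans (by gcongr; exact hB.lower U)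
  obtain ⟨S, hS⟩ := exists_semigroup_of_quasiDissipative (A := D.IsA K) hB (om * c)
    (fun h h' => h.add h') (fun a {_ _} h => h.smul a) (fun h => h.eq_zero) hdiss'
    (fun lam hlam Y => by
      have hinj : ∀ U, D.IsA K U ((lam : ℂ) • U) → U = 0 := fun U hU =>
        hB.eq_zero_of_lt hlam (hdiss' hU)
      obtain ⟨U, hU⟩ := D.exists_isA_of_injective K lam hcount hinj Y
      refine ⟨U, ?_⟩
      convert hU using 2
      exact (Complex.coe_smul lam U).symm)
  exact ⟨S, hS, fun T hT => hT.unique hS⟩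

end VertexConditions

end Generation

/-! ### Complex conjugation and real semigroups -/

/-- A semigroup commutes with every conjugation that leaves the graph of its generator invariant. -/
theorem IsSemigroupGeneratedBy.apply_conj {H : Type*} [NormedAddCommGroup H] [NormedSpace ℂ H]
    [CompleteSpace H] {S : ℝ≥0 → H →L[ℂ] H} {A : H → H → Prop} (hS : IsSemigroupGeneratedBy S A)
    (J : H →SL[starRingEnd ℂ] H) (hJ : ∀ U, J (J U) = U) (hA : ∀ {U W}, A U W → A (J U) (J W))
    (t : ℝ≥0) (U : H) : S t (J U) = J (S t U) := by
  -- Conjugating twice keeps `T t` complex linear. The factors `t⁻¹` are real, so `J` passes through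
  -- difference quotients, and `T` has the same generator as `S`.
  let T : ℝ≥0 → H →L[ℂ] H := fun t => J.comp ((S t).comp J)
  have hT : ∀ t U, T t U = J (S t (J U)) := fun _ _ => rfl
  have hTgen : IsSemigroupGeneratedBy T A := by
    refine ⟨⟨?_, fun s t => ?_, fun U => ?_⟩, fun U W => ?_⟩
    · ext U
      rw [hT, hS.1.zero, ContinuousLinearMap.id_apply, hJ, ContinuousLinearMap.id_apply]
    · ext U
      rw [hT, hS.1.add, ContinuousLinearMap.comp_apply, ContinuousLinearMap.comp_apply, hT, hT, hJ]
    · have h := (J.continuous.tendsto _).comp (hS.1.continuous_at_zero (J U))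
      rw [hJ] at h
      exact h
    · have hdiff : ∀ (t : ℝ≥0) (U : H), J (((t : ℝ) : ℂ)⁻¹ • (S t U - U)) =
          ((t : ℝ) : ℂ)⁻¹ • (J (S t U) - J U) := fun t U => by
        rw [map_smulₛₗ, map_sub, map_inv₀, Complex.conj_ofReal]
      constructor
      · intro h
        have h1 := (J.continuous.tendsto _).comp ((hS.2 _ _).1 (hA h))
        rw [hJ] at h1
        refine h1.congr fun t => ?_
        rw [Function.comp_apply, hdiff, hJ, hT]
      · intro h
        have h1 := (J.continuous.tendsto _).comp h
        have h2 : A (J U) (J W) := by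
          refine (hS.2 _ _).2 (h1.congr fun t => ?_)
          rw [Function.comp_apply, map_smulₛₗ, map_sub, map_inv₀, Complex.conj_ofReal, hT, hJ]
        have h3 := hA h2
        rwa [hJ, hJ] at h3
  have h := congrArg (fun R : ℝ≥0 → H →L[ℂ] H => R t U) (hTgen.unique hS)
  change J (S t (J U)) = S t U at h
  rw [← h, hJ]

/-! ### Entrywise conjugation of vectors, real subspaces and real operators. -/

section ConjVec

variable {ι : Type*}

/-- Entrywise complex conjugation. -/
noncomputable def conjVec (x : EuclideanSpace ℂ ι) : EuclideanSpace ℂ ι :=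
  WithLp.toLp 2 fun i => starRingEnd ℂ (x i)

@[simp] theorem conjVec_apply (x : EuclideanSpace ℂ ι) (i : ι) :
    conjVec x i = starRingEnd ℂ (x i) := rfl

theorem conjVec_add (x y : EuclideanSpace ℂ ι) : conjVec (x + y) = conjVec x + conjVec y := by
  ext i
  simp

theorem conjVec_sub (x y : EuclideanSpace ℂ ι) : conjVec (x - y) = conjVec x - conjVec y := by
  ext i
  simp

theorem conjVec_smul (a : ℂ) (x : EuclideanSpace ℂ ι) :
    conjVec (a • x) = starRingEnd ℂ a • conjVec x := by
  ext i
  simp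

theorem conjVec_conjVec (x : EuclideanSpace ℂ ι) : conjVec (conjVec x) = x := by
  ext i
  simp

theorem conjVec_eq_iff (x : EuclideanSpace ℂ ι) : conjVec x = x ↔ IsRealVec x := by
  constructor
  · intro h i
    exact Complex.conj_eq_iff_im.1 (congrArg (fun y : EuclideanSpace ℂ ι => y i) h)
  · intro h
    ext i
    exact Complex.conj_eq_iff_im.2 (h i)

theorem isRealVec_reVec (x : EuclideanSpace ℂ ι) : IsRealVec (reVec x) := fun _ =>
  Complex.ofReal_im _

/-- The imaginary part is the real part of `-i x`, so a complex subspace that is invariant under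
real parts contains both parts of its elements. -/
theorem eq_reVec_add (x : EuclideanSpace ℂ ι) :
    x = reVec x + Complex.I • reVec (-Complex.I • x) := by
  ext i
  simp only [reVec, PiLp.add_apply, PiLp.smul_apply, smul_eq_mul]
  apply Complex.ext <;> simp

theorem conjVec_eq_reVec_sub (x : EuclideanSpace ℂ ι) :
    conjVec x = reVec x - Complex.I • reVec (-Complex.I • x) := by
  ext i
  simp only [reVec, PiLp.sub_apply, PiLp.smul_apply, smul_eq_mul, conjVec_apply]
  apply Complex.ext <;> simp

variable {Y Z : Submodule ℂ (EuclideanSpace ℂ ι)}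

theorem conjVec_mem (hY : ∀ ξ ∈ Y, reVec ξ ∈ Y) {ξ : EuclideanSpace ℂ ι} (h : ξ ∈ Y) :
    conjVec ξ ∈ Y := by
  rw [conjVec_eq_reVec_sub]
  exact Y.sub_mem (hY _ h) (Y.smul_mem _ (hY _ (Y.smul_mem _ h)))

/-- A real operator commutes with the conjugation. -/
theorem IsRealOp.apply_conjVec {f : Y →ₗ[ℂ] Z} (hf : IsRealOp f) (hY : ∀ ξ ∈ Y, reVec ξ ∈ Y)
    {ξ : EuclideanSpace ℂ ι} (h : ξ ∈ Y) (h' : conjVec ξ ∈ Y) :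
    (f ⟨conjVec ξ, h'⟩ : EuclideanSpace ℂ ι) = conjVec (f ⟨ξ, h⟩) := by
  let a : Y := ⟨reVec ξ, hY _ h⟩
  let b : Y := ⟨reVec (-Complex.I • ξ), hY _ (Y.smul_mem _ h)⟩
  have e1 : (⟨ξ, h⟩ : Y) = a + Complex.I • b := Subtype.ext (eq_reVec_add ξ)
  have e2 : (⟨conjVec ξ, h'⟩ : Y) = a - Complex.I • b := Subtype.ext (conjVec_eq_reVec_sub ξ)
  have ha := (conjVec_eq_iff _).2 (hf a (isRealVec_reVec _))
  have hb := (conjVec_eq_iff _).2 (hf b (isRealVec_reVec _))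
  rw [e1, e2, map_add, map_sub, map_smul, Submodule.coe_add, Submodule.coe_sub,
    Submodule.coe_smul, conjVec_add, conjVec_smul, ha, hb, Complex.conj_I, neg_smul, sub_eq_add_neg]

variable [Fintype ι]

theorem norm_conjVec (x : EuclideanSpace ℂ ι) : ‖conjVec x‖ = ‖x‖ := by
  simp [EuclideanSpace.norm_eq]

theorem lipschitzWith_conjVec :
    LipschitzWith 1 (conjVec : EuclideanSpace ℂ ι → EuclideanSpace ℂ ι) :=
  LipschitzWith.of_dist_le_mul fun x y => by
    rw [dist_eq_norm, dist_eq_norm, ← conjVec_sub, norm_conjVec, NNReal.coe_one, one_mul]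

/-- Entrywise complex conjugation as a real-linear operator. -/
noncomputable def conjCLM : EuclideanSpace ℂ ι →L[ℝ] EuclideanSpace ℂ ι where
  toFun := conjVec
  map_add' := conjVec_add
  map_smul' r x := by
    ext i
    simp
  cont := lipschitzWith_conjVec.continuous

/-- The conjugated projection lies in `Y`, and the conjugated remainder is orthogonal to `Y`: its
pairing with `y` is conjugate to that of the remainder with `conjVec y`. -/
theorem starProjection_conjVec (hY : ∀ ξ ∈ Y, reVec ξ ∈ Y) (ξ : EuclideanSpace ℂ ι) :
    Y.starProjection (conjVec ξ) = conjVec (Y.starProjection ξ) := by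
  refine (Submodule.eq_starProjection_of_mem_of_inner_eq_zero
    (conjVec_mem hY (Submodule.starProjection_apply_mem Y ξ)) fun y hy => ?_)
  have h := Submodule.starProjection_inner_eq_zero (K := Y) ξ (conjVec y) (conjVec_mem hY hy)
  rw [← conjVec_sub]
  rw [PiLp.inner_apply] at h ⊢
  have h2 := congrArg (starRingEnd ℂ) h
  rw [map_sum, map_zero] at h2
  rw [← h2]
  refine Finset.sum_congr rfl fun i _ => ?_
  simp

theorem matOp_conjVec {n : ℕ} {A : Matrix (Fin n) (Fin n) ℂ} (hA : IsRealMatrix A)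
    (ξ : EuclideanSpace ℂ (Fin n)) : matOp A (conjVec ξ) = conjVec (matOp A ξ) := by
  ext i
  simp only [conjVec_apply, matOp, Matrix.ofLp_toEuclideanCLM, Matrix.mulVec, dotProduct, map_sum,
    map_mul]
  refine Finset.sum_congr rfl fun j _ => ?_
  rw [Complex.conj_eq_iff_im.2 (hA i j)]

end ConjVec

/-! ### Conjugation on the state space and invariance of the graph of `𝔸`. -/

section RealSemigroup

variable {V E : Type*} [Fintype V] [Fintype E] [DecidableEq V] [DecidableEq E]
  {G : Network V E}

/-- Complex conjugation in `L²`. -/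
noncomputable def Network.conjL2 (G : Network V E) (e : E) (u : G.EdgeL2 e) : G.EdgeL2 e :=
  lipschitzWith_conjVec.compLp (by ext; simp) u

theorem Network.coeFn_conjL2 (G : Network V E) (e : E) (u : G.EdgeL2 e) :
    G.conjL2 e u =ᵐ[volume.restrict (Ioo 0 (G.len e))] fun x => conjVec (u x) :=
  LipschitzWith.coeFn_compLp _ _ _

theorem Network.norm_conjL2_le (G : Network V E) (e : E) (u : G.EdgeL2 e) :
    ‖G.conjL2 e u‖ ≤ ‖u‖ :=
  (LipschitzWith.norm_compLp_le _ _ _).trans_eq (by rw [NNReal.coe_one, one_mul])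

namespace VertexConditions

theorem ext_state (D : VertexConditions G) {U W : D.State} (hf : ∀ e, U.fst e = W.fst e)
    (hs : ∀ v, U.snd v = W.snd v) : U = W := by
  rw [← sub_eq_zero, ← norm_eq_zero, ← pow_eq_zero_iff two_ne_zero, norm_sq_state]
  simp [hf, hs]

/-- Complex conjugation in the state space. -/
theorem exists_conj (D : VertexConditions G) (hYd : ∀ v, ∀ x ∈ D.Yd v, reVec x ∈ D.Yd v) :
    ∃ J : D.State →SL[starRingEnd ℂ] D.State,
      (∀ U e, (J U).fst e =ᵐ[volume.restrict (Ioo 0 (G.len e))] fun x => conjVec (U.fst e x)) ∧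
      ∀ U v, ((J U).snd v : G.VertexVec v) = conjVec (U.snd v : G.VertexVec v) := by
  let j : D.State → D.State := fun U => WithLp.toLp 2 (WithLp.toLp 2 fun e => G.conjL2 e (U.fst e),
    WithLp.toLp 2 fun v => ⟨conjVec (U.snd v : G.VertexVec v), conjVec_mem (hYd v) (U.snd v).2⟩)
  have h1 : ∀ U e, (j U).fst e =ᵐ[volume.restrict (Ioo 0 (G.len e))]
    fun x => conjVec (U.fst e x) := fun U e => G.coeFn_conjL2 e (U.fst e)
  have h2 : ∀ U v, ((j U).snd v : G.VertexVec v) = conjVec (U.snd v : G.VertexVec v) :=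
    fun _ _ => rfl
  let J : D.State →ₛₗ[starRingEnd ℂ] D.State :=
    { toFun := j
      map_add' := fun U W => by
        refine D.ext_state (fun e => Lp.ext ?_) fun v => Subtype.ext ?_
        · rw [WithLp.add_fst, PiLp.add_apply]
          filter_upwards [h1 (U + W) e, h1 U e, h1 W e, Lp.coeFn_add ((j U).fst e) ((j W).fst e),
            Lp.coeFn_add (U.fst e) (W.fst e)] with x e1 e2 e3 e4 e5
          rw [e1, e4, Pi.add_apply, e2, e3, ← conjVec_add, WithLp.add_fst, PiLp.add_apply, e5,
            Pi.add_apply]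
        · rw [WithLp.add_snd, PiLp.add_apply, Submodule.coe_add, h2, h2, h2, ← conjVec_add]
          rfl
      map_smul' := fun a U => by
        refine D.ext_state (fun e => Lp.ext ?_) fun v => Subtype.ext ?_
        · rw [WithLp.smul_fst, PiLp.smul_apply]
          filter_upwards [h1 (a • U) e, h1 U e, Lp.coeFn_smul (starRingEnd ℂ a) ((j U).fst e),
            Lp.coeFn_smul a (U.fst e)] with x e1 e2 e3 e4
          rw [e1, e3, Pi.smul_apply, e2, ← conjVec_smul, WithLp.smul_fst, PiLp.smul_apply, e4,
            Pi.smul_apply]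
        · rw [WithLp.smul_snd, PiLp.smul_apply, Submodule.coe_smul, h2, h2, ← conjVec_smul]
          rfl }
  refine ⟨J.mkContinuous 1 fun U => ?_, h1, h2⟩
  rw [one_mul]
  refine abs_le_of_sq_le_sq' ?_ (norm_nonneg _) |>.2
  rw [norm_sq_state, norm_sq_state]
  refine add_le_add (Finset.sum_le_sum fun e _ => ?_) (Finset.sum_le_sum fun v _ => ?_)
  · exact pow_le_pow_left₀ (norm_nonneg _) (G.norm_conjL2_le e _) 2
  · refine pow_le_pow_left₀ (norm_nonneg _) (le_of_eq ?_) 2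
    exact norm_conjVec (U.snd v : G.VertexVec v)

theorem trace_conjVec (v : V) (f : ∀ e, ℝ → G.EdgeVec e) :
    G.trace v (fun e x => conjVec (f e x)) = conjVec (G.trace v f) := rfl

/-- Conjugation is continuous and real linear, so it carries primitives to primitives. It commutes
with evaluation at the endpoints, with the real coefficients and vertex operators, and with the
projectors onto real subspaces. -/
theorem IsA.conj {D : VertexConditions G} {K : EdgeCoefficients G} {U W : D.State}
    (h : D.IsA K U W) (hY : ∀ v, ∀ ξ ∈ D.Y v, reVec ξ ∈ D.Y v)
    (hYd : ∀ v, ∀ x ∈ D.Yd v, reVec x ∈ D.Yd v)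
    (hB : ∀ v, IsRealOp (D.B v)) (hC : ∀ v, IsRealOp (D.C v))
    (hM : ∀ e, ∀ x ∈ Icc 0 (G.len e), IsRealMatrix (K.M e x))
    (hN : ∀ e, ∀ᵐ x ∂(volume.restrict (Ioo 0 (G.len e))), IsRealMatrix (K.N e x))
    {J : D.State → D.State}
    (hJ₁ : ∀ U e, (J U).fst e =ᵐ[volume.restrict (Ioo 0 (G.len e))] fun x => conjVec (U.fst e x))
    (hJ₂ : ∀ U v, ((J U).snd v : G.VertexVec v) = conjVec (U.snd v : G.VertexVec v)) :
    D.IsA K (J U) (J W) := by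
  rw [isA_iff] at h ⊢
  obtain ⟨f, g, h1, h2, h3⟩ := h
  refine ⟨fun e x => conjVec (f e x), fun e => G.conjL2 e (g e), fun e => ⟨?_, ?_⟩, fun e => ?_,
    fun v => ?_⟩
  · filter_upwards [hJ₁ U e, (h1 e).1] with x e1 e2
    rw [e1, e2]
  · exact ((h1 e).2.map conjCLM).congr_ae (G.len_pos e).le (G.coeFn_conjL2 e (g e)).symm
  · filter_upwards [hJ₁ W e, h2 e, G.coeFn_conjL2 e (g e), hN e, ae_restrict_mem measurableSet_Ioo]
      with x e1 e2 e3 e4 hx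
    have e5 := matOp_conjVec (hM e x (Ioo_subset_Icc_self hx)) (g e x)
    have e6 := matOp_conjVec e4 (f e x)
    rw [e1, e2, e3, conjVec_add]
    exact congrArg₂ (· + ·) e5.symm e6.symm
  · obtain ⟨hU, hmem, hW⟩ := h3 v
    rw [trace_conjVec]
    refine ⟨Subtype.ext ?_, conjVec_mem (hY v) hmem, Subtype.ext ?_⟩
    · rw [hJ₂, hU]
      exact (starProjection_conjVec (hYd v) (G.trace v f)).symm
    · have e1 := (hB v).apply_conjVec (hY v) hmem (conjVec_mem (hY v) hmem)
      have e2 := (hC v).apply_conjVec (hYd v) (U.snd v).2 (conjVec_mem (hYd v) (U.snd v).2)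
      have e3 : (J U).snd v = ⟨conjVec (U.snd v : G.VertexVec v),
        conjVec_mem (hYd v) (U.snd v).2⟩ := Subtype.ext (hJ₂ U v)
      rw [hJ₂, hW, Submodule.coe_add, Submodule.coe_add, conjVec_add, e1, e3, e2]

theorem isRealState_iff {D : VertexConditions G} {J : D.State → D.State}
    (hJ₁ : ∀ U e, (J U).fst e =ᵐ[volume.restrict (Ioo 0 (G.len e))] fun x => conjVec (U.fst e x))
    (hJ₂ : ∀ U v, ((J U).snd v : G.VertexVec v) = conjVec (U.snd v : G.VertexVec v))
    (U : D.State) : D.IsRealState U ↔ J U = U := by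
  constructor
  · rintro ⟨h1, h2⟩
    refine D.ext_state (fun e => Lp.ext ?_) fun v => Subtype.ext ?_
    · filter_upwards [hJ₁ U e, h1 e] with x e1 e2
      rw [e1, (conjVec_eq_iff _).2 e2]
    · rw [hJ₂, (conjVec_eq_iff _).2 (h2 v)]
  · intro h
    refine ⟨fun e => ?_, fun v => ?_⟩
    · have h1 := hJ₁ U e
      rw [h] at h1
      filter_upwards [h1] with x hx
      exact (conjVec_eq_iff _).1 hx.symm
    · have h2 := hJ₂ U v
      rw [h] at h2
      exact (conjVec_eq_iff _).1 h2.symm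

theorem conj_conj {D : VertexConditions G} {J : D.State → D.State}
    (hJ₁ : ∀ U e, (J U).fst e =ᵐ[volume.restrict (Ioo 0 (G.len e))] fun x => conjVec (U.fst e x))
    (hJ₂ : ∀ U v, ((J U).snd v : G.VertexVec v) = conjVec (U.snd v : G.VertexVec v))
    (U : D.State) : J (J U) = U := by
  refine D.ext_state (fun e => Lp.ext ?_) fun v => Subtype.ext ?_
  · filter_upwards [hJ₁ (J U) e, hJ₁ U e] with x e1 e2
    rw [e1, e2, conjVec_conjVec]
  · rw [hJ₂, hJ₂, conjVec_conjVec]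

end VertexConditions

end RealSemigroup

theorem mainTheorem6 {V E : Type*} [Fintype V] [Fintype E] [DecidableEq V] [DecidableEq E]
    (G : Network V E) (K : EdgeCoefficients G) (D : VertexConditions G)
    (hY : ∀ v, ∀ ξ ∈ D.Y v, reVec ξ ∈ D.Y v)
    (hYd : ∀ v, ∀ x ∈ D.Yd v, reVec x ∈ D.Yd v)
    (hQe : ∀ e, ∀ x ∈ Set.Icc 0 (G.len e), IsRealMatrix (K.Q e x))
    (hQv : ∀ v, IsRealOp (D.Q v))
    (hB : ∀ v, IsRealOp (D.B v))
    (hC : ∀ v, IsRealOp (D.C v))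
    (hM : ∀ e, ∀ x ∈ Set.Icc 0 (G.len e), IsRealMatrix (K.M e x))
    (hN : ∀ e, ∀ᵐ x ∂(MeasureTheory.volume.restrict (Set.Ioo 0 (G.len e))),
      IsRealMatrix (K.N e x)) :
    (D.WellPosedHyp₁ K ∨ D.WellPosedHyp₂' K →
      ∃! S : NNReal → D.State →L[ℂ] D.State, IsSemigroupGeneratedBy S (D.IsA K)) ∧
    (D.WellPosedHyp₁ K ∨ D.WellPosedHyp₂ K →
      ∀ S : NNReal → D.State →L[ℂ] D.State, IsSemigroupGeneratedBy S (D.IsA K) →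
        ∀ t U, D.IsRealState U → D.IsRealState (S t U)) := by
  refine ⟨fun h => ?_, fun _ S hS t U hU => ?_⟩
  · rcases h with h | h
    · exact D.existsUnique_semigroup K h.2 h.1.finrank_le
    · exact D.existsUnique_semigroup K (fun v => (h v).1) h.finrank_le
  -- Real states are the fixed points of `J`, and `S t` commutes with `J`.
  · obtain ⟨J, hJ₁, hJ₂⟩ := D.exists_conj hYd
    rw [VertexConditions.isRealState_iff hJ₁ hJ₂] at hU ⊢
    rw [← hS.apply_conj J (VertexConditions.conj_conj hJ₁ hJ₂)
      (fun h => h.conj hY hYd hB hC hM hN hJ₁ hJ₂), hU]
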